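/- **Setting.** Let $\theta_0>0$, $\beta=\theta_0/2\pi-1$, $R>0$, $U=\{z\in\mathbb C:|z|<R\}$, $U^*=U\setminus\{0\}$. Let $h=|z|^{2\beta}e^{2\xi}|dz|^2$ be a hyperbolic metric on $U$ with a cone singularity of angle $\theta_0$ at $p=0$: $h$ is smooth with curvature $-1$ on $U^*$, and $\xi$ is continuous on $U$. Let $d_h$ be the distance of $h$ on $U$, $r(z)=d_h(0,z)$, and let $\nabla$ be the Levi-Civita connection of $h$. A *Codazzi operator* on $U^*$ is a smooth $h$-self-adjoint field $b$ of endomorphisms of $TU^*$ with $d^\nabla b=0$, where $d^\nabla b(X,Y)=\nabla_X(bY)-\nabla_Y(bX)-b[X,Y]$; $\|b\|=(\operatorname{tr} b^2)^{1/2}$. For a holomorphic quadratic differential $q=f(z)\,dz^2$ on $U^*$, $b_q$ is the Codazzi operator defined by $\operatorname{Re} q(v,w)=h(b_q v,w)$. For a function $u$, $\mathrm{Hess}\,u=\nabla\operatorname{grad}u$ is regarded as an operator, and $\mathrm I$ is the identity. Let $\mathbb R^{2,1}$ be $\mathbb R^3$ with $\langle v,w\rangle=v_1w_1+v_2w_2-v_3w_3$,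 and $\mathbb H^2=\{\langle v,v\rangle=-1,\ v_3>0\}$. On the universal cover of $U^*$ let $\mathrm{dev}$ be a developing map into $\mathbb H^2$ (a local isometry), with holonomy $\mathrm{hol}:\pi_1(U^*)\cong\mathbb Z\to \mathrm{SO}_0(2,1)$, $\mathrm{dev}\circ\alpha=\mathrm{hol}(\alpha)\,\mathrm{dev}$. If $\hat u$ is a smooth function on the universal cover with $\mathrm{Hess}\,\hat u-\hat u\mathrm I$ equal to the lift of $b$, the cocycle $t$ defined by $\hat u-\hat u\circ\alpha^{-1}=\langle t_\alpha,\mathrm{dev}\rangle$ represents $\delta b\in H^1_{\mathrm{hol}}(\pi_1(U^*),\mathbb R^{2,1})$. We say that $\delta b$ is *trivial around $p$* if such cocycles exist and each of them is a coboundary: there is $t_0\in\mathbb R^{2,1}$ with $t_\alpha=\mathrm{hol}(\alpha)t_0-t_0$ for all $\alpha\in\pi_1(U^*)$. **Proposition.** Suppose $\theta_0\in(0,2\pi)$ and let $q$ be a holomorphic quadratic differential on $U^*$ with at most a simple pole at $0$. Then $\delta b_q$ is trivial around $p$, and there is a function $u$ on $U$, smooth on $U^*$, with $b_q=\mathrm{Hess}\,u-u\,\mathrm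 I$ on $U^*$, which is Lipschitz for $d_h$ on $\{|z|<\rho\}$ for every $\rho<R$. **Lemma.** Let $\theta_0\in(0,\infty)$ and let $b$ be a Codazzi operator on $U^*$ such that $\|b(z)\|<C\,r(z)^\alpha$ on $U^*$ for some constants $C$ and $\alpha>-2$. Suppose that $\theta_0$ is not an integer multiple of $2\pi$, or that $\alpha>-1$. Then $\delta b$ is trivial around $p$, and there is a function $u$ on $U$, smooth on $U^*$, with $b=\mathrm{Hess}\,u-u\,\mathrm I$ on $U^*$, such that for every $\rho<R$, on the disc $\{|z|<\rho\}$: - $u\in W^{1,2}(h)$: $u$ and $\|du\|_h$, with $du$ the weak differential, are in $L^2(h)$; - $u$ is Hölder continuous for $d_h$ with every exponent $\gamma\in(0,1)$ such that $\gamma\le\alpha+2$; - if $\alpha>-1$, then $u$ is Lipschitz for $d_h$. -/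

import Mathlib

open MeasureTheory Set
open scoped ContDiff ENNReal NNReal

namespace ConeCodazzi

noncomputable section

/-! ### Conformal metrics on planar domains

A function `φ` stands for the conformal metric `h = e^{2φ} |dz|²`. Tangent vectors of the plane are
complex numbers. -/

/-- The metric `h_z(v, w) = e^{2φ(z)} ⟨v, w⟩`. -/
def metric (φ : ℂ → ℝ) (z v w : ℂ) : ℝ := Real.exp (2 * φ z) * inner ℝ v w

/-- The Gauss curvature `-e^{-2φ} Δφ` of `h`. -/
def curvature (φ : ℂ → ℝ) (z : ℂ) : ℝ := -Real.exp (-2 * φ z) * Laplacian.laplacian φ z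

/-- The Levi-Civita covariant derivative at `z` of the vector field `Y` in the direction `v`:
`∇_v Y = D_v Y + dφ(v) Y + dφ(Y) v - ⟨v, Y⟩ grad φ`, the gradient of `φ` being Euclidean. -/
def nabla (φ : ℂ → ℝ) (Y : ℂ → ℂ) (z v : ℂ) : ℂ :=
  fderiv ℝ Y z v + fderiv ℝ φ z v • Y z + fderiv ℝ φ z (Y z) • v
    - (inner ℝ v (Y z) : ℝ) • gradient φ z

/-- The gradient of `u` with respect to `h`. -/
def hgrad (φ u : ℂ → ℝ) (z : ℂ) : ℂ := Real.exp (-2 * φ z) • gradient u z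

/-- The Hessian operator `Hess u = ∇ grad u` of `h`, applied to `v` at `z`. -/
def hess (φ u : ℂ → ℝ) (z v : ℂ) : ℂ := nabla φ (hgrad φ u) z v

/-- `b = Hess u - u I` on `Ω`. -/
def IsHessSub (φ : ℂ → ℝ) (Ω : Set ℂ) (b : ℂ → ℂ →L[ℝ] ℂ) (u : ℂ → ℝ) : Prop :=
  ∀ z ∈ Ω, ∀ v : ℂ, b z v = hess φ u z v - u z • v

/-- Codazzi operators on `Ω`: smooth, self-adjoint, with `d^∇ b = 0`. The Codazzi equation is
evaluated on constant vector fields `v`, `w`, whose bracket is zero. -/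
structure IsCodazzi (φ : ℂ → ℝ) (Ω : Set ℂ) (b : ℂ → ℂ →L[ℝ] ℂ) : Prop where
  smooth : ContDiffOn ℝ ∞ b Ω
  selfAdjoint : ∀ z ∈ Ω, ∀ v w : ℂ, metric φ z (b z v) w = metric φ z v (b z w)
  codazzi : ∀ z ∈ Ω, ∀ v w : ℂ,
    nabla φ (fun ζ => b ζ w) z v - nabla φ (fun ζ => b ζ v) z w = 0

/-- The norm `‖b‖ = (tr b²)^{1/2}` of a self-adjoint operator. -/
def opNorm (b : ℂ →L[ℝ] ℂ) : ℝ :=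
  Real.sqrt (LinearMap.trace ℝ ℂ ((b.comp b : ℂ →L[ℝ] ℂ) : ℂ →ₗ[ℝ] ℂ))

/-! ### Hyperbolic discs with a cone point -/

/-- The coordinate disc `|z| < R`. -/
def disc (R : ℝ) : Set ℂ := Metric.ball 0 R

/-- The disc without the cone point. -/
def pdisc (R : ℝ) : Set ℂ := disc R \ {0}

/-- `e^{2φ}|dz|²` is a hyperbolic metric on the disc `|z| < R` with a cone singularity of angle `θ₀`
at `0`: it is smooth of curvature `-1` off `0`, and equals `|z|^{2β} e^{2ξ} |dz|²` with
`β = θ₀ / 2π - 1` and `ξ` continuous on the whole disc. -/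
structure IsHyperbolicCone (θ₀ R : ℝ) (φ : ℂ → ℝ) : Prop where
  smooth : ContDiffOn ℝ ∞ φ (pdisc R)
  hyperbolic : ∀ z ∈ pdisc R, curvature φ z = -1
  cone : ∃ ξ : ℂ → ℝ, ContinuousOn ξ (disc R) ∧
    ∀ z ∈ pdisc R, φ z = (θ₀ / (2 * Real.pi) - 1) * Real.log ‖z‖ + ξ z

/-- The distance of `h` on the disc of radius `R`: the infimum of the lengths of `C¹` paths. The
value of `φ` at `0` plays no role: a `C¹` path has velocity zero at almost every time spent
at `0`. -/
def hdist (φ : ℂ → ℝ) (R : ℝ) (x y : ℂ) : ℝ≥0∞ :=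
  ⨅ (γ : ℝ → ℂ) (_ : ContDiffOn ℝ 1 γ (Icc 0 1)) (_ : ∀ t ∈ Icc (0 : ℝ) 1, γ t ∈ disc R)
    (_ : γ 0 = x) (_ : γ 1 = y),
    ∫⁻ t in Icc (0 : ℝ) 1, ENNReal.ofReal (Real.exp (φ (γ t)) * ‖derivWithin γ (Icc 0 1) t‖)

/-- The distance `r` from the cone point. -/
def coneDist (φ : ℂ → ℝ) (R : ℝ) (z : ℂ) : ℝ := (hdist φ R 0 z).toReal

/-- `u` is Hölder continuous of exponent `γ` for the distance of `h`, on every smaller concentric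
disc. For `γ = 1` this is Lipschitz continuity. -/
def IsLocallyHolder (φ : ℂ → ℝ) (R γ : ℝ) (u : ℂ → ℝ) : Prop :=
  ∀ ρ < R, ∃ K : ℝ≥0, ∀ x ∈ disc ρ, ∀ y ∈ disc ρ, edist (u x) (u y) ≤ K * hdist φ R x y ^ γ

/-- `u ∈ W^{1,2}(h)` on `Ω`: `u` is in `L²(h)` and has a weak differential `η ↦ ⟨G, η⟩` across the
whole of `Ω`, whose `h`-norm `e^{-φ}‖G‖` is in `L²(h)`. The area form of `h` is `e^{2φ} dx dy`. -/
def MemW12 (φ : ℂ → ℝ) (Ω : Set ℂ) (u : ℂ → ℝ) : Prop :=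
  LocallyIntegrableOn u Ω ∧
  IntegrableOn (fun z => u z ^ 2 * Real.exp (2 * φ z)) Ω ∧
  ∃ G : ℂ → ℂ, LocallyIntegrableOn G Ω ∧
    (∀ η : ℂ → ℝ, ContDiff ℝ ∞ η → HasCompactSupport η → tsupport η ⊆ Ω → ∀ v : ℂ,
      ∫ z in Ω, u z * fderiv ℝ η z v = -∫ z in Ω, (inner ℝ (G z) v : ℝ) * η z) ∧
    IntegrableOn (fun z => (Real.exp (-φ z) * ‖G z‖) ^ 2 * Real.exp (2 * φ z)) Ω

/-! ### The operator of a quadratic differential -/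

/-- The operator `b_q` of the quadratic differential `q = f(z) dz²`: the one with
`Re q(v, w) = h(b_q v, w)`, see `re_eq_metric_bq`. -/
def bq (φ : ℂ → ℝ) (f : ℂ → ℂ) (z : ℂ) : ℂ →L[ℝ] ℂ :=
  Real.exp (-2 * φ z) •
    ((Complex.conjCLE : ℂ →L[ℝ] ℂ).comp (ContinuousLinearMap.mul ℝ ℂ (f z)))

theorem re_eq_metric_bq (φ : ℂ → ℝ) (f : ℂ → ℂ) (z v w : ℂ) :
    (f z * v * w).re = metric φ z (bq φ f z v) w := by
  have h : Real.exp (2 * φ z) * Real.exp (-2 * φ z) = 1 := by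
    rw [← Real.exp_add]; simp
  have e : metric φ z (bq φ f z v) w
      = Real.exp (2 * φ z) * Real.exp (-2 * φ z) * (f z * v * w).re := by
    simp only [metric, bq, FunLike.coe_smul, Pi.smul_apply, inner_smul_left]
    simp [Complex.inner]
    ring
  rw [e, h, one_mul]

/-! ### Minkowski space, developing maps and the cocycle of a Codazzi operator -/

/-- The vector space underlying Minkowski space `ℝ^{2,1}`. -/
abbrev Mink : Type := Fin 3 → ℝ

/-- The Minkowski product. -/
def mink (v w : Mink) : ℝ := v 0 * w 0 + v 1 * w 1 - v 2 * w 2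

/-- The hyperboloid model of the hyperbolic plane. -/
def hyperboloid : Set Mink := {v | mink v v = -1 ∧ 0 < v 2}

/-- `A ∈ SO₀(2,1)`. -/
structure IsSO0 (A : Mink ≃ₗ[ℝ] Mink) : Prop where
  isometry : ∀ v w : Mink, mink (A v) (A w) = mink v w
  det_eq_one : LinearMap.det (A : Mink →ₗ[ℝ] Mink) = 1
  orthochronous : ∀ v ∈ hyperboloid, A v ∈ hyperboloid

/-- The universal cover of the punctured disc of radius `R`: a half-plane, with covering map
`exp`. The generator of the deck group is `w ↦ w + 2πi`. -/
def cover (R : ℝ) : Set ℂ := {w | w.re < Real.log R}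

/-- The generator `w ↦ w + 2πi` of the deck group, raised to the power `n`. -/
def deck (n : ℤ) (w : ℂ) : ℂ := w + n * (2 * Real.pi * Complex.I)

/-- The pull-back of the metric `e^{2φ}|dz|²` by `exp` is `e^{2 liftMetric φ}|dw|²`. -/
def liftMetric (φ : ℂ → ℝ) (w : ℂ) : ℝ := φ (Complex.exp w) + w.re

/-- The pull-back of the operator `b` by `exp`, whose differential at `w` is multiplication by
`exp w`. -/
def liftOp (b : ℂ → ℂ →L[ℝ] ℂ) (w : ℂ) : ℂ →L[ℝ] ℂ :=
  (ContinuousLinearMap.mul ℝ ℂ (Complex.exp (-w))).comp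
    ((b (Complex.exp w)).comp (ContinuousLinearMap.mul ℝ ℂ (Complex.exp w)))

/-- `dev` is a developing map: a local isometry from the universal cover to the hyperbolic
plane. -/
structure IsDevelopingMap (φ : ℂ → ℝ) (R : ℝ) (dev : ℂ → Mink) : Prop where
  smooth : ContDiffOn ℝ ∞ dev (cover R)
  maps : ∀ w ∈ cover R, dev w ∈ hyperboloid
  isometric : ∀ w ∈ cover R, ∀ v₁ v₂ : ℂ,
    mink (fderiv ℝ dev w v₁) (fderiv ℝ dev w v₂) = metric (liftMetric φ) w v₁ v₂

/-- `A` is the holonomy of the generator of the fundamental group of the punctured disc, and `t` is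
a cocycle (`t n` being its value on the `n`-th power of the generator) that represents `δ b`: for
some developing map `dev` with holonomy `A` and some smooth `û` on the universal cover with
`Hess û - û I` the lift of `b`, one has `û - û ∘ α⁻¹ = ⟨t_α, dev⟩` for every deck
transformation `α`. -/
def RepresentsDelta (φ : ℂ → ℝ) (R : ℝ) (b : ℂ → ℂ →L[ℝ] ℂ) (A : Mink ≃ₗ[ℝ] Mink)
    (t : ℤ → Mink) : Prop :=
  IsSO0 A ∧ ∃ (dev : ℂ → Mink) (u : ℂ → ℝ), IsDevelopingMap φ R dev ∧
    (∀ w ∈ cover R, dev (deck 1 w) = A (dev w)) ∧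
    ContDiffOn ℝ ∞ u (cover R) ∧
    IsHessSub (liftMetric φ) (cover R) (liftOp b) u ∧
    ∀ n : ℤ, ∀ w ∈ cover R, u w - u (deck (-n) w) = mink (t n) (dev w)

/-- `δ b` is trivial around the puncture: it has representing cocycles, and each of them is a
coboundary. -/
def DeltaTrivial (φ : ℂ → ℝ) (R : ℝ) (b : ℂ → ℂ →L[ℝ] ℂ) : Prop :=
  (∃ A t, RepresentsDelta φ R b A t) ∧
  ∀ A t, RepresentsDelta φ R b A t → ∃ t₀ : Mink, ∀ n : ℤ, t n = (A ^ n) t₀ - t₀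

end

end ConeCodazzi

open MeasureTheory Set
open scoped ContDiff ENNReal NNReal

namespace ConeCodazzi

noncomputable section

/-! ### Algebra of Minkowski space -/

/-! Scalar functions are traded for vectors of Minkowski space. Pull everything back by `exp` to a
half-plane and let `dev` be a developing map there. To a function u attach F = dev_*(grad u) -
u·dev. Then u = ⟨F, dev⟩ and dF = dev_* ∘ (Hess u - u I). Solving b = Hess u - u I on the cover thus
means finding a primitive of the vector-valued 1-form dev_* b. The tangential part of its exterior
derivative vanishes by the Codazzi equation and the normal part by self-adjointness, so the Poincaré
lemma on the convex half-plane gives F, unique up to a translation (`IsLocalIso.exists_isPrimitive`,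
`IsLocalIso.IsPrimitive.exists_eq_add`). If A is the holonomy, then F(w + 2πi) = A F(w) + t. The
function descends to the punctured disc once F is translated so that t = 0, and a single-valued
solution makes every representing cocycle a coboundary (`deltaTrivial_of_isHessSub`).

The translation is found at the cone point (`IsLocalIso.exists_equivariant_primitive`). Put l =
θ₀/2π. In the logarithmic coordinate the metric factor is O(e^{l Re w}) and ‖b‖ is O(e^{lα Re w}),
so `dev` converges to a point p fixed by A, and dF = O(e^{l(α+1) Re w}). If α > -1, F converges to a
fixed point q of x ↦ A x + t, and q is subtracted. If α ≤ -1, F need not converge, but dF is tangent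
to the hyperboloid at `dev`, so d⟨F, p⟩ gains a factor e^{l Re w}. Since α > -2, ⟨F, p⟩ has a limit
and t is orthogonal to p. When A ≠ 1, the map A - 1 is invertible on the orthogonal complement of p,
which solves A s - s = t. The holonomy is nontrivial unless θ₀ is a multiple of 2π: otherwise the
Liouville function would be a bounded single-valued holomorphic function whose derivative has size
|z|^{l-1}, so l - 1 would be a natural number (`exists_nat_of_periodic`).

The developing map comes from Liouville's theorem (`IsHyperbolicOn.exists_liouville`): for
e^{2ψ}|dw|² of curvature -1 the function Q = ∂²ψ - (∂ψ)² is holomorphic, and a suitable quotient of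
two solutions of y'' = -Q y maps isometrically to the unit disc.

Regularity follows from du = ⟨F, d dev⟩, which gives u - u(0) = O(|z|^{lγ}) and du = O(|z|^{lγ-1}).
Since the distance r to the cone point is comparable with |z|^l, this is growth of order r^γ.
Integration along paths yields the Hölder and Lipschitz bounds, and conformal invariance of the
Dirichlet energy yields W^{1,2}. For the proposition, a simple pole gives ‖b_q‖ = O(r^α) with α = -2
+ 1/l, and α > -1 exactly when θ₀ < 2π. -/

theorem mink_comm (v w : Mink) : mink v w = mink w v := by simp only [mink]; ring

theorem mink_add_left (u v w : Mink) : mink (u + v) w = mink u w + mink v w := by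
  simp only [mink, Pi.add_apply]; ring

theorem mink_sub_left (u v w : Mink) : mink (u - v) w = mink u w - mink v w := by
  simp only [mink, Pi.sub_apply]; ring

theorem mink_smul_left (c : ℝ) (v w : Mink) : mink (c • v) w = c * mink v w := by
  simp only [mink, Pi.smul_apply, smul_eq_mul]; ring

theorem mink_add_right (u v w : Mink) : mink w (u + v) = mink w u + mink w v := by
  simp only [mink, Pi.add_apply]; ring

theorem mink_sub_right (u v w : Mink) : mink w (u - v) = mink w u - mink w v := by
  simp only [mink, Pi.sub_apply]; ring

theorem mink_smul_right (c : ℝ) (v w : Mink) : mink w (c • v) = c * mink w v := by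
  simp only [mink, Pi.smul_apply, smul_eq_mul]; ring

/-- The Minkowski product as a continuous bilinear map. -/
def minkL : Mink →L[ℝ] Mink →L[ℝ] ℝ :=
  LinearMap.toContinuousLinearMap
    { toFun := fun v => LinearMap.toContinuousLinearMap
        { toFun := fun w => mink v w
          map_add' := fun a b => mink_add_right a b v
          map_smul' := fun c a => mink_smul_right c a v }
      map_add' := fun a b => by ext1 w; exact mink_add_left a b w
      map_smul' := fun c a => by ext1 w; exact mink_smul_left c a w }

@[simp] theorem minkL_apply (v w : Mink) : minkL v w = mink v w := rfl

/-- The determinant of three vectors. -/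
def det3 (a b c : Mink) : ℝ :=
  a 0 * (b 1 * c 2 - b 2 * c 1) - a 1 * (b 0 * c 2 - b 2 * c 0) + a 2 * (b 0 * c 1 - b 1 * c 0)

/-- The square of the determinant is minus the Gram determinant, because the matrix of the Minkowski
form has determinant -1. -/
theorem det3_sq (a b c : Mink) :
    det3 a b c ^ 2 = -(mink a a * (mink b b * mink c c - mink b c ^ 2)
      - mink a b * (mink a b * mink c c - mink b c * mink a c)
      + mink a c * (mink a b * mink b c - mink b b * mink a c)) := by
  simp only [det3, mink]; ring

/-- Cramer's rule: the coefficients in the linear combinations are cofactors of the matrix with rows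
a, b, c. -/
theorem eq_zero_of_det3 {a b c x : Mink} (h : det3 a b c ≠ 0) (ha : mink a x = 0)
    (hb : mink b x = 0) (hc : mink c x = 0) : x = 0 := by
  have h0 : det3 a b c * x 0 = 0 := by
    simp only [det3, mink] at *
    linear_combination (b 1 * c 2 - b 2 * c 1) * ha - (a 1 * c 2 - a 2 * c 1) * hb
      + (a 1 * b 2 - a 2 * b 1) * hc
  have h1 : det3 a b c * x 1 = 0 := by
    simp only [det3, mink] at *
    linear_combination -(b 0 * c 2 - b 2 * c 0) * ha + (a 0 * c 2 - a 2 * c 0) * hb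
      - (a 0 * b 2 - a 2 * b 0) * hc
  have h2 : det3 a b c * x 2 = 0 := by
    simp only [det3, mink] at *
    linear_combination -(b 0 * c 1 - b 1 * c 0) * ha + (a 0 * c 1 - a 1 * c 0) * hb
      - (a 0 * b 1 - a 1 * b 0) * hc
  ext i
  fin_cases i
  · exact (mul_eq_zero.1 h0).resolve_left h
  · exact (mul_eq_zero.1 h1).resolve_left h
  · exact (mul_eq_zero.1 h2).resolve_left h

/-- The determinant of a linear map scales `det3`. -/
theorem det3_map (A : Mink →ₗ[ℝ] Mink) (a b c : Mink) :
    det3 (A a) (A b) (A c) = LinearMap.det A * det3 a b c := by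
  have key : ∀ x y z : Mink, det3 x y z = Matrix.det (Matrix.of ![x, y, z]) := by
    intro x y z
    rw [Matrix.det_fin_three]
    simp [det3]; ring
  have hA : ∀ x, A x = (LinearMap.toMatrix' A).mulVec x := fun x => by
    rw [← Matrix.toLin'_apply, Matrix.toLin'_toMatrix']
  -- The three vectors are rows, so `A` acts by its transpose on the right.
  have hM : Matrix.of ![A a, A b, A c]
      = Matrix.of ![a, b, c] * (LinearMap.toMatrix' A).transpose := by
    ext i j
    rw [Matrix.mul_apply]
    fin_cases i
    · exact (congrFun (hA a) j).trans (dotProduct_comm _ _)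
    · exact (congrFun (hA b) j).trans (dotProduct_comm _ _)
    · exact (congrFun (hA c) j).trans (dotProduct_comm _ _)
  rw [key, key, hM, Matrix.det_mul, Matrix.det_transpose, LinearMap.det_toMatrix', mul_comm]

/-- A conformal frame `(a, b)` of the tangent plane at the point `x` of the hyperboloid. -/
theorem det3_frame {a b x : Mink} {c : ℝ} (haa : mink a a = c) (hbb : mink b b = c)
    (hab : mink a b = 0) (hax : mink a x = 0) (hbx : mink b x = 0) (hxx : mink x x = -1) :
    det3 a b x ^ 2 = c ^ 2 := by
  rw [det3_sq, haa, hbb, hab, hax, hbx, hxx]; ring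

theorem one_le_of_mem_hyperboloid {x : Mink} (hx : x ∈ hyperboloid) : 1 ≤ x 2 := by
  have h := hx.1
  simp only [mink] at h
  nlinarith [hx.2, sq_nonneg (x 0), sq_nonneg (x 1)]

/-- Reversed Cauchy–Schwarz inequality, from Lagrange's identity for the horizontal parts of x and
y. It distinguishes the two sheets, which is how orthochronicity is proved later. -/
theorem mink_neg_of_mem {x y : Mink} (hx : x ∈ hyperboloid) (hy : y ∈ hyperboloid) :
    mink x y < 0 := by
  obtain ⟨hx1, hx2⟩ := hx
  obtain ⟨hy1, hy2⟩ := hy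
  simp only [mink] at *
  have h1 : 0 < x 2 * y 2 := mul_pos hx2 hy2
  have h2 : (x 0 * y 0 + x 1 * y 1) ^ 2 < (x 2 * y 2) ^ 2 := by
    have e : (x 0 * y 0 + x 1 * y 1) ^ 2 + (x 0 * y 1 - x 1 * y 0) ^ 2
        = (x 2 ^ 2 - 1) * (y 2 ^ 2 - 1) := by
      have hx3 : x 2 ^ 2 - 1 = x 0 ^ 2 + x 1 ^ 2 := by linarith
      have hy3 : y 2 ^ 2 - 1 = y 0 ^ 2 + y 1 ^ 2 := by linarith
      rw [hx3, hy3]; ring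
    have hx4 : 1 ≤ x 2 ^ 2 := by nlinarith [sq_nonneg (x 0), sq_nonneg (x 1)]
    have hy4 : 1 ≤ y 2 ^ 2 := by nlinarith [sq_nonneg (y 0), sq_nonneg (y 1)]
    nlinarith [sq_nonneg (x 0 * y 1 - x 1 * y 0)]
  linarith [lt_of_pow_lt_pow_left₀ 2 h1.le h2]

/-- Tangent vectors of the hyperboloid: comparison of the Minkowski and the sup norms. -/
theorem norm_le_of_tangent {x v : Mink} (hx : x ∈ hyperboloid) (hv : mink v x = 0) :
    ‖v‖ ≤ x 2 * Real.sqrt (mink v v) := by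
  have hx1 := hx.1
  have hx2 := hx.2
  have hx3 := one_le_of_mem_hyperboloid hx
  -- Lagrange's identity again: by tangency, x₂v₂ is the Euclidean product of the horizontal parts
  -- of x and v.
  have e2 : v 2 ^ 2 ≤ (x 2 ^ 2 - 1) * mink v v := by
    simp only [mink] at hx1 hv ⊢
    have e : (x 2 * v 2) ^ 2 + (x 0 * v 1 - x 1 * v 0) ^ 2
        = (x 2 ^ 2 - 1) * (v 0 ^ 2 + v 1 ^ 2) := by
      have h1 : x 2 * v 2 = x 0 * v 0 + x 1 * v 1 := by linarith
      have h2 : x 2 ^ 2 - 1 = x 0 ^ 2 + x 1 ^ 2 := by linarith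
      rw [h1, h2]; ring
    nlinarith [sq_nonneg (x 0 * v 1 - x 1 * v 0)]
  have hn : 0 ≤ mink v v := by
    by_contra! h
    have h2 : v 2 ^ 2 ≤ 0 := e2.trans (mul_nonpos_of_nonneg_of_nonpos (by nlinarith) h.le)
    simp only [mink] at h
    nlinarith [sq_nonneg (v 0), sq_nonneg (v 1)]
  have hs : v 0 ^ 2 + v 1 ^ 2 = mink v v + v 2 ^ 2 := by simp only [mink]; ring
  have hb : v 0 ^ 2 + v 1 ^ 2 ≤ x 2 ^ 2 * mink v v := by rw [hs]; linarith
  have fin : ∀ i, v i ^ 2 ≤ x 2 ^ 2 * mink v v := by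
    intro i
    fin_cases i
    · show v 0 ^ 2 ≤ _
      linarith [sq_nonneg (v 1)]
    · show v 1 ^ 2 ≤ _
      linarith [sq_nonneg (v 0)]
    · show v 2 ^ 2 ≤ _
      linarith
  refine (pi_norm_le_iff_of_nonneg (by positivity)).2 fun i => ?_
  rw [Real.norm_eq_abs]
  refine abs_le_of_sq_le_sq ?_ (by positivity)
  rw [mul_pow, Real.sq_sqrt hn]
  exact fin i

theorem abs_mink_le (a b : Mink) : |mink a b| ≤ 3 * ‖a‖ * ‖b‖ := by
  have h : ∀ i, |a i * b i| ≤ ‖a‖ * ‖b‖ := fun i => by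
    rw [abs_mul]
    exact mul_le_mul (norm_le_pi_norm a i) (norm_le_pi_norm b i) (abs_nonneg _) (norm_nonneg _)
  have h0 := abs_le.1 (h 0)
  have h1 := abs_le.1 (h 1)
  have h2 := abs_le.1 (h 2)
  rw [mink, abs_le]
  constructor <;> linarith [h0.1, h0.2, h1.1, h1.2, h2.1, h2.2]

/-- The Minkowski cross product. -/
def mcross (a b : Mink) : Mink :=
  ![a 1 * b 2 - a 2 * b 1, a 2 * b 0 - a 0 * b 2, -(a 0 * b 1 - a 1 * b 0)]

theorem mink_mcross (a b c : Mink) : mink (mcross a b) c = det3 a b c := by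
  simp [mink, mcross, det3]; ring

/-- An element of `SO₀(2,1)` that fixes two independent vectors is the identity. -/
theorem IsSO0.eq_refl_of_fixed {A : Mink ≃ₗ[ℝ] Mink} (hA : IsSO0 A) {p x : Mink}
    (hp : mink p p = -1) (hAp : A p = p) (hAx : A x = x) (hpx : mink x p = 0) (hx : 0 < mink x x) :
    ∀ v, A v = v := by
  -- The product of p × x with v is det(p, x, v), which A preserves because it fixes p and x and has
  -- determinant 1. Hence A v - v is orthogonal to p, x and p × x, which form a basis.
  have hcross : ∀ v, mink (mcross p x) v = mink (mcross p x) (A v) := by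
    intro v
    rw [mink_mcross, mink_mcross]
    have := det3_map (A : Mink →ₗ[ℝ] Mink) p x v
    rw [hA.det_eq_one, one_mul] at this
    simpa [hAp, hAx] using this.symm
  have hcc : mink (mcross p x) (mcross p x) = mink x x := by
    have : mink (mcross p x) (mcross p x) = -(mink p p * mink x x - mink x p ^ 2) := by
      simp [mink, mcross]; ring
    rw [this, hp, hpx]; ring
  have hdet : det3 p x (mcross p x) ≠ 0 := by
    rw [← mink_mcross, hcc]; exact hx.ne'
  intro v
  refine sub_eq_zero.1 (eq_zero_of_det3 hdet ?_ ?_ ?_)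
  · have := hA.isometry p v
    rw [hAp] at this
    rw [mink_sub_right, this, sub_self]
  · have := hA.isometry x v
    rw [hAx] at this
    rw [mink_sub_right, this, sub_self]
  · rw [mink_sub_right, ← hcross, sub_self]

/-- The orthogonal complement of a timelike vector is spacelike; the mechanism is Lagrange's
identity once more. -/
theorem mink_pos_of_orthogonal {p x : Mink} (hp : mink p p = -1) (hpx : mink x p = 0)
    (hx : x ≠ 0) : 0 < mink x x := by
  have e2 : p 2 ^ 2 * x 2 ^ 2 ≤ (p 2 ^ 2 - 1) * (x 0 ^ 2 + x 1 ^ 2) := by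
    simp only [mink] at hp hpx
    have e : (p 2 * x 2) ^ 2 + (p 0 * x 1 - p 1 * x 0) ^ 2
        = (p 2 ^ 2 - 1) * (x 0 ^ 2 + x 1 ^ 2) := by
      have h1 : p 2 * x 2 = p 0 * x 0 + p 1 * x 1 := by linarith
      have h2 : p 2 ^ 2 - 1 = p 0 ^ 2 + p 1 ^ 2 := by linarith
      rw [h1, h2]; ring
    nlinarith [sq_nonneg (p 0 * x 1 - p 1 * x 0)]
  have hp2 : 1 ≤ p 2 ^ 2 := by
    simp only [mink] at hp
    nlinarith [sq_nonneg (p 0), sq_nonneg (p 1)]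
  by_contra! h
  simp only [mink] at h
  apply hx
  have h01 : x 0 ^ 2 + x 1 ^ 2 ≤ 0 := by nlinarith
  have h0 : x 0 = 0 := by nlinarith [sq_nonneg (x 0), sq_nonneg (x 1)]
  have h1 : x 1 = 0 := by nlinarith [sq_nonneg (x 0), sq_nonneg (x 1)]
  have h2 : x 2 = 0 := by
    rw [h0, h1] at e2
    nlinarith [sq_nonneg (x 2)]
  ext i
  fin_cases i
  · exact h0
  · exact h1
  · exact h2

/-- A nontrivial rotation about `p` displaces some point by any given vector orthogonal to `p`. -/
theorem IsSO0.exists_sub_eq {A : Mink ≃ₗ[ℝ] Mink} (hA : IsSO0 A) {p t : Mink}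
    (hp : mink p p = -1) (hAp : A p = p) (hne : ∃ v, A v ≠ v) (ht : mink t p = 0) :
    ∃ s, A s - s = t := by
  set B : Mink →ₗ[ℝ] Mink := (A : Mink →ₗ[ℝ] Mink) - LinearMap.id with hB
  have hBa : ∀ v, B v = A v - v := fun v => rfl
  set P : Submodule ℝ Mink := LinearMap.ker (minkL p : Mink →ₗ[ℝ] ℝ) with hP
  have hPm : ∀ v, v ∈ P ↔ mink v p = 0 := fun v => by
    rw [hP, LinearMap.mem_ker, mink_comm]; rfl
  have hmaps : ∀ v, B v ∈ P := fun v => by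
    rw [hPm, hBa, mink_sub_left]
    have := hA.isometry v p
    rw [hAp] at this
    rw [this, sub_self]
  let C : P →ₗ[ℝ] P := (B.comp P.subtype).codRestrict P (fun v => hmaps v)
  -- A fixed vector orthogonal to p would force A = 1. So A - 1 is injective on the complement of p,
  -- hence surjective there by dimension.
  have hinj : Function.Injective C := by
    rw [injective_iff_map_eq_zero]
    intro x hx
    by_contra hx0
    have hAx : A x = x := sub_eq_zero.1 (congrArg Subtype.val hx : B x = 0)
    have hxp := (hPm x).1 x.2
    obtain ⟨v, hv⟩ := hne
    exact hv (hA.eq_refl_of_fixed hp hAp hAx hxp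
      (mink_pos_of_orthogonal hp hxp (fun h => hx0 (Subtype.ext h))) v)
  obtain ⟨s, hs⟩ := LinearMap.surjective_of_injective hinj ⟨t, (hPm t).2 ht⟩
  exact ⟨s, (congrArg Subtype.val hs : B s = t)⟩

/-! ### Local isometries into the hyperboloid -/

/-- `dev` is a local isometry of `(H, e^{2ψ}|dw|²)` into the hyperbolic plane. -/
structure IsLocalIso (ψ : ℂ → ℝ) (H : Set ℂ) (dev : ℂ → Mink) : Prop where
  isOpen : IsOpen H
  smooth_metric : ContDiffOn ℝ ∞ ψ H
  smooth : ContDiffOn ℝ ∞ dev H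
  maps : ∀ w ∈ H, dev w ∈ hyperboloid
  isometric : ∀ w ∈ H, ∀ v₁ v₂ : ℂ,
    mink (fderiv ℝ dev w v₁) (fderiv ℝ dev w v₂) = metric ψ w v₁ v₂

theorem metric_comm (ψ : ℂ → ℝ) (w u v : ℂ) : metric ψ w u v = metric ψ w v u := by
  simp only [metric, real_inner_comm]

theorem inner_gradient_left (f : ℂ → ℝ) (z v : ℂ) :
    inner ℝ (gradient f z) v = fderiv ℝ f z v := by
  simp [gradient]

/-- The Christoffel form of a conformal metric. -/
def christoffel (ψ : ℂ → ℝ) (w v x : ℂ) : ℂ :=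
  fderiv ℝ ψ w v • x + fderiv ℝ ψ w x • v - (inner ℝ v x : ℝ) • gradient ψ w

theorem nabla_eq (ψ : ℂ → ℝ) (Y : ℂ → ℂ) (w v : ℂ) :
    nabla ψ Y w v = fderiv ℝ Y w v + christoffel ψ w v (Y w) := by
  simp only [nabla, christoffel]; abel

theorem two_le_infty : (2 : WithTop ℕ∞) ≤ ((⊤ : ℕ∞) : WithTop ℕ∞) :=
  WithTop.coe_le_coe.2 (le_top : (2 : ℕ∞) ≤ ⊤)

theorem contDiffAt_top_of_infty {E F : Type*} [NormedAddCommGroup E] [NormedSpace ℝ E]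
    [NormedAddCommGroup F] [NormedSpace ℝ F] {f : E → F} {s : Set E} {x : E}
    (h : ContDiffOn ℝ ∞ f s) (hs : IsOpen s) (hx : x ∈ s) : ContDiffAt ℝ ∞ f x :=
  h.contDiffAt (hs.mem_nhds hx)

theorem differentiableAt_of_infty {E F : Type*} [NormedAddCommGroup E] [NormedSpace ℝ E]
    [NormedAddCommGroup F] [NormedSpace ℝ F] {f : E → F} {s : Set E} {x : E}
    (h : ContDiffOn ℝ ∞ f s) (hs : IsOpen s) (hx : x ∈ s) : DifferentiableAt ℝ f x :=
  (contDiffAt_top_of_infty h hs hx).differentiableAt (by simp)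

theorem contDiffOn_fderiv_infty {E F : Type*} [NormedAddCommGroup E] [NormedSpace ℝ E]
    [NormedAddCommGroup F] [NormedSpace ℝ F] {f : E → F} {s : Set E}
    (h : ContDiffOn ℝ ∞ f s) (hs : IsOpen s) : ContDiffOn ℝ ∞ (fderiv ℝ f) s :=
  ((contDiffOn_infty_iff_fderiv_of_isOpen hs).1 h).2

theorem contDiffOn_infty_of_hasFDerivAt {E F : Type*} [NormedAddCommGroup E] [NormedSpace ℝ E]
    [NormedAddCommGroup F] [NormedSpace ℝ F] {f : E → F} {f' : E → E →L[ℝ] F} {s : Set E}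
    (hs : IsOpen s) (h : ∀ x ∈ s, HasFDerivAt f (f' x) x) (h' : ContDiffOn ℝ ∞ f' s) :
    ContDiffOn ℝ ∞ f s := by
  rw [contDiffOn_infty_iff_fderiv_of_isOpen hs]
  exact ⟨fun x hx => (h x hx).differentiableAt.differentiableWithinAt,
    h'.congr fun x hx => (h x hx).fderiv⟩

theorem fderiv_mink {f g : ℂ → Mink} {w : ℂ} (hf : DifferentiableAt ℝ f w)
    (hg : DifferentiableAt ℝ g w) (v : ℂ) :
    fderiv ℝ (fun ζ => mink (f ζ) (g ζ)) w v
      = mink (fderiv ℝ f w v) (g w) + mink (f w) (fderiv ℝ g w v) := by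
  have h := (minkL.isBoundedBilinearMap.hasFDerivAt (f w, g w)).comp w
    (hf.hasFDerivAt.prodMk hg.hasFDerivAt)
  have h' : fderiv ℝ (fun ζ => mink (f ζ) (g ζ)) w = _ := h.fderiv
  rw [h']
  simp [add_comm]

theorem fderiv_metric_const {ψ : ℂ → ℝ} {w : ℂ} (hψ : DifferentiableAt ℝ ψ w) (u x v : ℂ) :
    fderiv ℝ (fun ζ => metric ψ ζ u x) w v = 2 * fderiv ℝ ψ w v * metric ψ w u x := by
  have h : HasFDerivAt (fun ζ => metric ψ ζ u x)
      ((inner ℝ u x : ℝ) • (Real.exp (2 * ψ w) • ((2 : ℝ) • fderiv ℝ ψ w))) w := by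
    exact ((hψ.hasFDerivAt.const_mul (2 : ℝ)).exp).mul_const (inner ℝ u x : ℝ)
  rw [h.fderiv]
  simp only [metric, FunLike.coe_smul, Pi.smul_apply, smul_eq_mul]
  ring

namespace IsLocalIso

variable {ψ : ℂ → ℝ} {H : Set ℂ} {dev : ℂ → Mink}

theorem differentiableAt (h : IsLocalIso ψ H dev) {w : ℂ} (hw : w ∈ H) :
    DifferentiableAt ℝ dev w :=
  differentiableAt_of_infty h.smooth h.isOpen hw

theorem differentiableAt_fderiv (h : IsLocalIso ψ H dev) {w : ℂ} (hw : w ∈ H) :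
    DifferentiableAt ℝ (fderiv ℝ dev) w :=
  differentiableAt_of_infty (contDiffOn_fderiv_infty h.smooth h.isOpen) h.isOpen hw

theorem mink_self (h : IsLocalIso ψ H dev) {w : ℂ} (hw : w ∈ H) : mink (dev w) (dev w) = -1 :=
  (h.maps w hw).1

theorem mink_fderiv (h : IsLocalIso ψ H dev) {w : ℂ} (hw : w ∈ H) (v : ℂ) :
    mink (fderiv ℝ dev w v) (dev w) = 0 := by
  have h1 : (fun ζ => mink (dev ζ) (dev ζ)) =ᶠ[nhds w] fun _ => (-1 : ℝ) := by
    filter_upwards [h.isOpen.mem_nhds hw] with ζ hζ using h.mink_self hζ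
  have h2 := fderiv_mink (h.differentiableAt hw) (h.differentiableAt hw) v
  rw [h1.fderiv_eq, mink_comm (dev w)] at h2
  simp at h2
  linarith

theorem det_frame_sq (h : IsLocalIso ψ H dev) {w : ℂ} (hw : w ∈ H) :
    det3 (fderiv ℝ dev w 1) (fderiv ℝ dev w Complex.I) (dev w) ^ 2 = Real.exp (2 * ψ w) ^ 2 := by
  refine det3_frame ?_ ?_ ?_ (h.mink_fderiv hw _) (h.mink_fderiv hw _) (h.mink_self hw) <;>
  · rw [h.isometric w hw]
    simp [metric, Complex.inner]

theorem det_frame_ne_zero (h : IsLocalIso ψ H dev) {w : ℂ} (hw : w ∈ H) :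
    det3 (fderiv ℝ dev w 1) (fderiv ℝ dev w Complex.I) (dev w) ≠ 0 := by
  intro h0
  have := h.det_frame_sq hw
  rw [h0] at this
  have := Real.exp_pos (2 * ψ w)
  nlinarith

/-- A vector of Minkowski space is determined by its products with the frame of `dev`. -/
theorem ext (h : IsLocalIso ψ H dev) {w : ℂ} (hw : w ∈ H) {x y : Mink}
    (h1 : ∀ v, mink x (fderiv ℝ dev w v) = mink y (fderiv ℝ dev w v))
    (h2 : mink x (dev w) = mink y (dev w)) : x = y := by
  refine sub_eq_zero.1 (eq_zero_of_det3 (h.det_frame_ne_zero hw) ?_ ?_ ?_) <;>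
    rw [mink_sub_right, mink_comm, mink_comm _ y, sub_eq_zero]
  exacts [h1 _, h1 _, h2]

theorem fderiv_fderiv_comm (h : IsLocalIso ψ H dev) {w : ℂ} (hw : w ∈ H) (v x : ℂ) :
    fderiv ℝ (fderiv ℝ dev) w v x = fderiv ℝ (fderiv ℝ dev) w x v := by
  have := (contDiffAt_top_of_infty h.smooth h.isOpen hw).isSymmSndFDerivAt
    (by simpa using two_le_infty)
  exact this v x

/-- The second derivative of a local isometry: its tangential part is given by the Christoffel
form, its normal part by the metric. -/
theorem fderiv_fderiv (h : IsLocalIso ψ H dev) {w : ℂ} (hw : w ∈ H) (v x : ℂ) :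
    fderiv ℝ (fderiv ℝ dev) w v x
      = fderiv ℝ dev w (christoffel ψ w v x) + metric ψ w v x • dev w := by
  have hψ := differentiableAt_of_infty h.smooth_metric h.isOpen hw
  have hd := h.differentiableAt_fderiv hw
  have happ : ∀ x v, fderiv ℝ (fun ζ => fderiv ℝ dev ζ x) w v
      = fderiv ℝ (fderiv ℝ dev) w v x := fun x v => by
    rw [fderiv_clm_apply hd (differentiableAt_const x)]; simp
  have hdx : ∀ x, DifferentiableAt ℝ (fun ζ => fderiv ℝ dev ζ x) w := fun x =>
    hd.clm_apply (differentiableAt_const x)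
  -- Derivative of the isometry condition. Its three cyclic permutations combine as in the Koszul
  -- formula, the second derivatives being symmetric.
  have key : ∀ v x y, mink (fderiv ℝ (fderiv ℝ dev) w v x) (fderiv ℝ dev w y)
      + mink (fderiv ℝ (fderiv ℝ dev) w v y) (fderiv ℝ dev w x)
      = 2 * fderiv ℝ ψ w v * metric ψ w x y := by
    intro v x y
    have e : (fun ζ => mink (fderiv ℝ dev ζ x) (fderiv ℝ dev ζ y)) =ᶠ[nhds w]
        fun ζ => metric ψ ζ x y := by
      filter_upwards [h.isOpen.mem_nhds hw] with ζ hζ using h.isometric ζ hζ x y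
    have h2 := fderiv_mink (hdx x) (hdx y) v
    rw [e.fderiv_eq, fderiv_metric_const hψ, happ, happ] at h2
    rw [h2, mink_comm (fderiv ℝ dev w x)]
  refine h.ext hw (fun y => ?_) ?_
  · have k1 := key v x y
    have k2 := key x y v
    have k3 := key y v x
    rw [h.fderiv_fderiv_comm hw x v, h.fderiv_fderiv_comm hw x y] at k2
    rw [h.fderiv_fderiv_comm hw y v] at k3
    have e1 : mink (fderiv ℝ (fderiv ℝ dev) w v x) (fderiv ℝ dev w y)
        = fderiv ℝ ψ w v * metric ψ w x y + fderiv ℝ ψ w x * metric ψ w y v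
          - fderiv ℝ ψ w y * metric ψ w v x := by linarith
    rw [e1, mink_add_left, mink_smul_left, mink_comm (dev w), h.mink_fderiv hw, h.isometric w hw]
    simp only [christoffel, metric, inner_add_left, inner_sub_left, real_inner_smul_left,
      inner_gradient_left, real_inner_comm y v]
    ring
  -- Normal part: differentiate the orthogonality of d dev(x) and `dev`.
  · have e : (fun ζ => mink (fderiv ℝ dev ζ x) (dev ζ)) =ᶠ[nhds w] fun ζ => (0 : ℝ) := by
      filter_upwards [h.isOpen.mem_nhds hw] with ζ hζ using h.mink_fderiv hζ x
    have h2 := fderiv_mink (hdx x) (h.differentiableAt hw) v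
    rw [e.fderiv_eq, happ, h.isometric w hw] at h2
    rw [mink_add_left, mink_smul_left, h.mink_self hw, h.mink_fderiv hw, metric_comm ψ w v x]
    simp at h2
    linarith

/-- The derivative of the push-forward of a vector field `Y`. -/
theorem fderiv_push (h : IsLocalIso ψ H dev) {w : ℂ} (hw : w ∈ H) {Y : ℂ → ℂ}
    (hY : DifferentiableAt ℝ Y w) (v : ℂ) :
    fderiv ℝ (fun ζ => fderiv ℝ dev ζ (Y ζ)) w v
      = fderiv ℝ dev w (nabla ψ Y w v) + metric ψ w v (Y w) • dev w := by
  rw [fderiv_clm_apply (h.differentiableAt_fderiv hw) hY, nabla_eq, map_add]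
  simp only [FunLike.coe_add, Pi.add_apply, ContinuousLinearMap.comp_apply,
    ContinuousLinearMap.flip_apply]
  rw [h.fderiv_fderiv hw]
  abel

theorem fderiv_injective (h : IsLocalIso ψ H dev) {w : ℂ} (hw : w ∈ H) {x y : ℂ}
    (e : fderiv ℝ dev w x = fderiv ℝ dev w y) : x = y := by
  have h1 := h.isometric w hw (x - y) (x - y)
  rw [map_sub, e, sub_self] at h1
  have h2 : mink 0 0 = 0 := by simp [mink]
  rw [h2, metric, real_inner_self_eq_norm_sq] at h1
  have := (mul_eq_zero.1 h1.symm).resolve_left (Real.exp_pos _).ne'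
  simpa [sub_eq_zero] using this

end IsLocalIso

/-! ### Hessians and affine deformations -/

theorem metric_hgrad (ψ u : ℂ → ℝ) (w v : ℂ) : metric ψ w v (hgrad ψ u w) = fderiv ℝ u w v := by
  rw [metric_comm, metric, hgrad, real_inner_smul_left, inner_gradient_left, ← mul_assoc,
    ← Real.exp_add]
  simp

/-- The gradient as a continuous linear image of the derivative. -/
theorem gradient_eq_dual_symm (u : ℂ → ℝ) :
    gradient u = fun w => (InnerProductSpace.toDual ℝ ℂ).symm (fderiv ℝ u w) := rfl

theorem contDiffOn_hgrad {ψ u : ℂ → ℝ} {H : Set ℂ} (hH : IsOpen H) (hψ : ContDiffOn ℝ ∞ ψ H)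
    (hu : ContDiffOn ℝ ∞ u H) : ContDiffOn ℝ ∞ (hgrad ψ u) H := by
  have h1 : ContDiffOn ℝ ∞ (gradient u) H := by
    rw [gradient_eq_dual_symm]
    exact (InnerProductSpace.toDual ℝ ℂ).symm.contDiff.comp_contDiffOn
      (contDiffOn_fderiv_infty hu hH)
  exact ((contDiffOn_const.mul hψ).exp).smul h1

theorem contDiffOn_mink {f g : ℂ → Mink} {H : Set ℂ} (hf : ContDiffOn ℝ ∞ f H)
    (hg : ContDiffOn ℝ ∞ g H) : ContDiffOn ℝ ∞ (fun w => mink (f w) (g w)) H := by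
  have hf' := contDiffOn_pi.1 hf
  have hg' := contDiffOn_pi.1 hg
  exact (((hf' 0).mul (hg' 0)).add ((hf' 1).mul (hg' 1))).sub ((hf' 2).mul (hg' 2))

namespace IsLocalIso

variable {ψ : ℂ → ℝ} {H : Set ℂ} {dev : ℂ → Mink}

/-- The vector-valued function that represents a scalar function `u` along `dev`. -/
def lift (ψ u : ℂ → ℝ) (dev : ℂ → Mink) (w : ℂ) : Mink :=
  fderiv ℝ dev w (hgrad ψ u w) - u w • dev w

theorem mink_lift (h : IsLocalIso ψ H dev) (u : ℂ → ℝ) {w : ℂ} (hw : w ∈ H) :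
    mink (lift ψ u dev w) (dev w) = u w := by
  rw [lift, mink_sub_left, mink_smul_left, h.mink_self hw, h.mink_fderiv hw]; ring

theorem mink_lift_fderiv (h : IsLocalIso ψ H dev) (u : ℂ → ℝ) {w : ℂ} (hw : w ∈ H) (v : ℂ) :
    mink (lift ψ u dev w) (fderiv ℝ dev w v) = fderiv ℝ u w v := by
  rw [lift, mink_sub_left, mink_smul_left, h.isometric w hw, mink_comm (dev w), h.mink_fderiv hw,
    metric_comm, metric_hgrad]; ring

/-- The normal term ⟨v, grad u⟩ dev in the derivative of the pushed-forward gradient cancels the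
term du(v) dev coming from u·dev. What is left is tangential. -/
theorem hasFDerivAt_lift (h : IsLocalIso ψ H dev) {u : ℂ → ℝ} (hu : ContDiffOn ℝ ∞ u H) {w : ℂ}
    (hw : w ∈ H) : DifferentiableAt ℝ (lift ψ u dev) w ∧
      ∀ v, fderiv ℝ (lift ψ u dev) w v = fderiv ℝ dev w (hess ψ u w v - u w • v) := by
  have hY := differentiableAt_of_infty (contDiffOn_hgrad h.isOpen h.smooth_metric hu) h.isOpen hw
  have hu' := differentiableAt_of_infty hu h.isOpen hw
  have h1 : DifferentiableAt ℝ (fun ζ => fderiv ℝ dev ζ (hgrad ψ u ζ)) w :=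
    (h.differentiableAt_fderiv hw).clm_apply hY
  have h2 : DifferentiableAt ℝ (fun ζ => u ζ • dev ζ) w := hu'.smul (h.differentiableAt hw)
  refine ⟨h1.sub h2, fun v => ?_⟩
  have e : fderiv ℝ (lift ψ u dev) w = _ := fderiv_sub h1 h2
  rw [e, fderiv_fun_smul hu' (h.differentiableAt hw), map_sub, hess]
  simp only [FunLike.coe_sub, FunLike.coe_add, FunLike.coe_smul, Pi.sub_apply, Pi.add_apply,
    Pi.smul_apply, map_smul]
  rw [h.fderiv_push hw hY, metric_hgrad]
  simp only [ContinuousLinearMap.smulRight_apply]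
  abel

/-- `F` is an affine deformation with derivative `dev_* b`. -/
def IsPrimitive (H : Set ℂ) (dev : ℂ → Mink) (b : ℂ → ℂ →L[ℝ] ℂ) (F : ℂ → Mink) : Prop :=
  ∀ w ∈ H, HasFDerivAt F ((fderiv ℝ dev w).comp (b w)) w

/-- Closedness of dev_* b splits: tangentially it is the Codazzi equation, normally the symmetry of
h(x, b y). Convexity then supplies the primitive. -/
theorem exists_isPrimitive (h : IsLocalIso ψ H dev) (hc : Convex ℝ H) {b : ℂ → ℂ →L[ℝ] ℂ}
    (hb : IsCodazzi ψ H b) : ∃ F, IsPrimitive H dev b F := by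
  have hbd : ∀ w ∈ H, DifferentiableAt ℝ b w := fun w hw =>
    differentiableAt_of_infty hb.smooth h.isOpen hw
  have hω : ∀ w ∈ H, DifferentiableAt ℝ (fun ζ => (fderiv ℝ dev ζ).comp (b ζ)) w := fun w hw =>
    (h.differentiableAt_fderiv hw).clm_comp (hbd w hw)
  refine hc.exists_forall_hasFDerivAt_of_fderiv_symmetric h.isOpen
    (fun w hw => (hω w hw).differentiableWithinAt) fun w hw x y => ?_
  have hY : ∀ y, DifferentiableAt ℝ (fun ζ => b ζ y) w := fun y =>
    (hbd w hw).clm_apply (differentiableAt_const y)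
  have e : ∀ x y, fderiv ℝ (fun ζ => (fderiv ℝ dev ζ).comp (b ζ)) w x y
      = fderiv ℝ dev w (nabla ψ (fun ζ => b ζ y) w x) + metric ψ w x (b w y) • dev w := by
    intro x y
    rw [← h.fderiv_push hw (hY y)]
    have := fderiv_clm_apply (hω w hw) (differentiableAt_const (𝕜 := ℝ) y)
    simp only [ContinuousLinearMap.comp_apply] at this
    rw [this]; simp
  rw [e, e, sub_eq_zero.1 (hb.codazzi w hw x y), ← hb.selfAdjoint w hw, metric_comm]

theorem IsPrimitive.add_const {b : ℂ → ℂ →L[ℝ] ℂ} {F : ℂ → Mink} (hF : IsPrimitive H dev b F)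
    (s : Mink) : IsPrimitive H dev b (fun w => F w + s) :=
  fun w hw => (hF w hw).add_const s

theorem IsPrimitive.contDiffOn (h : IsLocalIso ψ H dev) {b : ℂ → ℂ →L[ℝ] ℂ}
    (hb : ContDiffOn ℝ ∞ b H) {F : ℂ → Mink} (hF : IsPrimitive H dev b F) :
    ContDiffOn ℝ ∞ F H :=
  contDiffOn_infty_of_hasFDerivAt h.isOpen hF
    ((contDiffOn_fderiv_infty h.smooth h.isOpen).clm_comp hb)

theorem IsPrimitive.fderiv_mink_dev (h : IsLocalIso ψ H dev) {b : ℂ → ℂ →L[ℝ] ℂ}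
    {F : ℂ → Mink} (hF : IsPrimitive H dev b F) {w : ℂ} (hw : w ∈ H) (v : ℂ) :
    fderiv ℝ (fun ζ => mink (F ζ) (dev ζ)) w v = mink (F w) (fderiv ℝ dev w v) := by
  rw [fderiv_mink (hF w hw).differentiableAt (h.differentiableAt hw), (hF w hw).fderiv,
    ContinuousLinearMap.comp_apply, h.mink_fderiv hw, zero_add]

/-- The vector F and the lift of ⟨F, dev⟩ have the same products with the frame of `dev`, so they
coincide. Comparing derivatives and using that d dev is injective gives the Hessian equation. -/
theorem IsPrimitive.isHessSub (h : IsLocalIso ψ H dev) {b : ℂ → ℂ →L[ℝ] ℂ}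
    (hb : ContDiffOn ℝ ∞ b H) {F : ℂ → Mink} (hF : IsPrimitive H dev b F) :
    IsHessSub ψ H b (fun w => mink (F w) (dev w)) := by
  have hu := contDiffOn_mink (hF.contDiffOn h hb) h.smooth
  have e : ∀ w ∈ H, lift ψ (fun w => mink (F w) (dev w)) dev w = F w := fun w hw =>
    h.ext hw (fun v => by rw [h.mink_lift_fderiv _ hw, hF.fderiv_mink_dev h hw])
      (h.mink_lift _ hw)
  intro w hw v
  have e' : lift ψ (fun w => mink (F w) (dev w)) dev =ᶠ[nhds w] F := by
    filter_upwards [h.isOpen.mem_nhds hw] with ζ hζ using e ζ hζ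
  have h1 := (h.hasFDerivAt_lift hu hw).2 v
  rw [e'.fderiv_eq, (hF w hw).fderiv] at h1
  exact h.fderiv_injective hw h1

theorem isPrimitive_lift (h : IsLocalIso ψ H dev) {b : ℂ → ℂ →L[ℝ] ℂ} {u : ℂ → ℝ}
    (hu : ContDiffOn ℝ ∞ u H) (hb : IsHessSub ψ H b u) :
    IsPrimitive H dev b (lift ψ u dev) := fun w hw => by
  refine (h.hasFDerivAt_lift hu hw).1.hasFDerivAt.congr_fderiv
    (ContinuousLinearMap.ext fun v => ?_)
  rw [(h.hasFDerivAt_lift hu hw).2, ← hb w hw]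
  rfl

theorem IsPrimitive.exists_eq_add (h : IsLocalIso ψ H dev) (hc : Convex ℝ H)
    {b : ℂ → ℂ →L[ℝ] ℂ} {F G : ℂ → Mink} (hF : IsPrimitive H dev b F)
    (hG : IsPrimitive H dev b G) : ∃ s, ∀ w ∈ H, F w = G w + s := by
  rcases H.eq_empty_or_nonempty with rfl | ⟨w₀, hw₀⟩
  · exact ⟨0, by simp⟩
  refine ⟨F w₀ - G w₀, fun w hw => ?_⟩
  rw [← sub_eq_iff_eq_add']
  refine hc.is_const_of_fderivWithin_eq_zero (𝕜 := ℝ) (f := fun w => F w - G w)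
    (fun z hz => ((hF z hz).sub (hG z hz)).differentiableAt.differentiableWithinAt)
    (fun z hz => ?_) hw hw₀
  rw [fderivWithin_of_isOpen h.isOpen hz]
  exact ((hF z hz).sub (hG z hz)).fderiv.trans (sub_self _)

/-- Two solutions of `Hess u - u I = b` differ by the restriction of a linear function. -/
theorem sub_eq_mink (h : IsLocalIso ψ H dev) (hc : Convex ℝ H) {b : ℂ → ℂ →L[ℝ] ℂ}
    {u₁ u₂ : ℂ → ℝ} (hu₁ : ContDiffOn ℝ ∞ u₁ H) (hu₂ : ContDiffOn ℝ ∞ u₂ H)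
    (hb₁ : IsHessSub ψ H b u₁) (hb₂ : IsHessSub ψ H b u₂) :
    ∃ s, ∀ w ∈ H, u₁ w = u₂ w + mink s (dev w) := by
  obtain ⟨s, hs⟩ := IsPrimitive.exists_eq_add h hc (h.isPrimitive_lift hu₁ hb₁)
    (h.isPrimitive_lift hu₂ hb₂)
  refine ⟨s, fun w hw => ?_⟩
  rw [← h.mink_lift u₁ hw, hs w hw, mink_add_left, h.mink_lift u₂ hw]

/-- Together with the preceding correspondence this says that the functions ⟨s, dev⟩ satisfy Hess u
= u I. -/
theorem isPrimitive_const (s : Mink) : IsPrimitive H dev 0 (fun _ => s) := fun w _ => by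
  exact (hasFDerivAt_const s w).congr_fderiv (ContinuousLinearMap.ext fun v => by simp)

/-- The points of `dev` span Minkowski space. -/
theorem eq_of_forall_mink (h : IsLocalIso ψ H dev) (hne : H.Nonempty) {x y : Mink}
    (hxy : ∀ w ∈ H, mink x (dev w) = mink y (dev w)) : x = y := by
  obtain ⟨w, hw⟩ := hne
  refine h.ext hw (fun v => ?_) (hxy w hw)
  have e : (fun ζ => mink x (dev ζ)) =ᶠ[nhds w] fun ζ => mink y (dev ζ) := by
    filter_upwards [h.isOpen.mem_nhds hw] with ζ hζ using hxy ζ hζ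
  rw [← (isPrimitive_const x).fderiv_mink_dev h hw, ← (isPrimitive_const y).fderiv_mink_dev h hw,
    e.fderiv_eq]

end IsLocalIso

/-! ### The exponential covering -/

theorem isOpen_disc (R : ℝ) : IsOpen (disc R) := Metric.isOpen_ball

theorem isOpen_pdisc (R : ℝ) : IsOpen (pdisc R) := (isOpen_disc R).sdiff isClosed_singleton

theorem isOpen_cover (R : ℝ) : IsOpen (cover R) := isOpen_lt Complex.continuous_re continuous_const

theorem convex_cover (R : ℝ) : Convex ℝ (cover R) := convex_halfSpace_re_lt _

theorem mem_disc {R : ℝ} {z : ℂ} : z ∈ disc R ↔ ‖z‖ < R := by simp [disc]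

theorem mem_pdisc {R : ℝ} {z : ℂ} : z ∈ pdisc R ↔ ‖z‖ < R ∧ z ≠ 0 := by simp [pdisc, disc]

theorem mem_cover {R : ℝ} {w : ℂ} : w ∈ cover R ↔ w.re < Real.log R := Iff.rfl

theorem exp_mem_pdisc {R : ℝ} (hR : 0 < R) {w : ℂ} : Complex.exp w ∈ pdisc R ↔ w ∈ cover R := by
  rw [mem_pdisc, mem_cover, Complex.norm_exp, Real.lt_log_iff_exp_lt hR]
  simp [Complex.exp_ne_zero]

theorem deck_mem_cover {R : ℝ} {w : ℂ} (n : ℤ) : deck n w ∈ cover R ↔ w ∈ cover R := by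
  simp [mem_cover, deck]

theorem exp_deck (n : ℤ) (w : ℂ) : Complex.exp (deck n w) = Complex.exp w := by
  rw [deck, Complex.exp_add, Complex.exp_int_mul_two_pi_mul_I, mul_one]

theorem liftMetric_deck (φ : ℂ → ℝ) (n : ℤ) (w : ℂ) :
    liftMetric φ (deck n w) = liftMetric φ w := by
  rw [liftMetric, exp_deck, liftMetric]
  simp [deck]

theorem liftOp_deck (b : ℂ → ℂ →L[ℝ] ℂ) (n : ℤ) (w : ℂ) :
    liftOp b (deck n w) = liftOp b w := by
  simp only [liftOp, exp_deck, Complex.exp_neg]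

theorem liftOp_apply (b : ℂ → ℂ →L[ℝ] ℂ) (w v : ℂ) :
    liftOp b w v = Complex.exp (-w) * b (Complex.exp w) (Complex.exp w * v) := rfl

theorem exp_neg_mul_exp (w : ℂ) : Complex.exp (-w) * Complex.exp w = 1 := by
  rw [← Complex.exp_add]; simp

theorem hasFDerivAt_exp_real (w : ℂ) :
    HasFDerivAt Complex.exp (ContinuousLinearMap.mul ℝ ℂ (Complex.exp w)) w := by
  have h := (Complex.hasDerivAt_exp w).hasFDerivAt.restrictScalars ℝ
  exact h.congr_fderiv (ContinuousLinearMap.ext fun v => by simp [mul_comm])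

theorem fderiv_comp_exp {E : Type*} [NormedAddCommGroup E] [NormedSpace ℝ E] {f : ℂ → E} {w : ℂ}
    (hf : DifferentiableAt ℝ f (Complex.exp w)) (v : ℂ) :
    fderiv ℝ (fun ζ => f (Complex.exp ζ)) w v
      = fderiv ℝ f (Complex.exp w) (Complex.exp w * v) := by
  have h := hf.hasFDerivAt.comp w (hasFDerivAt_exp_real w)
  have h' : fderiv ℝ (fun ζ => f (Complex.exp ζ)) w = _ := h.fderiv
  rw [h']; rfl

theorem contDiffOn_comp_exp {E : Type*} [NormedAddCommGroup E] [NormedSpace ℝ E] {f : ℂ → E}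
    {R : ℝ} (hR : 0 < R) (hf : ContDiffOn ℝ ∞ f (pdisc R)) :
    ContDiffOn ℝ ∞ (fun w => f (Complex.exp w)) (cover R) :=
  hf.comp Complex.contDiff_exp.contDiffOn
    fun _ hw => (exp_mem_pdisc hR).2 hw

theorem contDiffOn_liftMetric {φ : ℂ → ℝ} {R : ℝ} (hR : 0 < R)
    (hφ : ContDiffOn ℝ ∞ φ (pdisc R)) : ContDiffOn ℝ ∞ (liftMetric φ) (cover R) :=
  (contDiffOn_comp_exp hR hφ).add Complex.reCLM.contDiff.contDiffOn

theorem contDiffOn_mulLeft {f : ℂ → ℂ} {H : Set ℂ} (hf : ContDiffOn ℝ ∞ f H) :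
    ContDiffOn ℝ ∞ (fun w => ContinuousLinearMap.mul ℝ ℂ (f w)) H :=
  (ContinuousLinearMap.mul ℝ ℂ).contDiff.comp_contDiffOn hf

theorem contDiffOn_liftOp {b : ℂ → ℂ →L[ℝ] ℂ} {R : ℝ} (hR : 0 < R)
    (hb : ContDiffOn ℝ ∞ b (pdisc R)) : ContDiffOn ℝ ∞ (liftOp b) (cover R) := by
  have he : ContDiff ℝ ∞ Complex.exp := Complex.contDiff_exp
  exact (contDiffOn_mulLeft (he.comp contDiff_neg).contDiffOn).clm_comp
    ((contDiffOn_comp_exp hR hb).clm_comp (contDiffOn_mulLeft he.contDiffOn))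

theorem fderiv_liftMetric {φ : ℂ → ℝ} {w : ℂ} (hφ : DifferentiableAt ℝ φ (Complex.exp w))
    (v : ℂ) : fderiv ℝ (liftMetric φ) w v
      = fderiv ℝ φ (Complex.exp w) (Complex.exp w * v) + v.re := by
  have h1 : DifferentiableAt ℝ (fun ζ => φ (Complex.exp ζ)) w :=
    hφ.comp w (hasFDerivAt_exp_real w).differentiableAt
  have h2 : HasFDerivAt Complex.re Complex.reCLM w := Complex.reCLM.hasFDerivAt
  have e : fderiv ℝ (liftMetric φ) w = _ := fderiv_add h1 h2.differentiableAt
  rw [e, h2.fderiv, FunLike.coe_add, Pi.add_apply, fderiv_comp_exp hφ]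
  rfl

theorem gradient_liftMetric {φ : ℂ → ℝ} {w : ℂ} (hφ : DifferentiableAt ℝ φ (Complex.exp w)) :
    gradient (liftMetric φ) w
      = (starRingEnd ℂ) (Complex.exp w) * gradient φ (Complex.exp w) + 1 := by
  refine ext_inner_right ℝ fun v => ?_
  rw [inner_gradient_left, fderiv_liftMetric hφ, ← inner_gradient_left, inner_add_left]
  simp only [Complex.inner, map_mul, Complex.conj_conj, map_one, mul_one]
  congr 2
  ring

theorem hgrad_comp_exp {φ u : ℂ → ℝ} {w : ℂ} (hu : DifferentiableAt ℝ u (Complex.exp w)) :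
    hgrad (liftMetric φ) (fun ζ => u (Complex.exp ζ)) w
      = Complex.exp (-w) * hgrad φ u (Complex.exp w) := by
  have e : gradient (fun ζ => u (Complex.exp ζ)) w
      = (starRingEnd ℂ) (Complex.exp w) * gradient u (Complex.exp w) := by
    refine ext_inner_right ℝ fun v => ?_
    rw [inner_gradient_left, fderiv_comp_exp hu, ← inner_gradient_left]
    simp only [Complex.inner, map_mul, Complex.conj_conj]
    congr 1
    ring
  have e2 : (Real.exp (-2 * liftMetric φ w) : ℂ) * (starRingEnd ℂ) (Complex.exp w)
      = Complex.exp (-w) * Real.exp (-2 * φ (Complex.exp w)) := by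
    rw [← Complex.exp_conj, Complex.ofReal_exp, Complex.ofReal_exp, ← Complex.exp_add,
      ← Complex.exp_add]
    congr 1
    apply Complex.ext
    · simp [liftMetric]; ring_nf
    · simp [liftMetric]
  rw [hgrad, hgrad, e, Complex.real_smul, Complex.real_smul, ← mul_assoc, e2, mul_assoc]

/-- The covariant derivative is natural under the exponential covering. -/
theorem nabla_liftMetric {φ : ℂ → ℝ} {Y : ℂ → ℂ} {w : ℂ}
    (hφ : DifferentiableAt ℝ φ (Complex.exp w)) (hY : DifferentiableAt ℝ Y (Complex.exp w))
    (v : ℂ) : nabla (liftMetric φ) (fun ζ => Complex.exp (-ζ) * Y (Complex.exp ζ)) w v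
      = Complex.exp (-w) * nabla φ Y (Complex.exp w) (Complex.exp w * v) := by
  have h1 : HasFDerivAt (fun ζ : ℂ => Complex.exp (-ζ))
      ((ContinuousLinearMap.mul ℝ ℂ (Complex.exp (-w))).comp
        (-ContinuousLinearMap.id ℝ ℂ)) w :=
    (hasFDerivAt_exp_real (-w)).comp w (hasFDerivAt_id w).neg
  have h2 : DifferentiableAt ℝ (fun ζ => Y (Complex.exp ζ)) w :=
    hY.comp w (hasFDerivAt_exp_real w).differentiableAt
  have e : fderiv ℝ (fun ζ => Complex.exp (-ζ) * Y (Complex.exp ζ)) w v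
      = Complex.exp (-w) * fderiv ℝ Y (Complex.exp w) (Complex.exp w * v)
        - v * (Complex.exp (-w) * Y (Complex.exp w)) := by
    have h3 : fderiv ℝ (fun ζ => Complex.exp (-ζ) * Y (Complex.exp ζ)) w = _ :=
      (h1.mul h2.hasFDerivAt).fderiv
    rw [h3]
    simp only [FunLike.coe_add, FunLike.coe_smul, Pi.add_apply, Pi.smul_apply, fderiv_comp_exp hY,
      ContinuousLinearMap.comp_apply, smul_eq_mul, ContinuousLinearMap.mul_apply']
    simp
    ring
  set y := Complex.exp (-w) * Y (Complex.exp w) with hy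
  have hYy : Y (Complex.exp w) = Complex.exp w * y := by
    rw [hy, ← mul_assoc, mul_comm (Complex.exp w), exp_neg_mul_exp, one_mul]
  have e3 : inner ℝ (Complex.exp w * v) (Complex.exp w * y)
      = ((starRingEnd ℂ) (Complex.exp w) * Complex.exp w).re * inner ℝ v y := by
    simp only [Complex.inner, map_mul]
    simp
    ring
  have e4 : (starRingEnd ℂ) (Complex.exp w) * Complex.exp w
      = (((starRingEnd ℂ) (Complex.exp w) * Complex.exp w).re : ℂ) := by
    apply Complex.ext <;> simp; ring
  rw [nabla, nabla, e, ← hy, fderiv_liftMetric hφ, fderiv_liftMetric hφ, gradient_liftMetric hφ,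
    hYy, e3]
  simp only [Complex.real_smul, Complex.ofReal_mul, ← e4, Complex.ofReal_add]
  -- The derivative of e^{-ζ} contributes -vy. The summand Re w of the lifted factor contributes the
  -- Christoffel terms that cancel it.
  have e5 : -(v * y) + v.re * y + y.re * v - ((inner ℝ v y : ℝ) : ℂ) = 0 := by
    apply Complex.ext <;> simp [Complex.inner] <;> ring
  linear_combination e5 + (-(fderiv ℝ φ (Complex.exp w) (Complex.exp w * v) * y
    + fderiv ℝ φ (Complex.exp w) (Complex.exp w * y) * v
    - (starRingEnd ℂ) (Complex.exp w) * ((inner ℝ v y : ℝ) : ℂ) * gradient φ (Complex.exp w)))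
      * exp_neg_mul_exp w

theorem hess_liftMetric {φ u : ℂ → ℝ} {R : ℝ} (hR : 0 < R) (hφ : ContDiffOn ℝ ∞ φ (pdisc R))
    (hu : ContDiffOn ℝ ∞ u (pdisc R)) {w : ℂ} (hw : w ∈ cover R) (v : ℂ) :
    hess (liftMetric φ) (fun ζ => u (Complex.exp ζ)) w v
      = Complex.exp (-w) * hess φ u (Complex.exp w) (Complex.exp w * v) := by
  have ho := isOpen_pdisc R
  have hz := (exp_mem_pdisc hR).2 hw
  rw [hess, hess, ← nabla_liftMetric (differentiableAt_of_infty hφ ho hz)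
    (differentiableAt_of_infty (contDiffOn_hgrad ho hφ hu) ho hz)]
  have e : hgrad (liftMetric φ) (fun ζ => u (Complex.exp ζ)) =ᶠ[nhds w]
      fun ζ => Complex.exp (-ζ) * hgrad φ u (Complex.exp ζ) := by
    filter_upwards [(isOpen_cover R).mem_nhds hw] with ζ hζ
    exact hgrad_comp_exp (differentiableAt_of_infty hu ho ((exp_mem_pdisc hR).2 hζ))
  simp only [nabla, e.fderiv_eq, e.eq_of_nhds]

/-- `Hess u - u I = b` holds downstairs if and only if it holds upstairs. -/
theorem isHessSub_lift_iff {φ u : ℂ → ℝ} {b : ℂ → ℂ →L[ℝ] ℂ} {R : ℝ} (hR : 0 < R)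
    (hφ : ContDiffOn ℝ ∞ φ (pdisc R)) (hu : ContDiffOn ℝ ∞ u (pdisc R)) :
    IsHessSub (liftMetric φ) (cover R) (liftOp b) (fun w => u (Complex.exp w))
      ↔ IsHessSub φ (pdisc R) b u := by
  constructor
  · intro h z hz v
    have hz0 : z ≠ 0 := (mem_pdisc.1 hz).2
    have hez : Complex.exp (Complex.log z) = z := Complex.exp_log hz0
    have hw : Complex.log z ∈ cover R := by rwa [← exp_mem_pdisc hR, hez]
    have h1 := h _ hw (z⁻¹ * v)
    rw [hess_liftMetric hR hφ hu hw, liftOp_apply, hez, mul_inv_cancel_left₀ hz0,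
      Complex.exp_neg, hez, Complex.real_smul, mul_left_comm, ← mul_sub] at h1
    have := mul_left_cancel₀ (inv_ne_zero hz0) h1
    rw [this, Complex.real_smul]
    dsimp only
    rw [hez]
  · intro h w hw v
    dsimp only
    rw [hess_liftMetric hR hφ hu hw, liftOp_apply, h _ ((exp_mem_pdisc hR).2 hw), mul_sub,
      Complex.real_smul, Complex.real_smul]
    linear_combination -(u (Complex.exp w) : ℂ) * v * exp_neg_mul_exp w

/-- A constant field x on the cover corresponds to the field z ↦ zx below, which is not constant.
The extra derivative is b applied to e^w v x, symmetric in v and x, so it drops out of the Codazzi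
equation. -/
theorem isCodazzi_lift {φ : ℂ → ℝ} {b : ℂ → ℂ →L[ℝ] ℂ} {R : ℝ} (hR : 0 < R)
    (hφ : ContDiffOn ℝ ∞ φ (pdisc R)) (hb : IsCodazzi φ (pdisc R) b) :
    IsCodazzi (liftMetric φ) (cover R) (liftOp b) where
  smooth := contDiffOn_liftOp hR hb.smooth
  selfAdjoint w hw v x := by
    have h := hb.selfAdjoint _ ((exp_mem_pdisc hR).2 hw) (Complex.exp w * v) (Complex.exp w * x)
    have key : ∀ a c : ℂ, inner ℝ (Complex.exp (-w) * a) c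
        = Complex.normSq (Complex.exp (-w)) * inner ℝ a (Complex.exp w * c) := by
      intro a c
      have hc : c = Complex.exp (-w) * (Complex.exp w * c) := by
        rw [← mul_assoc, exp_neg_mul_exp, one_mul]
      conv_lhs => rw [hc]
      simp only [Complex.inner, map_mul, Complex.normSq_apply]
      simp
      ring
    simp only [metric, liftOp_apply] at h ⊢
    rw [key, mul_left_cancel₀ (Real.exp_pos _).ne' h, ← real_inner_comm v, key,
      real_inner_comm (Complex.exp w * v)]
  codazzi w hw v x := by
    have hz := (exp_mem_pdisc hR).2 hw
    have hφ' := differentiableAt_of_infty hφ (isOpen_pdisc R) hz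
    have hb' := differentiableAt_of_infty hb.smooth (isOpen_pdisc R) hz
    have key : ∀ v x, nabla (liftMetric φ) (fun ζ => liftOp b ζ x) w v = Complex.exp (-w) *
        (nabla φ (fun ζ => b ζ (Complex.exp w * x)) (Complex.exp w) (Complex.exp w * v)
          + b (Complex.exp w) (Complex.exp w * v * x)) := by
      intro v x
      have hx : HasFDerivAt (fun ζ : ℂ => ζ * x) ((ContinuousLinearMap.mul ℝ ℂ).flip x)
          (Complex.exp w) := ((ContinuousLinearMap.mul ℝ ℂ).flip x).hasFDerivAt
      have hY : DifferentiableAt ℝ (fun ζ => b ζ (ζ * x)) (Complex.exp w) :=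
        hb'.clm_apply hx.differentiableAt
      simp only [liftOp_apply]
      rw [nabla_liftMetric hφ' hY, nabla_eq, nabla_eq, fderiv_clm_apply hb' hx.differentiableAt,
        fderiv_clm_apply hb' (differentiableAt_const _), hx.fderiv]
      simp
      ring_nf
    rw [key, key, ← mul_sub]
    have := hb.codazzi _ hz (Complex.exp w * v) (Complex.exp w * x)
    rw [sub_eq_zero.1 this, mul_right_comm (Complex.exp w) x v, mul_right_comm]
    simp

/-- The Laplacian of the lifted conformal factor. -/
theorem laplacian_liftMetric {θ₀ R : ℝ} {φ : ℂ → ℝ} (hR : 0 < R) (hφ : IsHyperbolicCone θ₀ R φ)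
    {w : ℂ} (hw : w ∈ cover R) :
    fderiv ℝ (fderiv ℝ (liftMetric φ)) w 1 1
      + fderiv ℝ (fderiv ℝ (liftMetric φ)) w Complex.I Complex.I
      = Real.exp (2 * liftMetric φ w) := by
  have ho := isOpen_pdisc R
  have hz := (exp_mem_pdisc hR).2 hw
  have hd2 : DifferentiableAt ℝ (fderiv ℝ φ) (Complex.exp w) :=
    differentiableAt_of_infty (contDiffOn_fderiv_infty hφ.smooth ho) ho hz
  have hl2 : DifferentiableAt ℝ (fderiv ℝ (liftMetric φ)) w :=
    differentiableAt_of_infty (contDiffOn_fderiv_infty (contDiffOn_liftMetric hR hφ.smooth)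
      (isOpen_cover R)) (isOpen_cover R) hw
  set B := fderiv ℝ (fderiv ℝ φ) (Complex.exp w) with hB
  -- The first-order term dφ(e^w v²) has opposite values for v = 1 and v = i, so only the second
  -- derivatives survive in the Laplacian.
  have key : ∀ v, fderiv ℝ (fderiv ℝ (liftMetric φ)) w v v
      = B (Complex.exp w * v) (Complex.exp w * v)
        + fderiv ℝ φ (Complex.exp w) (Complex.exp w * v * v) := by
    intro v
    have e1 : fderiv ℝ (fun ζ => fderiv ℝ (liftMetric φ) ζ v) w v
        = fderiv ℝ (fderiv ℝ (liftMetric φ)) w v v := by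
      rw [fderiv_clm_apply hl2 (differentiableAt_const _)]; simp
    have e2 : (fun ζ => fderiv ℝ (liftMetric φ) ζ v) =ᶠ[nhds w]
        fun ζ => fderiv ℝ φ (Complex.exp ζ) (Complex.exp ζ * v) + v.re := by
      filter_upwards [(isOpen_cover R).mem_nhds hw] with ζ hζ
      exact fderiv_liftMetric (differentiableAt_of_infty hφ.smooth ho
        ((exp_mem_pdisc hR).2 hζ)) v
    have hx : HasFDerivAt (fun ζ : ℂ => ζ * v) ((ContinuousLinearMap.mul ℝ ℂ).flip v)
        (Complex.exp w) := ((ContinuousLinearMap.mul ℝ ℂ).flip v).hasFDerivAt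
    have hY : DifferentiableAt ℝ (fun ζ => fderiv ℝ φ ζ (ζ * v)) (Complex.exp w) :=
      hd2.clm_apply hx.differentiableAt
    rw [← e1, e2.fderiv_eq, fderiv_add_const, fderiv_comp_exp hY,
      fderiv_clm_apply hd2 hx.differentiableAt, hx.fderiv]
    simp [hB, add_comm, mul_comm v]
  have hcurv := hφ.hyperbolic _ hz
  have hsymm : ∀ a c, B a c = B c a := fun a c =>
    (contDiffAt_top_of_infty hφ.smooth ho hz).isSymmSndFDerivAt (by simpa using two_le_infty) a c
  have hlap : Laplacian.laplacian φ (Complex.exp w) = B 1 1 + B Complex.I Complex.I := by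
    rw [InnerProductSpace.laplacian_eq_iteratedFDeriv_complexPlane]
    simp [iteratedFDeriv_two_apply, hB]
  have hI : ∀ a : ℂ, B a a + B (a * Complex.I) (a * Complex.I)
      = Complex.normSq a * (B 1 1 + B Complex.I Complex.I) := by
    intro a
    have ha : a = a.re • (1 : ℂ) + a.im • Complex.I := by
      apply Complex.ext <;> simp
    have haI : a * Complex.I = (-a.im) • (1 : ℂ) + a.re • Complex.I := by
      apply Complex.ext <;> simp
    rw [haI]
    nth_rewrite 1 2 [ha]
    simp only [map_add, map_smul, FunLike.coe_add, FunLike.coe_smul, Pi.add_apply, Pi.smul_apply,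
      smul_eq_mul, hsymm Complex.I 1, Complex.normSq_apply]
    ring
  rw [key, key, mul_one, mul_assoc, Complex.I_mul_I, mul_one, mul_neg_one, map_neg]
  have h1 := hI (Complex.exp w)
  rw [← hlap] at h1
  have hexp : Laplacian.laplacian φ (Complex.exp w) = Real.exp (2 * φ (Complex.exp w)) := by
    rw [curvature] at hcurv
    have h2 : Real.exp (2 * φ (Complex.exp w)) * Real.exp (-2 * φ (Complex.exp w)) = 1 := by
      rw [← Real.exp_add]; simp
    linear_combination -Real.exp (2 * φ (Complex.exp w)) * hcurv
      - Laplacian.laplacian φ (Complex.exp w) * h2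
  have hn : Complex.normSq (Complex.exp w) = Real.exp (2 * w.re) := by
    rw [Complex.normSq_eq_norm_sq, Complex.norm_exp, ← Real.exp_nat_mul]; norm_num
  rw [hexp, hn, ← Real.exp_add] at h1
  rw [liftMetric, mul_add, add_comm (2 * φ _), ← h1]
  ring

/-! ### Holomorphic linear differential equations on convex domains -/

/-- Complex linearity makes the real derivative of the 1-form f dw symmetric, so the real Poincaré
lemma applies. -/
theorem exists_holomorphic_primitive {E : Type*} [NormedAddCommGroup E] [NormedSpace ℂ E]
    [CompleteSpace E] {U : Set ℂ} (hU : IsOpen U) (hc : Convex ℝ U) (w₀ : ℂ) {f : ℂ → E}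
    (hf : DifferentiableOn ℂ f U) : ∃ F : ℂ → E, F w₀ = 0 ∧ ∀ w ∈ U, HasDerivAt F (f w) w := by
  have hd : ∀ w ∈ U, HasFDerivAt (fun z => ContinuousLinearMap.toSpanSingleton ℂ (f z))
      ((ContinuousLinearMap.toSpanSingletonCLE (𝕜 := ℂ) (E := E) :
        E →L[ℂ] ℂ →L[ℂ] E).comp (fderiv ℂ f w)) w := fun w hw =>
    (ContinuousLinearMap.toSpanSingletonCLE (𝕜 := ℂ) (E := E) :
        E →L[ℂ] ℂ →L[ℂ] E).hasFDerivAt.comp w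
      (hf.differentiableAt (hU.mem_nhds hw)).hasFDerivAt
  obtain ⟨F, hF⟩ : ∃ F : ℂ → E, ∀ w ∈ U,
      HasFDerivAt F (ContinuousLinearMap.toSpanSingleton ℂ (f w)) w :=
    hc.exists_forall_hasFDerivAt_of_fderiv_symmetric hU
    (fun w hw => ((hd w hw).restrictScalars ℝ).differentiableAt.differentiableWithinAt)
    (fun w hw x y => by
      rw [((hd w hw).restrictScalars ℝ).fderiv]
      have e : ∀ x, fderiv ℂ f w x = x • deriv f w := fun x => by
        rw [← fderiv_apply_one_eq_deriv, ← map_smul]; simp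
      simp [e, smul_smul, mul_comm])
  refine ⟨fun w => F w - F w₀, sub_self _, fun w hw => ?_⟩
  simpa using ((hF w hw).hasDerivAt).sub_const (F w₀)

/-- A holomorphic linear system on a convex domain has a global solution. -/
theorem exists_solution_linear {E : Type*} [NormedAddCommGroup E] [NormedSpace ℂ E]
    [CompleteSpace E] {U : Set ℂ} (hU : IsOpen U) (hc : Convex ℝ U) {w₀ : ℂ} (hw₀ : w₀ ∈ U)
    {A : ℂ → E →L[ℂ] E} (hA : DifferentiableOn ℂ A U) (y₀ : E) :
    ∃ Y : ℂ → E, Y w₀ = y₀ ∧ ∀ w ∈ U, HasDerivAt Y (A w (Y w)) w := by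
  choose! P hP0 hP using fun (f : ℂ → E) (hf : DifferentiableOn ℂ f U) =>
    exists_holomorphic_primitive hU hc w₀ hf
  -- Successive terms of the Picard series: each is the primitive, vanishing at w₀, of A applied to
  -- the previous one.
  let y : ℕ → ℂ → E := fun n => Nat.rec (fun _ => y₀) (fun _ f => P (fun w => A w (f w))) n
  have ysucc : ∀ n, y (n + 1) = P (fun w => A w (y n w)) := fun n => rfl
  have ydiff : ∀ n, DifferentiableOn ℂ (y n) U := by
    intro n
    induction n with
    | zero => exact differentiableOn_const _
    | succ n ih =>
      intro w hw
      exact (hP _ (hA.clm_apply ih) w hw).differentiableAt.differentiableWithinAt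
  have yderiv : ∀ n, ∀ w ∈ U, HasDerivAt (y (n + 1)) (A w (y n w)) w := fun n w hw =>
    hP _ (hA.clm_apply (ydiff n)) w hw
  have yzero : ∀ n, y (n + 1) w₀ = 0 := fun n => hP0 _ (hA.clm_apply (ydiff n))
  have main : ∀ w ∈ U, Summable (fun n => y (n + 1) w₀) ∧
      HasDerivAt (fun z => y₀ + ∑' n, y (n + 1) z) (A w (y₀ + ∑' n, y (n + 1) w)) w := by
    intro w hw
    have hseg : IsCompact (segment ℝ w₀ w) := by
      rw [segment_eq_image_lineMap]
      exact isCompact_Icc.image (by fun_prop)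
    -- A convex neighbourhood of the segment whose closure is compact in U: A is bounded there,
    -- which is enough for convergence near w.
    obtain ⟨δ, hδ, hsub⟩ := hseg.exists_cthickening_subset_open hU (hc.segment_subset hw₀ hw)
    have hK : IsCompact (Metric.cthickening δ (segment ℝ w₀ w)) := hseg.cthickening
    set t := Metric.thickening δ (segment ℝ w₀ w) with ht
    have htU : t ⊆ U := (Metric.thickening_subset_cthickening _ _).trans hsub
    have hto : IsOpen t := Metric.isOpen_thickening
    have htc : Convex ℝ t := (convex_segment w₀ w).thickening δ
    have h0t : w₀ ∈ t := Metric.self_subset_thickening hδ _ (left_mem_segment ℝ w₀ w)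
    have hwt : w ∈ t := Metric.self_subset_thickening hδ _ (right_mem_segment ℝ w₀ w)
    obtain ⟨M, hM⟩ := hK.exists_bound_of_continuousOn (hA.continuousOn.mono hsub)
    obtain ⟨D, hD⟩ := hK.exists_bound_of_continuousOn
      (f := fun z : ℂ => z - w₀) (by fun_prop)
    have hMt : ∀ z ∈ t, ‖A z‖ ≤ M := fun z hz =>
      hM z (Metric.thickening_subset_cthickening _ _ hz)
    have hDt : ∀ z ∈ t, ‖z - w₀‖ ≤ D := fun z hz =>
      hD z (Metric.thickening_subset_cthickening _ _ hz)
    have hM0 : 0 ≤ M := (norm_nonneg _).trans (hMt w₀ h0t)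
    -- The usual factorial estimate, obtained by integrating along the segment from w₀ to z.
    have bound : ∀ n, ∀ z ∈ t, ‖y n z‖ ≤ ‖y₀‖ * ((M * ‖z - w₀‖) ^ n / n.factorial) := by
      intro n
      induction n with
      | zero => intro z _; simp [y]
      | succ n ih =>
        intro z hz
        set d := ‖z - w₀‖ with hd
        have hline : ∀ s ∈ Icc (0 : ℝ) 1, w₀ + s • (z - w₀) ∈ t := fun s hs =>
          htc.add_smul_sub_mem h0t hz hs
        have hder : ∀ s ∈ Icc (0 : ℝ) 1, HasDerivAt (fun s : ℝ => y (n + 1) (w₀ + s • (z - w₀)))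
            ((z - w₀) • A (w₀ + s • (z - w₀)) (y n (w₀ + s • (z - w₀)))) s := by
          intro s hs
          have h1 : HasDerivAt (fun s : ℝ => w₀ + s • (z - w₀)) (z - w₀) s := by
            simpa using ((hasDerivAt_id s).smul_const (z - w₀)).const_add w₀
          exact (yderiv n _ (htU (hline s hs))).scomp s h1
        have hB : ∀ s : ℝ, HasDerivAt
            (fun s : ℝ => ‖y₀‖ * ((M * (s * d)) ^ (n + 1) / (n + 1).factorial))
            (‖y₀‖ * ((M * d) * ((M * (s * d)) ^ n / n.factorial))) s := by
          intro s
          have h1 : HasDerivAt (fun s : ℝ => M * (s * d)) (M * d) s := by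
            simpa using ((hasDerivAt_id s).mul_const d).const_mul M
          have h2 := ((h1.pow (n + 1)).div_const ((n + 1).factorial : ℝ)).const_mul ‖y₀‖
          refine h2.congr_deriv ?_
          have : ((n : ℝ) + 1) ≠ 0 := by positivity
          rw [Nat.factorial_succ]
          push_cast
          field_simp
        have := image_norm_le_of_norm_deriv_right_le_deriv_boundary
          (f := fun s : ℝ => y (n + 1) (w₀ + s • (z - w₀))) (a := 0) (b := 1)
          (fun s hs => (hder s hs).continuousAt.continuousWithinAt)
          (fun s hs => (hder s ⟨hs.1, hs.2.le⟩).hasDerivWithinAt)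
          (B := fun s : ℝ => ‖y₀‖ * ((M * (s * d)) ^ (n + 1) / (n + 1).factorial))
          (by simp [yzero]) hB (fun s hs => by
            have hs' : s ∈ Icc (0 : ℝ) 1 := ⟨hs.1, hs.2.le⟩
            rw [norm_smul, ← hd]
            have h1 := ih _ (hline s hs')
            have h2 : ‖w₀ + s • (z - w₀) - w₀‖ = s * d := by
              rw [add_sub_cancel_left, norm_smul, Real.norm_of_nonneg hs.1]
            rw [h2] at h1
            have h3 := ((A (w₀ + s • (z - w₀))).le_of_opNorm_le (hMt _ (hline s hs'))
              (y n (w₀ + s • (z - w₀))))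
            calc d * ‖A (w₀ + s • (z - w₀)) (y n (w₀ + s • (z - w₀)))‖
                ≤ d * (M * (‖y₀‖ * ((M * (s * d)) ^ n / n.factorial))) := by
                  gcongr
                  exact h3.trans (by gcongr)
              _ = _ := by ring)
          (right_mem_Icc.2 zero_le_one)
        simpa using this
    have bound' : ∀ n, ∀ z ∈ t, ‖y n z‖ ≤ ‖y₀‖ * ((M * D) ^ n / n.factorial) := fun n z hz =>
      (bound n z hz).trans (by gcongr; exact hDt z hz)
    have hsum : Summable (fun n : ℕ => ‖y₀‖ * ((M * D) ^ n / n.factorial)) :=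
      (Real.summable_pow_div_factorial (M * D)).mul_left _
    have hs0 : Summable (fun n => y (n + 1) w₀) := by simp [yzero, summable_zero]
    refine ⟨hs0, ?_⟩
    have h1 := hasDerivAt_tsum_of_isPreconnected (g := fun n => y (n + 1))
      (g' := fun n z => A z (y n z)) (hsum.mul_left M) hto htc.isPreconnected
      (fun n z hz => yderiv n z (htU hz))
      (fun n z hz => ((A z).le_of_opNorm_le (hMt z hz) _).trans
        (mul_le_mul_of_nonneg_left (bound' n z hz) hM0)) h0t hs0 hwt
    have hsy : Summable (fun n => y n w) := .of_norm_bounded hsum fun n => bound' n w hwt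
    have h2 : ∑' n, A w (y n w) = A w (y₀ + ∑' n, y (n + 1) w) := by
      rw [← ContinuousLinearMap.map_tsum _ hsy, hsy.tsum_eq_zero_add]
      rfl
    rw [← h2]
    exact h1.const_add y₀
  exact ⟨fun z => y₀ + ∑' n, y (n + 1) z, by simp [yzero], fun w hw => (main w hw).2⟩

/-- Solutions of `y'' = -Q y` with prescribed initial values. -/
theorem exists_solution_second_order {U : Set ℂ} (hU : IsOpen U) (hc : Convex ℝ U) {w₀ : ℂ}
    (hw₀ : w₀ ∈ U) {Q : ℂ → ℂ} (hQ : DifferentiableOn ℂ Q U) (a b : ℂ) :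
    ∃ y y' : ℂ → ℂ, y w₀ = a ∧ y' w₀ = b ∧
      ∀ w ∈ U, HasDerivAt y (y' w) w ∧ HasDerivAt y' (-Q w * y w) w := by
  let A : ℂ → (ℂ × ℂ) →L[ℂ] (ℂ × ℂ) := fun w =>
    (ContinuousLinearMap.inl ℂ ℂ ℂ).comp (ContinuousLinearMap.snd ℂ ℂ ℂ)
      - Q w • (ContinuousLinearMap.inr ℂ ℂ ℂ).comp (ContinuousLinearMap.fst ℂ ℂ ℂ)
  have hA : DifferentiableOn ℂ A U := (differentiableOn_const _).sub (hQ.smul_const _)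
  obtain ⟨Y, hY0, hY⟩ := exists_solution_linear hU hc hw₀ hA (a, b)
  refine ⟨fun w => (Y w).1, fun w => (Y w).2, by simp [hY0], by simp [hY0], fun w hw => ?_⟩
  have h1 := (ContinuousLinearMap.fst ℂ ℂ ℂ).hasFDerivAt.comp_hasDerivAt w (hY w hw)
  have h2 := (ContinuousLinearMap.snd ℂ ℂ ℂ).hasFDerivAt.comp_hasDerivAt w (hY w hw)
  exact ⟨h1.congr_deriv (by simp [A]), h2.congr_deriv (by simp [A])⟩

/-! ### Wirtinger derivatives -/

/-- The real linear map `v ↦ a v + b v̄`. -/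
def wirtingerCLM (a b : ℂ) : ℂ →L[ℝ] ℂ :=
  ContinuousLinearMap.mul ℝ ℂ a
    + (ContinuousLinearMap.mul ℝ ℂ b).comp (Complex.conjCLE : ℂ →L[ℝ] ℂ)

@[simp] theorem wirtingerCLM_apply (a b v : ℂ) :
    wirtingerCLM a b v = a * v + b * (starRingEnd ℂ) v := by
  simp [wirtingerCLM]

/-- `f` has the Wirtinger derivatives `∂f = a` and `∂̄f = b` at `w`. -/
def HasWirtinger (f : ℂ → ℂ) (a b w : ℂ) : Prop := HasFDerivAt f (wirtingerCLM a b) w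

namespace HasWirtinger

variable {f g : ℂ → ℂ} {a b c d w : ℂ}

theorem congr_val (h : HasWirtinger f a b w) (h1 : a = c) (h2 : b = d) :
    HasWirtinger f c d w := h1 ▸ h2 ▸ h

theorem of_clm {L : ℂ →L[ℝ] ℂ} (h : HasFDerivAt f L w)
    (e : ∀ v, L v = a * v + b * (starRingEnd ℂ) v) : HasWirtinger f a b w :=
  h.congr_fderiv (ContinuousLinearMap.ext fun v => by rw [e, wirtingerCLM_apply])

theorem of_differentiableAt (h : DifferentiableAt ℝ f w) :
    HasWirtinger f ((fderiv ℝ f w 1 - Complex.I * fderiv ℝ f w Complex.I) / 2)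
      ((fderiv ℝ f w 1 + Complex.I * fderiv ℝ f w Complex.I) / 2) w := by
  refine of_clm h.hasFDerivAt fun v => ?_
  have hv : v = v.re • (1 : ℂ) + v.im • Complex.I := by apply Complex.ext <;> simp
  have hv' : (starRingEnd ℂ) v = v.re - v.im * Complex.I := by apply Complex.ext <;> simp
  have hv'' : v = v.re + v.im * Complex.I := by apply Complex.ext <;> simp
  rw [hv']
  conv_lhs => rw [hv]
  conv_rhs => enter [1, 2]; rw [hv'']
  rw [map_add, map_smul, map_smul, Complex.real_smul, Complex.real_smul]
  linear_combination v.im * fderiv ℝ f w Complex.I * Complex.I_sq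

theorem add (hf : HasWirtinger f a b w) (hg : HasWirtinger g c d w) :
    HasWirtinger (fun z => f z + g z) (a + c) (b + d) w :=
  of_clm (HasFDerivAt.add hf hg) fun v => by simp; ring

theorem sub (hf : HasWirtinger f a b w) (hg : HasWirtinger g c d w) :
    HasWirtinger (fun z => f z - g z) (a - c) (b - d) w :=
  of_clm (HasFDerivAt.sub hf hg) fun v => by simp; ring

theorem neg (hf : HasWirtinger f a b w) : HasWirtinger (fun z => -f z) (-a) (-b) w :=
  of_clm (HasFDerivAt.neg hf) fun v => by simp; ring

theorem mul (hf : HasWirtinger f a b w) (hg : HasWirtinger g c d w) :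
    HasWirtinger (fun z => f z * g z) (a * g w + f w * c) (b * g w + f w * d) w :=
  of_clm (HasFDerivAt.mul hf hg) fun v => by simp; ring

theorem conj (hf : HasWirtinger f a b w) :
    HasWirtinger (fun z => (starRingEnd ℂ) (f z)) ((starRingEnd ℂ) b) ((starRingEnd ℂ) a) w :=
  of_clm ((Complex.conjCLE : ℂ →L[ℝ] ℂ).hasFDerivAt.comp w hf) fun v => by simp; ring

theorem const_mul (hf : HasWirtinger f a b w) (k : ℂ) :
    HasWirtinger (fun z => k * f z) (k * a) (k * b) w :=
  of_clm (HasFDerivAt.const_mul hf k) fun v => by simp; ring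

theorem cexp (hf : HasWirtinger f a b w) : HasWirtinger (fun z => Complex.exp (f z))
    (Complex.exp (f w) * a) (Complex.exp (f w) * b) w :=
  of_clm (HasFDerivAt.cexp hf) fun v => by simp; ring

theorem of_hasDerivAt (h : HasDerivAt f a w) : HasWirtinger f a 0 w :=
  of_clm (h.hasFDerivAt.restrictScalars ℝ) fun v => by simp [mul_comm]

theorem hasDerivAt (h : HasWirtinger f a 0 w) : HasDerivAt f a w := by
  have h1 : DifferentiableAt ℂ f w := by
    rw [differentiableAt_complex_iff_differentiableAt_real]
    refine ⟨HasFDerivAt.differentiableAt h, ?_⟩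
    rw [HasFDerivAt.fderiv h]
    simp [mul_comm]
  have h2 := (h1.hasDerivAt.hasFDerivAt.restrictScalars ℝ).unique h
  have h3 : deriv f w = a := by simpa using congrArg (fun L => L 1) h2
  rw [← h3]
  exact h1.hasDerivAt

end HasWirtinger

/-! ### The Schwarzian equation of a hyperbolic metric -/

/-- The Wirtinger derivative `∂ψ` of a real function. -/
def dz (ψ : ℂ → ℝ) (w : ℂ) : ℂ :=
  ((fderiv ℝ ψ w 1 : ℂ) - Complex.I * fderiv ℝ ψ w Complex.I) / 2

/-- `e^{2ψ}|dw|²` is a smooth hyperbolic metric on the open set `H`. -/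
structure IsHyperbolicOn (ψ : ℂ → ℝ) (H : Set ℂ) : Prop where
  isOpen : IsOpen H
  smooth : ContDiffOn ℝ ∞ ψ H
  liouville : ∀ w ∈ H, fderiv ℝ (fderiv ℝ ψ) w 1 1
    + fderiv ℝ (fderiv ℝ ψ) w Complex.I Complex.I = Real.exp (2 * ψ w)

namespace IsHyperbolicOn

variable {ψ : ℂ → ℝ} {H : Set ℂ}

theorem hasWirtinger (h : IsHyperbolicOn ψ H) {w : ℂ} (hw : w ∈ H) :
    HasWirtinger (fun z => (ψ z : ℂ)) (dz ψ w) ((starRingEnd ℂ) (dz ψ w)) w := by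
  have hd := differentiableAt_of_infty h.smooth h.isOpen hw
  have h1 : HasFDerivAt (fun z => (ψ z : ℂ)) (Complex.ofRealCLM.comp (fderiv ℝ ψ w)) w :=
    Complex.ofRealCLM.hasFDerivAt.comp w hd.hasFDerivAt
  have h2 := HasWirtinger.of_differentiableAt h1.differentiableAt
  rw [h1.fderiv] at h2
  refine h2.congr_val (by simp [dz]) ?_
  simp [dz, map_ofNat]

theorem contDiffOn_dz (h : IsHyperbolicOn ψ H) : ContDiffOn ℝ ∞ (dz ψ) H := by
  have h1 : ∀ v : ℂ, ContDiffOn ℝ ∞ (fun w => (fderiv ℝ ψ w v : ℂ)) H := fun v =>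
    Complex.ofRealCLM.contDiff.comp_contDiffOn
      ((contDiffOn_fderiv_infty h.smooth h.isOpen).clm_apply contDiffOn_const)
  exact ((h1 1).sub (contDiffOn_const.mul (h1 Complex.I))).div_const 2

theorem fderiv_dz (h : IsHyperbolicOn ψ H) {w : ℂ} (hw : w ∈ H) (v : ℂ) :
    fderiv ℝ (dz ψ) w v = ((fderiv ℝ (fderiv ℝ ψ) w v 1 : ℂ)
      - Complex.I * fderiv ℝ (fderiv ℝ ψ) w v Complex.I) / 2 := by
  have hd : DifferentiableAt ℝ (fderiv ℝ ψ) w :=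
    differentiableAt_of_infty (contDiffOn_fderiv_infty h.smooth h.isOpen) h.isOpen hw
  have h1 : ∀ x : ℂ, HasFDerivAt (fun w => (fderiv ℝ ψ w x : ℂ))
      (Complex.ofRealCLM.comp ((fderiv ℝ (fderiv ℝ ψ) w).flip x)) w := fun x =>
    Complex.ofRealCLM.hasFDerivAt.comp w
      ((hd.hasFDerivAt.clm_apply (hasFDerivAt_const x w)).congr_fderiv (by simp))
  have h2 := ((h1 1).sub ((h1 Complex.I).const_mul Complex.I)).mul_const (2⁻¹ : ℂ)
  have h3 : fderiv ℝ (dz ψ) w = _ := HasFDerivAt.fderiv (f := dz ψ) h2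
  rw [h3]
  simp
  ring

/-- The second Wirtinger derivative `∂²ψ`. -/
def dzz (ψ : ℂ → ℝ) (w : ℂ) : ℂ := fderiv ℝ (dz ψ) w 1 - Complex.exp (2 * ψ w) / 4

/-- Liouville's equation reads ∂̄∂ψ = e^{2ψ}/4. The derivatives of ∂ψ in the directions 1 and i are
∂²ψ + ∂̄∂ψ and i(∂²ψ - ∂̄∂ψ), which also explains the term subtracted in `dzz`. -/
theorem fderiv_dz_I (h : IsHyperbolicOn ψ H) {w : ℂ} (hw : w ∈ H) :
    fderiv ℝ (dz ψ) w Complex.I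
      = Complex.I * (fderiv ℝ (dz ψ) w 1 - Complex.exp (2 * ψ w) / 2) := by
  have hs : fderiv ℝ (fderiv ℝ ψ) w 1 Complex.I = fderiv ℝ (fderiv ℝ ψ) w Complex.I 1 :=
    (contDiffAt_top_of_infty h.smooth h.isOpen hw).isSymmSndFDerivAt
      (by simpa using two_le_infty) _ _
  have hl : ((fderiv ℝ (fderiv ℝ ψ) w 1 1 : ℂ)
      + fderiv ℝ (fderiv ℝ ψ) w Complex.I Complex.I) = Complex.exp (2 * ψ w) := by
    exact_mod_cast congrArg (fun x : ℝ => (x : ℂ)) (h.liouville w hw)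
  rw [h.fderiv_dz hw, h.fderiv_dz hw, hs, ← hl]
  linear_combination (fderiv ℝ (fderiv ℝ ψ) w Complex.I 1 / 2 : ℂ) * Complex.I_sq

theorem hasWirtinger_dz (h : IsHyperbolicOn ψ H) {w : ℂ} (hw : w ∈ H) :
    HasWirtinger (dz ψ) (dzz ψ w) (Complex.exp (2 * ψ w) / 4) w := by
  refine (HasWirtinger.of_differentiableAt
    (differentiableAt_of_infty h.contDiffOn_dz h.isOpen hw)).congr_val ?_ ?_
  · rw [h.fderiv_dz_I hw, dzz]
    linear_combination
      (-(fderiv ℝ (dz ψ) w 1 - Complex.exp (2 * ψ w) / 2) / 2) * Complex.I_sq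
  · rw [h.fderiv_dz_I hw]
    linear_combination
      ((fderiv ℝ (dz ψ) w 1 - Complex.exp (2 * ψ w) / 2) / 2) * Complex.I_sq

theorem hasWirtinger_exp (h : IsHyperbolicOn ψ H) {w : ℂ} (hw : w ∈ H) (k : ℂ) :
    HasWirtinger (fun z => Complex.exp (k * ψ z)) (Complex.exp (k * ψ w) * (k * dz ψ w))
      (Complex.exp (k * ψ w) * (k * (starRingEnd ℂ) (dz ψ w))) w :=
  ((h.hasWirtinger hw).const_mul k).cexp

/-- Commuting derivatives, ∂̄∂²ψ = ∂(e^{2ψ}/4). Only this ∂̄-derivative matters for holomorphy, so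
the other one is left unspecified. -/
theorem hasWirtinger_dzz (h : IsHyperbolicOn ψ H) {w : ℂ} (hw : w ∈ H) :
    ∃ c, HasWirtinger (dzz ψ) c (dz ψ w * Complex.exp (2 * ψ w) / 2) w := by
  have hp := contDiffOn_fderiv_infty h.contDiffOn_dz h.isOpen
  have hpd : DifferentiableAt ℝ (fderiv ℝ (dz ψ)) w := differentiableAt_of_infty hp h.isOpen hw
  have happ : ∀ x v : ℂ, fderiv ℝ (fun z => fderiv ℝ (dz ψ) z x) w v
      = fderiv ℝ (fderiv ℝ (dz ψ)) w v x := fun x v => by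
    rw [fderiv_clm_apply hpd (differentiableAt_const x)]; simp
  have hs : fderiv ℝ (fderiv ℝ (dz ψ)) w 1 Complex.I
      = fderiv ℝ (fderiv ℝ (dz ψ)) w Complex.I 1 :=
    (contDiffAt_top_of_infty h.contDiffOn_dz h.isOpen hw).isSymmSndFDerivAt
      (by simpa using two_le_infty) _ _
  have hE := h.hasWirtinger_exp hw 2
  have hEd : DifferentiableAt ℝ (fun z => Complex.exp (2 * ψ z)) w := HasFDerivAt.differentiableAt hE
  have hEv : ∀ v, fderiv ℝ (fun z => Complex.exp (2 * ψ z)) w v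
      = Complex.exp (2 * ψ w) * (2 * dz ψ w) * v
        + Complex.exp (2 * ψ w) * (2 * (starRingEnd ℂ) (dz ψ w)) * (starRingEnd ℂ) v := fun v => by
    rw [HasFDerivAt.fderiv hE, wirtingerCLM_apply]
  have h1 : ∀ x : ℂ, DifferentiableAt ℝ (fun z => fderiv ℝ (dz ψ) z x) w := fun x =>
    hpd.clm_apply (differentiableAt_const x)
  -- the derivative in the direction `1` of the relation between the first derivatives of `∂ψ`
  have hrel : fderiv ℝ (fderiv ℝ (dz ψ)) w 1 Complex.I
      = Complex.I * (fderiv ℝ (fderiv ℝ (dz ψ)) w 1 1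
        - fderiv ℝ (fun z => Complex.exp (2 * ψ z)) w 1 / 2) := by
    have e : (fun z => fderiv ℝ (dz ψ) z Complex.I) =ᶠ[nhds w]
        fun z => Complex.I * (fderiv ℝ (dz ψ) z 1 - Complex.exp (2 * ψ z) * 2⁻¹) := by
      filter_upwards [h.isOpen.mem_nhds hw] with z hz
      rw [h.fderiv_dz_I hz, div_eq_mul_inv]
    have h3 := (((h1 1).hasFDerivAt.sub (hEd.hasFDerivAt.mul_const (2⁻¹ : ℂ))).const_mul Complex.I)
    have h5 : fderiv ℝ (fun z => Complex.I * (fderiv ℝ (dz ψ) z 1 - Complex.exp (2 * ψ z) * 2⁻¹)) w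
        = _ := HasFDerivAt.fderiv h3
    rw [← happ Complex.I, e.fderiv_eq, h5, ← happ]
    simp
    ring
  have h4 : HasFDerivAt (dzz ψ) (fderiv ℝ (fun z => fderiv ℝ (dz ψ) z 1) w
      - (4⁻¹ : ℂ) • fderiv ℝ (fun z => Complex.exp (2 * ψ z)) w) w := by
    have h3 := (h1 1).hasFDerivAt.sub (hEd.hasFDerivAt.const_mul (4⁻¹ : ℂ))
    have e : dzz ψ = fun z => fderiv ℝ (dz ψ) z 1 - 4⁻¹ * Complex.exp (2 * ψ z) := by
      funext z; rw [dzz]; ring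
    rw [e]
    exact h3
  refine ⟨_, (HasWirtinger.of_differentiableAt h4.differentiableAt).congr_val rfl ?_⟩
  rw [h4.fderiv]
  simp only [FunLike.coe_sub, FunLike.coe_smul, Pi.sub_apply, Pi.smul_apply, smul_eq_mul, happ,
    ← hs, hrel, hEv, map_one, Complex.conj_I]
  ring_nf
  simp only [Complex.I_sq]
  ring

/-- The holomorphic potential `∂²ψ - (∂ψ)²`, half the Schwarzian of a developing map. -/
def potential (ψ : ℂ → ℝ) (w : ℂ) : ℂ := dzz ψ w - dz ψ w * dz ψ w

/-- The ∂̄-derivatives of ∂²ψ and (∂ψ)² are both ∂ψ·e^{2ψ}/2. -/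
theorem differentiableOn_potential (h : IsHyperbolicOn ψ H) :
    DifferentiableOn ℂ (potential ψ) H := by
  intro w hw
  obtain ⟨c, hc⟩ := h.hasWirtinger_dzz hw
  have hp := h.hasWirtinger_dz hw
  have := (hc.sub (hp.mul hp)).congr_val rfl
    (d := 0) (by ring)
  exact this.hasDerivAt.differentiableAt.differentiableWithinAt

end IsHyperbolicOn

/-! ### Liouville's theorem from the equation y'' = -Q y. -/

namespace IsHyperbolicOn

variable {ψ : ℂ → ℝ} {H : Set ℂ}

/-- The Wronskian of `e^{-ψ}` and a function with value `y` and derivative `y'`. -/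
def wronskian (ψ : ℂ → ℝ) (y y' : ℂ → ℂ) (w : ℂ) : ℂ :=
  Complex.exp (-1 * ψ w) * (y' w + dz ψ w * y w)

/-- The `∂̄`-derivative of the Wronskian of `e^{-ψ}` and a solution. -/
def wronskianBar (ψ : ℂ → ℝ) (y y' : ℂ → ℂ) (w : ℂ) : ℂ :=
  -(starRingEnd ℂ) (dz ψ w) * wronskian ψ y y' w + 4⁻¹ * (Complex.exp (1 * ψ w) * y w)

theorem exp_mul_exp_eq (x : ℝ) :
    Complex.exp (2 * x) * Complex.exp (-1 * x) = Complex.exp (1 * x) := by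
  rw [← Complex.exp_add]; congr 1; ring

/-- The function e^{-ψ} satisfies ∂²(e^{-ψ}) = -Q e^{-ψ}, the equation solved by y. Hence their
Wronskian is killed by ∂, that is, antiholomorphic. -/
theorem hasWirtinger_wronskian (h : IsHyperbolicOn ψ H) {y y' : ℂ → ℂ} {w : ℂ} (hw : w ∈ H)
    (hy : HasDerivAt y (y' w) w) (hy' : HasDerivAt y' (-potential ψ w * y w) w) :
    HasWirtinger (wronskian ψ y y') 0 (wronskianBar ψ y y' w) w := by
  have hY := HasWirtinger.of_hasDerivAt hy
  have hY' := HasWirtinger.of_hasDerivAt hy'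
  have hp := h.hasWirtinger_dz hw
  refine ((h.hasWirtinger_exp hw (-1)).mul (hY'.add (hp.mul hY))).congr_val ?_ ?_
  · rw [potential]; ring
  · rw [wronskianBar, wronskian, ← exp_mul_exp_eq]; ring

/-- As e^{-ψ} is real it also satisfies the conjugate equation in ∂̄, and the antiholomorphic
Wronskian W inherits it: ∂̄²W = -Q̄ W. -/
theorem hasWirtinger_wronskianBar (h : IsHyperbolicOn ψ H) {y y' : ℂ → ℂ} {w : ℂ} (hw : w ∈ H)
    (hy : HasDerivAt y (y' w) w) (hy' : HasDerivAt y' (-potential ψ w * y w) w) :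
    HasWirtinger (wronskianBar ψ y y') 0
      (-(starRingEnd ℂ) (potential ψ w) * wronskian ψ y y' w) w := by
  have hY := HasWirtinger.of_hasDerivAt hy
  have hp := h.hasWirtinger_dz hw
  have hW := h.hasWirtinger_wronskian hw hy hy'
  refine ((hp.conj.neg.mul hW).add
    (((h.hasWirtinger_exp hw 1).mul hY).const_mul 4⁻¹)).congr_val ?_ ?_
  · have e1 : (starRingEnd ℂ) (Complex.exp (2 * ψ w) / 4) = Complex.exp (2 * ψ w) / 4 := by
      rw [map_div₀, ← Complex.exp_conj, map_mul, Complex.conj_ofReal, map_ofNat, map_ofNat]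
    rw [e1, wronskian, ← exp_mul_exp_eq]; ring
  · rw [wronskianBar, potential, map_sub, map_mul]; ring

/-- The Wronskian W of y and the conjugate of x solve the same antiholomorphic equation, so their
own Wronskian is constant. The constants for all pairs of solutions determine e^{-ψ} as a Hermitian
form in the solutions. -/
theorem wronskian_const (h : IsHyperbolicOn ψ H) (hc : Convex ℝ H) {y y' x x' : ℂ → ℂ}
    (hy : ∀ w ∈ H, HasDerivAt y (y' w) w ∧ HasDerivAt y' (-potential ψ w * y w) w)
    (hx : ∀ w ∈ H, HasDerivAt x (x' w) w ∧ HasDerivAt x' (-potential ψ w * x w) w)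
    {w w₀ : ℂ} (hw : w ∈ H) (hw₀ : w₀ ∈ H) :
    wronskian ψ y y' w * (starRingEnd ℂ) (x' w) - wronskianBar ψ y y' w * (starRingEnd ℂ) (x w)
      = wronskian ψ y y' w₀ * (starRingEnd ℂ) (x' w₀)
        - wronskianBar ψ y y' w₀ * (starRingEnd ℂ) (x w₀) := by
  have key : ∀ w ∈ H, HasWirtinger (fun w => wronskian ψ y y' w * (starRingEnd ℂ) (x' w)
      - wronskianBar ψ y y' w * (starRingEnd ℂ) (x w)) 0 0 w := by
    intro w hw
    have h1 := h.hasWirtinger_wronskian hw (hy w hw).1 (hy w hw).2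
    have h2 := h.hasWirtinger_wronskianBar hw (hy w hw).1 (hy w hw).2
    have h3 := (HasWirtinger.of_hasDerivAt (hx w hw).1).conj
    have h4 := (HasWirtinger.of_hasDerivAt (hx w hw).2).conj
    refine ((h1.mul h4).sub (h2.mul h3)).congr_val ?_ ?_
    · simp
    · simp; ring
  refine hc.is_const_of_fderivWithin_eq_zero (𝕜 := ℝ)
    (f := fun w => wronskian ψ y y' w * (starRingEnd ℂ) (x' w)
      - wronskianBar ψ y y' w * (starRingEnd ℂ) (x w))
    (fun z hz => (HasFDerivAt.differentiableAt (key z hz)).differentiableWithinAt)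
    (fun z hz => ?_) hw hw₀
  rw [fderivWithin_of_isOpen h.isOpen hz, HasFDerivAt.fderiv (key z hz)]
  ext1 v
  simp

/-- Liouville's representation: a hyperbolic metric on a convex domain is the pull-back of the
hyperbolic metric of the unit disc under a holomorphic function. -/
theorem exists_liouville (h : IsHyperbolicOn ψ H) (hc : Convex ℝ H) {w₀ : ℂ} (hw₀ : w₀ ∈ H) :
    ∃ g : ℂ → ℂ, DifferentiableOn ℂ g H ∧
      ∀ w ∈ H, ‖g w‖ < 1 ∧ 2 * ‖deriv g w‖ = Real.exp (ψ w) * (1 - ‖g w‖ ^ 2) := by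
  -- Normalisation: with y₁(w₀) = 0 and y₂(w₀) = s, the identity |y₂|² - |y₁|² = 2e^{-ψ} holds at
  -- w₀. The slope of y₂ is chosen so that its Wronskian with e^{-ψ} vanishes at w₀.
  set s : ℝ := Real.sqrt (2 * Real.exp (-ψ w₀)) with hs
  have hs0 : 0 < s := Real.sqrt_pos.2 (by positivity)
  have hs2 : (s : ℂ) * s = 2 * Complex.exp (-1 * ψ w₀) := by
    rw [← Complex.ofReal_mul, hs, Real.mul_self_sqrt (by positivity)]
    push_cast; ring_nf
  have hsc : (s : ℂ) ≠ 0 := by exact_mod_cast hs0.ne'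
  have hQ := h.differentiableOn_potential
  obtain ⟨y₁, y₁', h10, h10', hy1⟩ := exists_solution_second_order h.isOpen hc hw₀ hQ 0 (1 / s)
  obtain ⟨y₂, y₂', h20, h20', hy2⟩ := exists_solution_second_order h.isOpen hc hw₀ hQ s
    (-dz ψ w₀ * s)
  have hdet : ∀ w ∈ H, y₁ w * y₂' w - y₂ w * y₁' w = -1 := by
    intro w hw
    have key : ∀ w ∈ H, HasDerivAt (fun w => y₁ w * y₂' w - y₂ w * y₁' w) 0 w := fun w hw =>
      (((hy1 w hw).1.mul (hy2 w hw).2).sub ((hy2 w hw).1.mul (hy1 w hw).2)).congr_deriv (by ring)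
    have e := hc.is_const_of_fderivWithin_eq_zero (𝕜 := ℂ)
      (f := fun w => y₁ w * y₂' w - y₂ w * y₁' w)
      (fun z hz => (key z hz).differentiableAt.differentiableWithinAt)
      (fun z hz => by
        rw [fderivWithin_of_isOpen h.isOpen hz, (key z hz).hasFDerivAt.fderiv]
        ext; simp) hw hw₀
    rw [e, h10, h20, h10']
    field_simp
    ring
  have hexp : Complex.exp (1 * ψ w₀) * Complex.exp (-1 * ψ w₀) = 1 := by
    rw [← Complex.exp_add]; simp
  have W1 : wronskian ψ y₁ y₁' w₀ = Complex.exp (-1 * ψ w₀) / s := by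
    rw [wronskian, h10, h10']; ring
  have W2 : wronskian ψ y₂ y₂' w₀ = 0 := by
    rw [wronskian, h20, h20']; ring
  have V1 : wronskianBar ψ y₁ y₁' w₀
      = -(starRingEnd ℂ) (dz ψ w₀) * (Complex.exp (-1 * ψ w₀) / s) := by
    rw [wronskianBar, W1, h10]; ring
  have V2 : wronskianBar ψ y₂ y₂' w₀ = 4⁻¹ * (Complex.exp (1 * ψ w₀) * s) := by
    rw [wronskianBar, W2, h20]; ring
  have hE := Complex.exp_ne_zero (-1 * ψ w₀)
  have hrho : ∀ w ∈ H, ((‖y₂ w‖ : ℂ) ^ 2 - (‖y₁ w‖ : ℂ) ^ 2) = 2 * Complex.exp (-1 * ψ w) := by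
    intro w hw
    have n11 := h.wronskian_const hc hy1 hy1 hw hw₀
    have n12 := h.wronskian_const hc hy1 hy2 hw hw₀
    have n21 := h.wronskian_const hc hy2 hy1 hw hw₀
    have n22 := h.wronskian_const hc hy2 hy2 hw hw₀
    rw [W1, V1, h10, h10'] at n11
    rw [W1, V1, h20, h20'] at n12
    rw [W2, V2, h10, h10'] at n21
    rw [W2, V2, h20, h20'] at n22
    simp only [map_zero, map_div₀, map_one, map_mul, map_neg, Complex.conj_ofReal] at n11 n12 n21 n22
    have e11 : Complex.exp (-1 * ψ w₀) / s * (1 / s)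
      - -(starRingEnd ℂ) (dz ψ w₀) * (Complex.exp (-1 * ψ w₀) / s) * 0 = 1 / 2 := by
      rw [mul_zero, sub_zero, div_mul_div_comm, mul_one, hs2, div_mul_cancel_right₀ hE, one_div]
    have e12 : Complex.exp (-1 * ψ w₀) / s * (-(starRingEnd ℂ) (dz ψ w₀) * s)
        - -(starRingEnd ℂ) (dz ψ w₀) * (Complex.exp (-1 * ψ w₀) / s) * s = 0 := by ring
    have e22 : 0 * (-(starRingEnd ℂ) (dz ψ w₀) * s) - 4⁻¹ * (Complex.exp (1 * ψ w₀) * s) * s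
        = -1 / 2 := by
      linear_combination (-4⁻¹ * Complex.exp (1 * ψ w₀)) * hs2 - 2⁻¹ * hexp
    rw [e11] at n11
    rw [e12] at n12
    rw [e22] at n22
    have hd := hdet w hw
    have hdc := congrArg (starRingEnd ℂ) hd
    simp only [map_sub, map_mul, map_neg, map_one] at hdc
    -- Cramer's rule with determinant -1. The constants form the diagonal matrix (1/2, -1/2), so the
    -- Wronskians of y₁ and y₂ are ȳ₂/2 and ȳ₁/2. Eliminating y₁' and y₂' between them leaves |y₂|²
    -- - |y₁|² = 2e^{-ψ}.
    have w1 : wronskian ψ y₁ y₁' w = (starRingEnd ℂ) (y₂ w) / 2 := by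
      linear_combination wronskian ψ y₁ y₁' w * hdc + (starRingEnd ℂ) (y₂ w) * n11
        - (starRingEnd ℂ) (y₁ w) * n12
    have w2 : wronskian ψ y₂ y₂' w = (starRingEnd ℂ) (y₁ w) / 2 := by
      linear_combination wronskian ψ y₂ y₂' w * hdc + (starRingEnd ℂ) (y₂ w) * n21
        - (starRingEnd ℂ) (y₁ w) * n22
    rw [← Complex.conj_mul', ← Complex.conj_mul']
    rw [wronskian] at w1 w2
    linear_combination -2 * y₂ w * w1 + 2 * y₁ w * w2 - 2 * Complex.exp (-1 * ψ w) * hd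
  have hrho' : ∀ w ∈ H, ‖y₂ w‖ ^ 2 - ‖y₁ w‖ ^ 2 = 2 * Real.exp (-ψ w) := by
    intro w hw
    have := hrho w hw
    rw [neg_one_mul] at this
    exact_mod_cast this
  have hlt : ∀ w ∈ H, ‖y₁ w‖ < ‖y₂ w‖ := fun w hw => by
    have := hrho' w hw
    have h2 := Real.exp_pos (-ψ w)
    exact lt_of_pow_lt_pow_left₀ 2 (norm_nonneg _) (by linarith)
  have hne : ∀ w ∈ H, y₂ w ≠ 0 := fun w hw h0 => by
    have := hlt w hw
    rw [h0, norm_zero] at this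
    exact absurd this (norm_nonneg _).not_gt
  have hder : ∀ w ∈ H, HasDerivAt (fun w => y₁ w / y₂ w) (1 / y₂ w ^ 2) w := fun w hw =>
    ((hy1 w hw).1.div (hy2 w hw).1 (hne w hw)).congr_deriv (by
      congr 1; linear_combination -hdet w hw)
  refine ⟨fun w => y₁ w / y₂ w,
    fun w hw => (hder w hw).differentiableAt.differentiableWithinAt, fun w hw => ⟨?_, ?_⟩⟩
  · rw [norm_div, div_lt_one (norm_pos_iff.2 (hne w hw))]
    exact hlt w hw
  · have hn := norm_pos_iff.2 (hne w hw)
    have he : Real.exp (ψ w) * Real.exp (-ψ w) = 1 := by rw [← Real.exp_add]; simp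
    rw [(hder w hw).deriv, norm_div, norm_div, norm_pow, norm_one]
    field_simp
    linear_combination -Real.exp (ψ w) * hrho' w hw - 2 * he

end IsHyperbolicOn

/-! ### Developing maps from holomorphic functions -/

/-- The isometry from the unit disc to the hyperboloid. -/
def discToHyperboloid (g : ℂ) : Mink :=
  ![2 * g.re / (1 - Complex.normSq g), 2 * g.im / (1 - Complex.normSq g),
    (1 + Complex.normSq g) / (1 - Complex.normSq g)]

theorem normSq_lt_one {g : ℂ} (hg : ‖g‖ < 1) : Complex.normSq g < 1 := by
  rw [Complex.normSq_eq_norm_sq]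
  nlinarith [norm_nonneg g]

theorem contDiffAt_discToHyperboloid {g : ℂ} (hg : ‖g‖ < 1) :
    ContDiffAt ℝ ∞ discToHyperboloid g := by
  have h1 : ContDiff ℝ ∞ fun g : ℂ => Complex.normSq g := by
    have : (fun g : ℂ => Complex.normSq g) = fun g => ‖g‖ ^ 2 := by
      funext g; rw [Complex.normSq_eq_norm_sq]
    rw [this]
    exact contDiff_norm_sq ℝ
  have hre : ContDiff ℝ ∞ Complex.re := Complex.reCLM.contDiff
  have him : ContDiff ℝ ∞ Complex.im := Complex.imCLM.contDiff
  have hn : 1 - Complex.normSq g ≠ 0 := by linarith [normSq_lt_one hg]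
  have hd : ContDiffAt ℝ ∞ (fun g : ℂ => 1 - Complex.normSq g) g :=
    (contDiff_const.sub h1).contDiffAt
  rw [contDiffAt_pi]
  intro i
  fin_cases i
  · exact (contDiff_const.mul hre).contDiffAt.div hd hn
  · exact (contDiff_const.mul him).contDiffAt.div hd hn
  · exact (contDiff_const.add h1).contDiffAt.div hd hn

theorem discToHyperboloid_mem {g : ℂ} (hg : ‖g‖ < 1) : discToHyperboloid g ∈ hyperboloid := by
  have hn : 0 < 1 - Complex.normSq g := by linarith [normSq_lt_one hg]
  refine ⟨?_, ?_⟩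
  · simp only [mink, discToHyperboloid, Matrix.cons_val]
    field_simp
    rw [Complex.normSq_apply]
    ring
  · simp only [discToHyperboloid, Matrix.cons_val]
    have := Complex.normSq_nonneg g
    positivity

theorem mink_fderiv_discToHyperboloid {g : ℂ} (hg : ‖g‖ < 1) (v₁ v₂ : ℂ) :
    mink (fderiv ℝ discToHyperboloid g v₁) (fderiv ℝ discToHyperboloid g v₂)
      = 4 / (1 - Complex.normSq g) ^ 2 * inner ℝ v₁ v₂ := by
  have hn : 1 - Complex.normSq g ≠ 0 := by linarith [normSq_lt_one hg]
  have hd : DifferentiableAt ℝ discToHyperboloid g :=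
    (contDiffAt_discToHyperboloid hg).differentiableAt (by simp)
  have key : ∀ v : ℂ, fderiv ℝ discToHyperboloid g v =
      ![2 * v.re / (1 - Complex.normSq g)
          + 4 * g.re * (g.re * v.re + g.im * v.im) / (1 - Complex.normSq g) ^ 2,
        2 * v.im / (1 - Complex.normSq g)
          + 4 * g.im * (g.re * v.re + g.im * v.im) / (1 - Complex.normSq g) ^ 2,
        4 * (g.re * v.re + g.im * v.im) / (1 - Complex.normSq g) ^ 2] := by
    intro v
    have hl : HasDerivAt (fun t : ℝ => g + t • v) v 0 := by
      simpa using ((hasDerivAt_id (0 : ℝ)).smul_const v).const_add g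
    have hg0 : g + (0 : ℝ) • v = g := by simp
    have h1 : HasDerivAt (fun t : ℝ => discToHyperboloid (g + t • v))
        (fderiv ℝ discToHyperboloid g v) 0 := by
      have h0 : HasFDerivAt discToHyperboloid (fderiv ℝ discToHyperboloid g)
          (g + (0 : ℝ) • v) := by
        rw [hg0]; exact hd.hasFDerivAt
      exact h0.comp_hasDerivAt (0 : ℝ) hl
    have h1' := hasDerivAt_pi.1 h1
    have hre : HasDerivAt (fun t : ℝ => (g + t • v).re) v.re 0 :=
      Complex.reCLM.hasFDerivAt.comp_hasDerivAt (0 : ℝ) hl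
    have him : HasDerivAt (fun t : ℝ => (g + t • v).im) v.im 0 :=
      Complex.imCLM.hasFDerivAt.comp_hasDerivAt (0 : ℝ) hl
    have hns : HasDerivAt (fun t : ℝ => Complex.normSq (g + t • v))
        (2 * (g.re * v.re + g.im * v.im)) 0 := by
      simp only [Complex.normSq_apply]
      refine ((hre.mul hre).add (him.mul him)).congr_deriv ?_
      simp only [hg0]; ring
    have hden := hns.const_sub 1
    have hn' : 1 - Complex.normSq (g + (0 : ℝ) • v) ≠ 0 := by rwa [hg0]
    have hr : ∀ i, fderiv ℝ discToHyperboloid g v i = _ := fun i => rfl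
    ext i
    fin_cases i
    · refine (h1' 0).unique (((hre.const_mul 2).div hden hn').congr_deriv ?_)
      simp only [hg0, Fin.zero_eta, Matrix.cons_val]
      field_simp
      ring
    · refine (h1' 1).unique (((him.const_mul 2).div hden hn').congr_deriv ?_)
      simp only [hg0, Fin.mk_one, Matrix.cons_val]
      field_simp
      ring
    · refine (h1' 2).unique (((hns.const_add 1).div hden hn').congr_deriv ?_)
      simp only [hg0, Fin.reduceFinMk, Matrix.cons_val]
      field_simp
      ring
  rw [key, key]
  simp only [mink, Matrix.cons_val, Complex.inner]
  have e : Complex.normSq g = g.re * g.re + g.im * g.im := Complex.normSq_apply g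
  set n := 1 - Complex.normSq g with hndef
  have hgn : g.re * g.re + g.im * g.im = 1 - n := by rw [hndef, e]; ring
  simp only [Complex.mul_re, Complex.conj_re, Complex.conj_im]
  field_simp
  linear_combination (16 * (g.re * v₁.re + g.im * v₁.im) * (g.re * v₂.re + g.im * v₂.im)) * hgn

/-- The hyperboloid metric on the disc is 4|dg|²/(1 - |g|²)². The relation between |g'| and e^ψ says
precisely that g pulls it back to e^{2ψ}|dw|². -/
theorem isLocalIso_of_liouville {ψ : ℂ → ℝ} {H : Set ℂ} (hH : IsOpen H)
    (hψ : ContDiffOn ℝ ∞ ψ H) {g : ℂ → ℂ} (hg : DifferentiableOn ℂ g H)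
    (hg1 : ∀ w ∈ H, ‖g w‖ < 1 ∧ 2 * ‖deriv g w‖ = Real.exp (ψ w) * (1 - ‖g w‖ ^ 2)) :
    IsLocalIso ψ H (fun w => discToHyperboloid (g w)) where
  isOpen := hH
  smooth_metric := hψ
  smooth w hw := ((contDiffAt_discToHyperboloid (hg1 w hw).1).comp w
    (((hg.contDiffOn hH).contDiffAt (hH.mem_nhds hw)).restrict_scalars ℝ)).contDiffWithinAt
  maps w hw := discToHyperboloid_mem (hg1 w hw).1
  isometric w hw v₁ v₂ := by
    have hd := (hg.differentiableAt (hH.mem_nhds hw)).hasDerivAt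
    have hf : HasFDerivAt (fun w => discToHyperboloid (g w)) _ w :=
      ((contDiffAt_discToHyperboloid (hg1 w hw).1).differentiableAt (by simp)).hasFDerivAt.comp w
        (hd.hasFDerivAt.restrictScalars ℝ)
    have hn : 0 < 1 - Complex.normSq (g w) := by linarith [normSq_lt_one (hg1 w hw).1]
    have h2 := (hg1 w hw).2
    rw [← Complex.normSq_eq_norm_sq] at h2
    rw [hf.fderiv]
    simp only [ContinuousLinearMap.comp_apply]
    rw [mink_fderiv_discToHyperboloid (hg1 w hw).1, metric]
    have e : inner ℝ (v₁ * deriv g w) (v₂ * deriv g w) = ‖deriv g w‖ ^ 2 * inner ℝ v₁ v₂ := by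
      rw [← Complex.normSq_eq_norm_sq, Complex.normSq_apply]
      simp only [Complex.inner, map_mul]
      simp
      ring
    have e2 : Real.exp (2 * ψ w) = Real.exp (ψ w) ^ 2 := by rw [← Real.exp_nat_mul]; norm_num
    have e3 : Real.exp (ψ w) = 2 * ‖deriv g w‖ / (1 - Complex.normSq (g w)) := by
      rw [h2]; field_simp
    have e4 : ∀ v, (ContinuousLinearMap.restrictScalars ℝ
        (ContinuousLinearMap.toSpanSingleton ℂ (deriv g w))) v = v * deriv g w := fun v => by simp
    rw [e4, e4, e, e2, e3]
    field_simp
    ring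

/-! ### Holonomy and the triviality of cocycles -/

theorem IsDevelopingMap.isLocalIso {φ : ℂ → ℝ} {R : ℝ} {dev : ℂ → Mink} (hR : 0 < R)
    (hφ : ContDiffOn ℝ ∞ φ (pdisc R)) (h : IsDevelopingMap φ R dev) :
    IsLocalIso (liftMetric φ) (cover R) dev where
  isOpen := isOpen_cover R
  smooth_metric := contDiffOn_liftMetric hR hφ
  smooth := h.smooth
  maps := h.maps
  isometric := h.isometric

theorem IsLocalIso.isDevelopingMap {φ : ℂ → ℝ} {R : ℝ} {dev : ℂ → Mink}
    (h : IsLocalIso (liftMetric φ) (cover R) dev) : IsDevelopingMap φ R dev where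
  smooth := h.smooth
  maps := h.maps
  isometric := h.isometric

theorem cover_nonempty (R : ℝ) : (cover R).Nonempty :=
  ⟨((Real.log R - 1 : ℝ) : ℂ), by simp [mem_cover]⟩

theorem mink_ext {x y : Mink} (h : ∀ z, mink x z = mink y z) : x = y := by
  ext i
  have := h (Pi.single i 1)
  fin_cases i <;> simpa [mink] using this

/-- Extending an isometry from a frame. -/
theorem IsLocalIso.mink_map {ψ ψ' : ℂ → ℝ} {H H' : Set ℂ} {dev dev' : ℂ → Mink}
    (h : IsLocalIso ψ H dev) (h' : IsLocalIso ψ' H' dev') {w w' : ℂ} (hw : w ∈ H) (hw' : w' ∈ H')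
    (hψ : ψ' w' = ψ w) {A : Mink →ₗ[ℝ] Mink} (h0 : A (dev w) = dev' w')
    (h1 : ∀ v, A (fderiv ℝ dev w v) = fderiv ℝ dev' w' v) (x y : Mink) :
    mink (A x) (A y) = mink x y := by
  set c := Real.exp (2 * ψ w) with hc
  have hc0 : c ≠ 0 := (Real.exp_pos _).ne'
  set e₁ := fderiv ℝ dev w 1 with he₁
  set e₂ := fderiv ℝ dev w Complex.I with he₂
  have m11 : mink e₁ e₁ = c := by rw [h.isometric w hw]; simp [metric, hc]
  have m22 : mink e₂ e₂ = c := by rw [h.isometric w hw]; simp [metric, hc]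
  have m12 : mink e₁ e₂ = 0 := by rw [h.isometric w hw]; simp [metric, Complex.inner]
  have m21 : mink e₂ e₁ = 0 := by rw [mink_comm, m12]
  have m13 : mink e₁ (dev w) = 0 := h.mink_fderiv hw _
  have m23 : mink e₂ (dev w) = 0 := h.mink_fderiv hw _
  have m31 : mink (dev w) e₁ = 0 := by rw [mink_comm, m13]
  have m32 : mink (dev w) e₂ = 0 := by rw [mink_comm, m23]
  have m33 := h.mink_self hw
  have a11 : mink (A e₁) (A e₁) = c := by
    rw [h1, h'.isometric w' hw']; simp [metric, hc, hψ]
  have a22 : mink (A e₂) (A e₂) = c := by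
    rw [h1, h'.isometric w' hw']; simp [metric, hc, hψ]
  have a12 : mink (A e₁) (A e₂) = 0 := by
    rw [h1, h1, h'.isometric w' hw']; simp [metric, Complex.inner]
  have a21 : mink (A e₂) (A e₁) = 0 := by rw [mink_comm, a12]
  have a13 : mink (A e₁) (A (dev w)) = 0 := by rw [h1, h0]; exact h'.mink_fderiv hw' _
  have a23 : mink (A e₂) (A (dev w)) = 0 := by rw [h1, h0]; exact h'.mink_fderiv hw' _
  have a31 : mink (A (dev w)) (A e₁) = 0 := by rw [mink_comm, a13]
  have a32 : mink (A (dev w)) (A e₂) = 0 := by rw [mink_comm, a23]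
  have a33 : mink (A (dev w)) (A (dev w)) = -1 := by rw [h0]; exact h'.mink_self hw'
  have expand : ∀ x : Mink, ∃ p q r : ℝ, x = p • e₁ + q • e₂ + r • dev w := by
    intro x
    refine ⟨mink x e₁ / c, mink x e₂ / c, -mink x (dev w), sub_eq_zero.1 ?_⟩
    refine eq_zero_of_det3 (h.det_frame_ne_zero hw) ?_ ?_ ?_ <;>
    · rw [mink_comm]
      simp only [← he₁, ← he₂, mink_sub_left, mink_add_left, mink_smul_left, m11, m12, m13, m21,
        m22, m23, m31, m32, m33]
      field_simp
      ring
  obtain ⟨p, q, r, rfl⟩ := expand x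
  obtain ⟨p', q', r', rfl⟩ := expand y
  simp only [map_add, map_smul, mink_add_left, mink_add_right, mink_smul_left, mink_smul_right,
    m11, m12, m13, m21, m22, m23, m31, m32, m33, a11, a12, a13, a21, a22, a23, a31, a32, a33]

/-- Two local isometries differ by a linear map. -/
theorem IsLocalIso.exists_linear {ψ : ℂ → ℝ} {H : Set ℂ} {dev dev' : ℂ → Mink}
    (h : IsLocalIso ψ H dev) (h' : IsLocalIso ψ H dev') (hc : Convex ℝ H) :
    ∃ A : Mink →ₗ[ℝ] Mink, ∀ w ∈ H, dev' w = A (dev w) := by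
  -- The function ⟨s, dev'⟩ solves Hess u = u I, so it is also a linear function of `dev`.
  have key : ∀ s : Mink, ∃ t : Mink, ∀ w ∈ H, mink s (dev' w) = mink t (dev w) := by
    intro s
    have hs := contDiffOn_mink (contDiffOn_const (c := s)) h'.smooth
    have h0 := contDiffOn_mink (contDiffOn_const (c := (0 : Mink))) h.smooth
    obtain ⟨t, ht⟩ := h.sub_eq_mink hc hs h0
      ((isPrimitive_const s).isHessSub h' contDiffOn_const)
      ((isPrimitive_const (0 : Mink)).isHessSub h contDiffOn_const)
    exact ⟨t, fun w hw => by rw [ht w hw, ← mink_add_left, zero_add]⟩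
  choose T hT using key
  -- Vectors whose Minkowski products with x are its coordinates; hence the sign of the last one.
  let η : Fin 3 → Mink := ![Pi.single 0 1, Pi.single 1 1, -Pi.single 2 1]
  refine ⟨LinearMap.pi fun i => (minkL (T (η i)) : Mink →ₗ[ℝ] ℝ), fun w hw => ?_⟩
  ext i
  have := hT (η i) w hw
  simp only [LinearMap.pi_apply, ContinuousLinearMap.coe_coe, minkL_apply, ← this]
  fin_cases i <;> simp [η, mink]

theorem fderiv_deck {E : Type*} [NormedAddCommGroup E] [NormedSpace ℝ E] (f : ℂ → E) (n : ℤ)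
    (w : ℂ) : fderiv ℝ (fun z => f (deck n z)) w = fderiv ℝ f (deck n w) :=
  fderiv_comp_add_right _

theorem IsLocalIso.comp_deck {φ : ℂ → ℝ} {R : ℝ} {dev : ℂ → Mink}
    (h : IsLocalIso (liftMetric φ) (cover R) dev) (n : ℤ) :
    IsLocalIso (liftMetric φ) (cover R) (fun w => dev (deck n w)) where
  isOpen := h.isOpen
  smooth_metric := h.smooth_metric
  smooth := h.smooth.comp (contDiff_id.add contDiff_const).contDiffOn
    fun w hw => (deck_mem_cover n).2 hw
  maps w hw := h.maps _ ((deck_mem_cover n).2 hw)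
  isometric w hw v₁ v₂ := by
    rw [fderiv_deck, h.isometric _ ((deck_mem_cover n).2 hw), metric, metric, liftMetric_deck]

theorem IsLocalIso.continuousOn_det {ψ : ℂ → ℝ} {H : Set ℂ} {dev : ℂ → Mink}
    (h : IsLocalIso ψ H dev) : ContinuousOn
      (fun w => det3 (fderiv ℝ dev w 1) (fderiv ℝ dev w Complex.I) (dev w)) H := by
  have h1 : ∀ v : ℂ, ContinuousOn (fun w => fderiv ℝ dev w v) H := fun v =>
    ((contDiffOn_fderiv_infty h.smooth h.isOpen).continuousOn).clm_apply continuousOn_const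
  have c1 := continuousOn_pi.1 (h1 1)
  have c2 := continuousOn_pi.1 (h1 Complex.I)
  have c3 := continuousOn_pi.1 h.smooth.continuousOn
  simp only [det3]
  exact (((c1 0).mul (((c2 1).mul (c3 2)).sub ((c2 2).mul (c3 1)))).sub
    ((c1 1).mul (((c2 0).mul (c3 2)).sub ((c2 2).mul (c3 0))))).add
    ((c1 2).mul (((c2 0).mul (c3 1)).sub ((c2 1).mul (c3 0))))

/-- Every developing map of the punctured disc has a holonomy in `SO₀(2,1)`. -/
theorem IsLocalIso.exists_holonomy {φ : ℂ → ℝ} {R : ℝ} {dev : ℂ → Mink}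
    (h : IsLocalIso (liftMetric φ) (cover R) dev) :
    ∃ A : Mink ≃ₗ[ℝ] Mink, IsSO0 A ∧ ∀ w ∈ cover R, dev (deck 1 w) = A (dev w) := by
  have h' := h.comp_deck 1
  obtain ⟨A, hA⟩ := h.exists_linear h' (convex_cover R)
  obtain ⟨w, hw⟩ := cover_nonempty R
  have hw' : deck 1 w ∈ cover R := (deck_mem_cover 1).2 hw
  have hAd : ∀ v, A (fderiv ℝ dev w v) = fderiv ℝ dev (deck 1 w) v := by
    intro v
    have e : (fun z => dev (deck 1 z)) =ᶠ[nhds w]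
        fun z => LinearMap.toContinuousLinearMap A (dev z) := by
      filter_upwards [h.isOpen.mem_nhds hw] with z hz using hA z hz
    rw [← fderiv_deck, e.fderiv_eq]
    have := ((LinearMap.toContinuousLinearMap A).hasFDerivAt.comp w
      (h.differentiableAt hw).hasFDerivAt).fderiv
    have e2 : fderiv ℝ (fun z => LinearMap.toContinuousLinearMap A (dev z)) w = _ := this
    rw [e2]; rfl
  have hiso : ∀ x y, mink (A x) (A y) = mink x y :=
    h.mink_map h hw hw' (liftMetric_deck φ 1 w) (hA w hw).symm hAd
  have hinj : Function.Injective A := fun x y hxy =>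
    mink_ext fun z => by rw [← hiso, ← hiso y, hxy]
  have hdet : LinearMap.det A = 1 := by
    set f := fun w => det3 (fderiv ℝ dev w 1) (fderiv ℝ dev w Complex.I) (dev w) with hf
    have e : f (deck 1 w) = LinearMap.det A * f w := by
      simp only [hf]
      rw [← det3_map, hAd, hAd, ← hA w hw]
    have s1 : f (deck 1 w) ^ 2 = f w ^ 2 := by
      simp only [hf]
      rw [h.det_frame_sq hw, h.det_frame_sq hw', liftMetric_deck]
    -- The frame determinant is continuous and never zero on the connected cover, so it has the same
    -- sign at w and at its translate. The squares agree because the lifted metric is invariant,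
    -- whence det A = 1.
    have hpos : 0 < f w * f (deck 1 w) := by
      by_contra! hneg
      have hfc := h.continuousOn_det
      have hpc := (convex_cover R).isPreconnected
      have hz : (0 : ℝ) ∈ f '' cover R := by
        rcases mul_nonpos_iff.1 hneg with ⟨h1, h2⟩ | ⟨h1, h2⟩
        · exact hpc.intermediate_value hw' hw hfc ⟨h2, h1⟩
        · exact hpc.intermediate_value hw hw' hfc ⟨h1, h2⟩
      obtain ⟨z, hz, hz0⟩ := hz
      exact h.det_frame_ne_zero hz hz0
    have hfw : f w ≠ 0 := h.det_frame_ne_zero hw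
    have : f (deck 1 w) = f w := by
      rcases sq_eq_sq_iff_eq_or_eq_neg.1 s1 with h1 | h1
      · exact h1
      · rw [h1] at hpos
        nlinarith [sq_nonneg (f w)]
    rw [this] at e
    exact (mul_right_cancel₀ hfw (by rw [one_mul]; exact e)).symm
  refine ⟨LinearEquiv.ofInjectiveEndo A hinj, ⟨hiso, ?_, fun v hv => ⟨?_, ?_⟩⟩, hA⟩
  · rw [show (LinearEquiv.ofInjectiveEndo A hinj : Mink →ₗ[ℝ] Mink) = A from
      LinearMap.ext fun _ => rfl, hdet]
  · exact (hiso v v).trans hv.1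
  -- A v has negative product with the point A(dev w) of the upper sheet. If A v were on the lower
  -- sheet, -A v would be on the upper one, with positive product.
  · show 0 < A v 2
    have h1 := mink_neg_of_mem hv (h.maps w hw)
    rw [← hiso, ← hA w hw] at h1
    by_contra! hle
    have hself : mink (A v) (A v) = -1 := (hiso v v).trans hv.1
    have hlt : A v 2 < 0 := by
      refine lt_of_le_of_ne hle fun h0 => ?_
      simp only [mink, h0] at hself
      nlinarith [sq_nonneg (A v 0), sq_nonneg (A v 1)]
    have h2 : (-1 : ℝ) • A v ∈ hyperboloid := by
      refine ⟨?_, ?_⟩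
      · rw [mink_smul_left, mink_smul_right, hself]; norm_num
      · simp only [Pi.smul_apply, smul_eq_mul]; linarith
    have h3 := mink_neg_of_mem h2 (h.maps _ hw')
    rw [mink_smul_left] at h3
    linarith

theorem deck_deck (m n : ℤ) (w : ℂ) : deck m (deck n w) = deck (m + n) w := by
  simp only [deck]; push_cast; ring

theorem deck_zero (w : ℂ) : deck 0 w = w := by simp [deck]

theorem dev_deck_zpow {R : ℝ} {dev : ℂ → Mink} {A : Mink ≃ₗ[ℝ] Mink}
    (h : ∀ w ∈ cover R, dev (deck 1 w) = A (dev w)) (n : ℤ) :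
    ∀ w ∈ cover R, dev (deck n w) = (A ^ n) (dev w) := by
  induction n using Int.induction_on with
  | zero => intro w _; rw [deck_zero, zpow_zero]; rfl
  | succ n ih =>
    intro w hw
    rw [add_comm, ← deck_deck, h _ ((deck_mem_cover _).2 hw), ih w hw, zpow_one_add]; rfl
  | pred n ih =>
    intro w hw
    have h1 := h _ ((deck_mem_cover (-(n : ℤ) - 1)).2 hw)
    rw [deck_deck, add_sub_cancel, ih w hw] at h1
    have h2 : A ((A ^ (-(n : ℤ) - 1)) (dev w)) = (A ^ (-(n : ℤ))) (dev w) := by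
      have e : A ^ (-(n : ℤ)) = A * A ^ (-(n : ℤ) - 1) := by
        rw [← zpow_one_add, add_sub_cancel]
      rw [e]; rfl
    exact A.injective (h1.symm.trans h2.symm)

theorem mink_zpow {A : Mink ≃ₗ[ℝ] Mink} (h : ∀ v w : Mink, mink (A v) (A w) = mink v w) (n : ℤ)
    (v w : Mink) : mink ((A ^ n) v) ((A ^ n) w) = mink v w := by
  have hs : ∀ n : ℤ, ∀ x, (A ^ (n + 1)) x = A ((A ^ n) x) := fun n x => by
    rw [add_comm, zpow_one_add]; rfl
  induction n using Int.induction_on with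
  | zero => rfl
  | succ n ih => rw [hs, hs, h, ih]
  | pred n ih =>
    rw [← h]
    rw [← hs, ← hs, sub_add_cancel, ih]

/-- If `b = Hess u - u I` has a single-valued solution on the punctured disc, then `δ b` is
trivial. -/
theorem deltaTrivial_of_isHessSub {θ₀ R : ℝ} {φ : ℂ → ℝ} (hR : 0 < R)
    (hφ : IsHyperbolicCone θ₀ R φ) {dev₀ : ℂ → Mink}
    (hdev₀ : IsLocalIso (liftMetric φ) (cover R) dev₀) {b : ℂ → ℂ →L[ℝ] ℂ} {u : ℂ → ℝ}
    (hu : ContDiffOn ℝ ∞ u (pdisc R)) (hb : IsHessSub φ (pdisc R) b u) :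
    DeltaTrivial φ R b := by
  have hue := contDiffOn_comp_exp hR hu
  have hbe := (isHessSub_lift_iff hR hφ.smooth hu).2 hb
  refine ⟨?_, ?_⟩
  · obtain ⟨A, hA, hAd⟩ := hdev₀.exists_holonomy
    refine ⟨A, 0, hA, dev₀, fun w => u (Complex.exp w), hdev₀.isDevelopingMap, hAd, hue, hbe,
      fun n w _ => ?_⟩
    dsimp only
    rw [exp_deck, sub_self]
    simp [mink]
  · rintro A t ⟨hA, dev, u₁, hdev, hAd, hu₁, hb₁, ht⟩
    have hl := hdev.isLocalIso hR hφ.smooth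
    -- Any other solution over any developing map differs from u ∘ exp by some ⟨s, dev⟩. Its cocycle
    -- is therefore s - Aⁿ s, the coboundary of -s.
    obtain ⟨s, hs⟩ := hl.sub_eq_mink (convex_cover R) hu₁ hue hb₁ hbe
    refine ⟨-s, fun n => ?_⟩
    rw [map_neg, sub_neg_eq_add, neg_add_eq_sub]
    refine hl.eq_of_forall_mink (cover_nonempty R) fun w hw => ?_
    have hw' := (deck_mem_cover (-n)).2 hw
    rw [← ht n w hw, hs w hw, hs _ hw', exp_deck, dev_deck_zpow hAd _ w hw, mink_sub_left,
      ← mink_zpow hA.isometry n s ((A ^ (-n)) (dev w))]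
    have : (A ^ n) ((A ^ (-n)) (dev w)) = dev w := by
      have e : A ^ n * A ^ (-n) = 1 := by rw [← zpow_add, add_neg_cancel, zpow_zero]
      exact congrArg (fun B : Mink ≃ₗ[ℝ] Mink => B (dev w)) e
    rw [this]
    ring

theorem IsHyperbolicCone.isHyperbolicOn {θ₀ R : ℝ} {φ : ℂ → ℝ} (hR : 0 < R)
    (hφ : IsHyperbolicCone θ₀ R φ) : IsHyperbolicOn (liftMetric φ) (cover R) where
  isOpen := isOpen_cover R
  smooth := contDiffOn_liftMetric hR hφ.smooth
  liouville _ hw := laplacian_liftMetric hR hφ hw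

/-! ### Estimates on half-strips -/

/-- The half-strip `Re w ≤ s₀`, `|Im w| ≤ T`. -/
def strip (s₀ T : ℝ) : Set ℂ := {w | w.re ≤ s₀ ∧ |w.im| ≤ T}

theorem exp_le_exp_mul {a c r s₀ : ℝ} (hca : c ≤ a) (hr : r ≤ s₀) :
    Real.exp (a * r) ≤ Real.exp ((a - c) * s₀) * Real.exp (c * r) := by
  rw [← Real.exp_add]
  refine Real.exp_le_exp.2 ?_
  nlinarith

/-- Exponentially decaying bounds force limits along the real axis. -/
theorem tendsto_of_strip_bound {E : Type*} [NormedAddCommGroup E] {s₀ T C κ : ℝ}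
    {g : ℂ → E} {l : E} (hκ : 0 < κ)
    (hg : ∀ w ∈ strip s₀ T, ‖g w - l‖ ≤ C * Real.exp (κ * w.re)) {τ : ℝ} (hτ : |τ| ≤ T) :
    Filter.Tendsto (fun s : ℝ => g (s + τ * Complex.I)) Filter.atBot (nhds l) := by
  rw [tendsto_iff_norm_sub_tendsto_zero]
  have h1 : Filter.Tendsto (fun s : ℝ => C * Real.exp (κ * s)) Filter.atBot (nhds 0) := by
    simpa using (Real.tendsto_exp_atBot.comp
      (Filter.tendsto_id.const_mul_atBot hκ)).const_mul C
  refine squeeze_zero' (Filter.Eventually.of_forall fun _ => norm_nonneg _) ?_ h1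
  filter_upwards [Filter.eventually_le_atBot s₀] with s hs
  simpa using hg (s + τ * Complex.I) ⟨by simpa using hs, by simpa using hτ⟩

section Strip

variable {E : Type*} [NormedAddCommGroup E] [NormedSpace ℝ E] {f : ℂ → E} {s₀ T C κ : ℝ}

/-- Integration of C e^{κs}. The sign of κ is left open: decay and growth estimates both use it. -/
theorem norm_sub_le_of_horizontal (hκ : κ ≠ 0)
    (hf : ∀ w ∈ strip s₀ T, DifferentiableAt ℝ f w ∧ ‖fderiv ℝ f w‖ ≤ C * Real.exp (κ * w.re))
    {a b τ : ℝ} (hτ : |τ| ≤ T) (hab : a ≤ b) (hb : b ≤ s₀) :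
    ‖f (b + τ * Complex.I) - f (a + τ * Complex.I)‖
      ≤ C / κ * (Real.exp (κ * b) - Real.exp (κ * a)) := by
  have hmem : ∀ s ∈ Icc a b, ((s : ℂ) + τ * Complex.I) ∈ strip s₀ T := fun s hs =>
    ⟨by simpa using hs.2.trans hb, by simpa using hτ⟩
  have hl : ∀ s : ℝ, HasDerivAt (fun s : ℝ => (s : ℂ) + τ * Complex.I) 1 s := fun s => by
    simpa using (Complex.ofRealCLM.hasDerivAt (x := s)).add_const ((τ : ℂ) * Complex.I)
  have hd : ∀ s ∈ Icc a b, HasDerivAt (fun s : ℝ => f (s + τ * Complex.I) - f (a + τ * Complex.I))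
      (fderiv ℝ f (s + τ * Complex.I) 1) s := fun s hs =>
    ((hf _ (hmem s hs)).1.hasFDerivAt.comp_hasDerivAt s (hl s)).sub_const _
  have hB : ∀ s : ℝ, HasDerivAt (fun s : ℝ => C / κ * (Real.exp (κ * s) - Real.exp (κ * a)))
      (C * Real.exp (κ * s)) s := fun s => by
    have h1 : HasDerivAt (fun s : ℝ => κ * s) κ s := by
      simpa using (hasDerivAt_id s).const_mul κ
    refine ((h1.exp.sub_const _).const_mul (C / κ)).congr_deriv ?_
    field_simp
  exact image_norm_le_of_norm_deriv_right_le_deriv_boundary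
    (f := fun s : ℝ => f (s + τ * Complex.I) - f (a + τ * Complex.I))
    (fun s hs => (hd s hs).continuousAt.continuousWithinAt)
    (fun s hs => (hd s ⟨hs.1, hs.2.le⟩).hasDerivWithinAt)
    (B := fun s : ℝ => C / κ * (Real.exp (κ * s) - Real.exp (κ * a))) (by simp) hB
    (fun s hs => by
      have h1 := hf _ (hmem s ⟨hs.1, hs.2.le⟩)
      have h2 := (fderiv ℝ f (s + τ * Complex.I)).le_opNorm 1
      rw [norm_one, mul_one] at h2
      exact h2.trans (by simpa using h1.2))
    (right_mem_Icc.2 hab)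

theorem norm_sub_le_of_vertical
    (hf : ∀ w ∈ strip s₀ T, DifferentiableAt ℝ f w ∧ ‖fderiv ℝ f w‖ ≤ C * Real.exp (κ * w.re))
    {s τ : ℝ} (hτ : |τ| ≤ T) (hs : s ≤ s₀) :
    ‖f (s + τ * Complex.I) - f s‖ ≤ C * Real.exp (κ * s) * T := by
  have hT : 0 ≤ T := (abs_nonneg _).trans hτ
  set K : Set ℂ := {w | w.re = s ∧ |w.im| ≤ T} with hK
  have hKc : Convex ℝ K := by
    have h1 : Convex ℝ {w : ℂ | w.re = s} := by
      have := (convex_singleton (𝕜 := ℝ) s).linear_preimage (Complex.reLm : ℂ →ₗ[ℝ] ℝ)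
      exact this
    have h2 : Convex ℝ {w : ℂ | |w.im| ≤ T} := by
      have := (convex_Icc (𝕜 := ℝ) (-T) T).linear_preimage (Complex.imLm : ℂ →ₗ[ℝ] ℝ)
      have e : {w : ℂ | |w.im| ≤ T} = Complex.imLm ⁻¹' Icc (-T) T := by
        ext w; simp [abs_le]
      rw [e]; exact this
    exact h1.inter h2
  have hKs : K ⊆ strip s₀ T := fun w hw => ⟨hw.1.le.trans hs, hw.2⟩
  have := hKc.norm_image_sub_le_of_norm_hasFDerivWithin_le (𝕜 := ℝ) (f := f) (f' := fderiv ℝ f)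
    (C := C * Real.exp (κ * s))
    (fun w hw => (hf w (hKs hw)).1.hasFDerivAt.hasFDerivWithinAt)
    (fun w hw => by rw [← hw.1]; exact (hf w (hKs hw)).2)
    (x := (s : ℂ)) (y := s + τ * Complex.I) ⟨by simp, by simpa using hT⟩ ⟨by simp, by simpa using hτ⟩
  rw [add_sub_cancel_left, norm_mul, Complex.norm_I, mul_one, Complex.norm_real,
    Real.norm_eq_abs] at this
  refine this.trans (mul_le_mul_of_nonneg_left hτ ?_)
  have h0 := (norm_nonneg _).trans (hf s ⟨by simpa using hs, by simpa using hT⟩).2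
  simpa using h0

theorem eq_re_add_im (w : ℂ) : w = (w.re : ℂ) + (w.im : ℝ) * Complex.I := by
  apply Complex.ext <;> simp

theorem strip_const_nonneg (hT : 0 ≤ T)
    (hf : ∀ w ∈ strip s₀ T, DifferentiableAt ℝ f w ∧ ‖fderiv ℝ f w‖ ≤ C * Real.exp (κ * w.re)) :
    0 ≤ C := by
  have h0 := (norm_nonneg _).trans (hf s₀ ⟨by simp, by simpa using hT⟩).2
  exact nonneg_of_mul_nonneg_left h0 (Real.exp_pos _)

/-- A function whose derivative decays exponentially has a limit at the end of the half-strip. -/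
theorem exists_limit_of_fderiv_le [CompleteSpace E] (hκ : 0 < κ) (hT : 0 ≤ T)
    (hf : ∀ w ∈ strip s₀ T, DifferentiableAt ℝ f w ∧ ‖fderiv ℝ f w‖ ≤ C * Real.exp (κ * w.re)) :
    ∃ l : E, ∃ D : ℝ, ∀ w ∈ strip s₀ T, ‖f w - l‖ ≤ D * Real.exp (κ * w.re) := by
  have hC := strip_const_nonneg hT hf
  have hor : ∀ a b : ℝ, a ≤ b → b ≤ s₀ → ‖f b - f a‖ ≤ C / κ * Real.exp (κ * b) := by
    intro a b hab hb
    have := norm_sub_le_of_horizontal hκ.ne' hf (τ := 0) (by simpa using hT) hab hb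
    simp only [Complex.ofReal_zero, zero_mul, add_zero] at this
    refine this.trans (mul_le_mul_of_nonneg_left ?_ (by positivity))
    linarith [Real.exp_pos (κ * a)]
  have hexp : Filter.Tendsto (fun n : ℕ => C / κ * Real.exp (κ * (s₀ - n))) Filter.atTop
      (nhds 0) := by
    have h1 : Filter.Tendsto (fun n : ℕ => κ * (s₀ - n)) Filter.atTop Filter.atBot := by
      refine Filter.Tendsto.const_mul_atBot hκ ?_
      exact Filter.tendsto_atBot_add_const_left _ s₀
        (Filter.tendsto_neg_atTop_atBot.comp tendsto_natCast_atTop_atTop)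
    simpa using (Real.tendsto_exp_atBot.comp h1).const_mul (C / κ)
  -- The limit is taken along the points s₀ - n of the real axis; horizontal and vertical segments
  -- then reach every point of the strip.
  have hcauchy : CauchySeq (fun n : ℕ => f ((s₀ - n : ℝ) : ℂ)) := by
    refine cauchySeq_of_le_tendsto_0' _ (fun n m hnm => ?_) hexp
    rw [dist_eq_norm]
    refine hor _ _ ?_ ?_
    · have : (n : ℝ) ≤ m := by exact_mod_cast hnm
      linarith
    · linarith [n.cast_nonneg (α := ℝ)]
  obtain ⟨l, hl⟩ := cauchySeq_tendsto_of_complete hcauchy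
  refine ⟨l, C * T + C / κ, fun w hw => ?_⟩
  have h1 := norm_sub_le_of_vertical hf hw.2 hw.1
  rw [← eq_re_add_im] at h1
  have h2 : ‖f (w.re : ℂ) - l‖ ≤ C / κ * Real.exp (κ * w.re) := by
    refine le_of_tendsto ((tendsto_const_nhds.sub hl).norm) ?_
    filter_upwards [Filter.eventually_ge_atTop ⌈s₀ - w.re⌉₊] with n hn
    refine hor _ _ ?_ hw.1
    have := (Nat.le_ceil (s₀ - w.re)).trans (Nat.cast_le.2 hn)
    linarith
  calc ‖f w - l‖ = ‖(f w - f w.re) + (f w.re - l)‖ := by congr 1; abel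
    _ ≤ _ := norm_add_le _ _
    _ ≤ _ := by linarith

/-- A function whose derivative grows exponentially grows at the same rate. -/
theorem exists_bound_of_fderiv_le (hκ : κ < 0) (hT : 0 ≤ T)
    (hf : ∀ w ∈ strip s₀ T, DifferentiableAt ℝ f w ∧ ‖fderiv ℝ f w‖ ≤ C * Real.exp (κ * w.re)) :
    ∃ D : ℝ, ∀ w ∈ strip s₀ T, ‖f w‖ ≤ D * Real.exp (κ * w.re) := by
  have hC := strip_const_nonneg hT hf
  refine ⟨(‖f s₀‖ + C * Real.exp (κ * s₀) * T) * Real.exp (-(κ * s₀)) - C / κ, fun w hw => ?_⟩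
  have h1 := norm_sub_le_of_vertical hf hw.2 (le_refl s₀)
  have h2 := norm_sub_le_of_horizontal hκ.ne hf hw.2 hw.1 le_rfl
  rw [← eq_re_add_im] at h2
  set p := f (s₀ + w.im * Complex.I)
  have h3 : ‖f w‖ ≤ ‖f s₀‖ + ‖p - f s₀‖ + ‖p - f w‖ := by
    calc ‖f w‖ = ‖f s₀ + (p - f s₀) - (p - f w)‖ := by congr 1; abel
      _ ≤ ‖f s₀ + (p - f s₀)‖ + ‖p - f w‖ := norm_sub_le _ _
      _ ≤ _ := by gcongr; exact norm_add_le _ _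
  have h4 : 1 ≤ Real.exp (-(κ * s₀)) * Real.exp (κ * w.re) := by
    rw [← Real.exp_add]
    exact Real.one_le_exp (by nlinarith [hw.1])
  have h5 : C / κ * (Real.exp (κ * s₀) - Real.exp (κ * w.re)) ≤ -(C / κ) * Real.exp (κ * w.re) := by
    have : C / κ ≤ 0 := div_nonpos_of_nonneg_of_nonpos hC hκ.le
    nlinarith [Real.exp_pos (κ * s₀)]
  have h6 : 0 ≤ ‖f s₀‖ + C * Real.exp (κ * s₀) * T := by positivity
  nlinarith [mul_le_mul_of_nonneg_left h4 h6]

end Strip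

/-! ### Asymptotics of developing maps and affine deformations at a cone point -/

namespace IsLocalIso

variable {ψ : ℂ → ℝ} {H : Set ℂ} {dev : ℂ → Mink}

theorem norm_fderiv_le (h : IsLocalIso ψ H dev) {w : ℂ} (hw : w ∈ H) (v : ℂ) :
    ‖fderiv ℝ dev w v‖ ≤ dev w 2 * (Real.exp (ψ w) * ‖v‖) := by
  refine (norm_le_of_tangent (h.maps w hw) (h.mink_fderiv hw v)).trans_eq ?_
  rw [h.isometric w hw, metric, real_inner_self_eq_norm_sq]
  have : Real.exp (2 * ψ w) * ‖v‖ ^ 2 = (Real.exp (ψ w) * ‖v‖) ^ 2 := by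
    rw [mul_pow, ← Real.exp_nat_mul]; norm_num
  rw [this, Real.sqrt_sq (by positivity)]

/-- Near a cone point the developing map converges exponentially in the logarithmic coordinate. -/
theorem exists_cone_point (h : IsLocalIso ψ H dev) {s₀ T C₀ l : ℝ} (hl : 0 < l) (hT : 0 ≤ T)
    (hS : strip s₀ T ⊆ H) (hψ : ∀ w ∈ strip s₀ T, Real.exp (ψ w) ≤ C₀ * Real.exp (l * w.re)) :
    ∃ p : Mink, ∃ C : ℝ, 0 ≤ C ∧ mink p p = -1 ∧ ∀ w ∈ strip s₀ T,
      dev w 2 ≤ C ∧ ‖fderiv ℝ dev w‖ ≤ C * Real.exp (l * w.re) ∧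
        ‖dev w - p‖ ≤ C * Real.exp (l * w.re) := by
  have hpos : ∀ w ∈ H, 0 < dev w 2 := fun w hw => (h.maps w hw).2
  -- A priori bound on the height: a tangent vector has sup norm at most dev₂ times its hyperbolic
  -- length, so the logarithm of dev₂ has derivative at most e^ψ, which decays exponentially. Hence
  -- dev₂ is bounded, and then d dev itself decays.
  have hlog : ∀ w ∈ strip s₀ T, DifferentiableAt ℝ (fun w => Real.log (dev w 2)) w ∧
      ‖fderiv ℝ (fun w => Real.log (dev w 2)) w‖ ≤ C₀ * Real.exp (l * w.re) := by
    intro w hw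
    have hwH := hS hw
    have h2 : HasFDerivAt (fun w => dev w 2)
        ((ContinuousLinearMap.proj (R := ℝ) (2 : Fin 3)).comp (fderiv ℝ dev w)) w :=
      (ContinuousLinearMap.proj (R := ℝ) (φ := fun _ : Fin 3 => ℝ) (2 : Fin 3)).hasFDerivAt.comp w
        (h.differentiableAt hwH).hasFDerivAt
    have h3 := h2.log (hpos w hwH).ne'
    refine ⟨h3.differentiableAt, ?_⟩
    rw [h3.fderiv]
    refine (ContinuousLinearMap.opNorm_le_bound _ (Real.exp_pos _).le fun v => ?_).trans (hψ w hw)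
    simp only [FunLike.coe_smul, Pi.smul_apply, ContinuousLinearMap.comp_apply,
      ContinuousLinearMap.proj_apply, norm_smul, norm_inv, Real.norm_of_nonneg (hpos w hwH).le]
    rw [inv_mul_le_iff₀ (hpos w hwH)]
    exact (norm_le_pi_norm (fderiv ℝ dev w v) 2).trans (h.norm_fderiv_le hwH v)
  obtain ⟨m, D, hD⟩ := exists_limit_of_fderiv_le hl hT hlog
  have hD0 : 0 ≤ D := by
    have := (norm_nonneg _).trans (hD s₀ ⟨by simp, by simpa using hT⟩)
    exact nonneg_of_mul_nonneg_left this (Real.exp_pos _)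
  set M := Real.exp (m + D * Real.exp (l * s₀)) with hM
  have hM0 : 0 < M := Real.exp_pos _
  have hbd : ∀ w ∈ strip s₀ T, dev w 2 ≤ M := by
    intro w hw
    rw [← Real.exp_log (hpos w (hS hw)), hM]
    refine Real.exp_le_exp.2 ?_
    have h1 := (abs_le.1 (hD w hw)).2
    have h2 : D * Real.exp (l * w.re) ≤ D * Real.exp (l * s₀) := by
      have := hw.1
      gcongr
    linarith
  have hfd : ∀ w ∈ strip s₀ T, DifferentiableAt ℝ dev w ∧
      ‖fderiv ℝ dev w‖ ≤ (M * C₀) * Real.exp (l * w.re) := by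
    intro w hw
    have h0 := (Real.exp_pos (ψ w)).trans_le (hψ w hw)
    refine ⟨h.differentiableAt (hS hw), ContinuousLinearMap.opNorm_le_bound _ ?_ fun v => ?_⟩
    · rw [mul_assoc]; positivity
    · refine (h.norm_fderiv_le (hS hw) v).trans ?_
      rw [mul_assoc, mul_assoc, ← mul_assoc C₀]
      gcongr
      · exact hbd w hw
      · exact hψ w hw
  obtain ⟨p, K, hK⟩ := exists_limit_of_fderiv_le hl hT hfd
  have hlim : Filter.Tendsto (fun s : ℝ => dev (s + (0 : ℝ) * Complex.I)) Filter.atBot (nhds p) :=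
    tendsto_of_strip_bound hl hK (by simpa using hT)
  refine ⟨p, max M (max (M * C₀) K), hM0.le.trans (le_max_left _ _), ?_, fun w hw => ⟨?_, ?_, ?_⟩⟩
  · have h1 : Filter.Tendsto (fun s : ℝ => mink (dev (s + (0 : ℝ) * Complex.I))
        (dev (s + (0 : ℝ) * Complex.I))) Filter.atBot (nhds (mink p p)) :=
      (minkL.isBoundedBilinearMap.continuous.tendsto (p, p)).comp (hlim.prodMk_nhds hlim)
    refine tendsto_nhds_unique h1 (tendsto_const_nhds.congr' ?_)
    filter_upwards [Filter.eventually_le_atBot s₀] with s hs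
    exact (h.mink_self (hS ⟨by simpa using hs, by simpa using hT⟩)).symm
  · exact (hbd w hw).trans (le_max_left _ _)
  · refine (hfd w hw).2.trans ?_
    gcongr
    exact (le_max_left _ _).trans (le_max_right _ _)
  · refine (hK w hw).trans ?_
    gcongr
    exact (le_max_right _ _).trans (le_max_right _ _)

end IsLocalIso

/-! ### Normalisation of the affine deformation at the cone point. -/

namespace IsLocalIso

variable {φ : ℂ → ℝ} {R : ℝ} {dev : ℂ → Mink}

/-- The hypotheses on a strip at the cone point that the asymptotics need. -/
structure ConeStrip (φ : ℂ → ℝ) (R : ℝ) (b : ℂ → ℂ →L[ℝ] ℂ) (l α s₀ T C₀ C₁ : ℝ) : Prop where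
  l_pos : 0 < l
  two_pi_le : 2 * Real.pi ≤ T
  subset : strip s₀ T ⊆ cover R
  metric_le : ∀ w ∈ strip s₀ T, Real.exp (liftMetric φ w) ≤ C₀ * Real.exp (l * w.re)
  op_le : ∀ w ∈ strip s₀ T, ‖liftOp b w‖ ≤ C₁ * Real.exp (l * α * w.re)

namespace ConeStrip

variable {b : ℂ → ℂ →L[ℝ] ℂ} {l α s₀ T C₀ C₁ : ℝ}

theorem T_nonneg (hc : ConeStrip φ R b l α s₀ T C₀ C₁) : 0 ≤ T :=
  (by positivity : (0 : ℝ) ≤ 2 * Real.pi).trans hc.two_pi_le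

theorem real_mem (hc : ConeStrip φ R b l α s₀ T C₀ C₁) {s : ℝ} (hs : s ≤ s₀) :
    ((s : ℂ) + (0 : ℝ) * Complex.I) ∈ strip s₀ T :=
  ⟨by simpa using hs, by simpa using hc.T_nonneg⟩

theorem abs_two_pi_le (hc : ConeStrip φ R b l α s₀ T C₀ C₁) : |2 * Real.pi| ≤ T := by
  rw [abs_of_pos (by positivity)]; exact hc.two_pi_le

end ConeStrip

theorem deck_one_real (s : ℝ) : deck 1 ((s : ℂ) + (0 : ℝ) * Complex.I)
    = (s : ℂ) + (2 * Real.pi : ℝ) * Complex.I := by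
  simp [deck]

/-- The holonomy fixes the cone point. -/
theorem map_cone_point {A : Mink ≃ₗ[ℝ] Mink}
    (hAd : ∀ w ∈ cover R, dev (deck 1 w) = A (dev w)) {b : ℂ → ℂ →L[ℝ] ℂ}
    {l α s₀ T C₀ C₁ C : ℝ} (hc : ConeStrip φ R b l α s₀ T C₀ C₁) {p : Mink}
    (hp : ∀ w ∈ strip s₀ T, ‖dev w - p‖ ≤ C * Real.exp (l * w.re)) : A p = p := by
  -- Along the lines Im w = 0 and Im w = 2π, which the deck transformation exchanges and the strip
  -- contains, `dev` tends to the same limit p.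
  have h0 := tendsto_of_strip_bound hc.l_pos hp (τ := 0) (by simpa using hc.T_nonneg)
  have h1 := tendsto_of_strip_bound hc.l_pos hp hc.abs_two_pi_le
  have hA : Filter.Tendsto (fun s : ℝ => A (dev (s + (0 : ℝ) * Complex.I))) Filter.atBot
      (nhds (A p)) :=
    ((LinearMap.continuous_of_finiteDimensional (A : Mink →ₗ[ℝ] Mink)).tendsto p).comp h0
  refine tendsto_nhds_unique hA (h1.congr' ?_)
  filter_upwards [Filter.eventually_le_atBot s₀] with s hs
  rw [← hAd _ (hc.subset (hc.real_mem hs)), deck_one_real]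

/-- The affine deformation is equivariant up to a translation. -/
theorem exists_translation (h : IsLocalIso (liftMetric φ) (cover R) dev) {A : Mink ≃ₗ[ℝ] Mink}
    (hAd : ∀ w ∈ cover R, dev (deck 1 w) = A (dev w)) {b : ℂ → ℂ →L[ℝ] ℂ} {F : ℂ → Mink}
    (hF : IsPrimitive (cover R) dev (liftOp b) F) :
    ∃ t, ∀ w ∈ cover R, F (deck 1 w) = A (F w) + t := by
  have h' := h.comp_deck 1
  have h1 : IsPrimitive (cover R) (fun w => dev (deck 1 w)) (liftOp b)
      (fun w => F (deck 1 w)) := fun w hw => by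
    have h2 := hF _ ((deck_mem_cover 1).2 hw)
    rw [liftOp_deck] at h2
    rw [fderiv_deck]
    have h3 : HasFDerivAt (deck 1) (ContinuousLinearMap.id ℝ ℂ) w :=
      (hasFDerivAt_id w).add_const _
    exact h2.comp w h3
  -- Both F ∘ deck and A ∘ F are primitives of the same invariant form, so they differ by a
  -- constant.
  have h2 : IsPrimitive (cover R) (fun w => dev (deck 1 w)) (liftOp b) (fun w => A (F w)) :=
    fun w hw => by
    set A' := LinearMap.toContinuousLinearMap (A : Mink →ₗ[ℝ] Mink)
    have e : (fun z => dev (deck 1 z)) =ᶠ[nhds w] fun z => A' (dev z) := by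
      filter_upwards [h.isOpen.mem_nhds hw] with z hz using hAd z hz
    have e2 : fderiv ℝ (fun z => A' (dev z)) w = A'.comp (fderiv ℝ dev w) :=
      (A'.hasFDerivAt.comp w (h.differentiableAt hw).hasFDerivAt).fderiv
    rw [e.fderiv_eq, e2]
    exact A'.hasFDerivAt.comp w (hF w hw)
  obtain ⟨t, ht⟩ := IsPrimitive.exists_eq_add h' (convex_cover R) h1 h2
  exact ⟨t, ht⟩

/-- The affine deformation of a Codazzi operator of controlled growth can be normalised to be
equivariant, with controlled growth at the cone point. -/
theorem exists_equivariant_primitive (h : IsLocalIso (liftMetric φ) (cover R) dev)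
    {A : Mink ≃ₗ[ℝ] Mink} (hA : IsSO0 A) (hAd : ∀ w ∈ cover R, dev (deck 1 w) = A (dev w))
    {b : ℂ → ℂ →L[ℝ] ℂ} {l α s₀ T C₀ C₁ : ℝ} (hc : ConeStrip φ R b l α s₀ T C₀ C₁) (hα : -2 < α)
    (hcase : -1 < α ∨ ∃ v, A v ≠ v) {F₀ : ℂ → Mink}
    (hF₀ : IsPrimitive (cover R) dev (liftOp b) F₀) :
    ∃ F, IsPrimitive (cover R) dev (liftOp b) F ∧ (∀ w ∈ cover R, F (deck 1 w) = A (F w)) ∧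
      ∀ γ, γ ≤ 1 → γ ≤ α + 2 → (γ < 1 ∨ -1 < α) →
        ∃ D, ∀ w ∈ strip s₀ T, ‖F w‖ ≤ D * Real.exp (l * (γ - 1) * w.re) := by
  obtain ⟨p, C, hC, hpp, hdev⟩ := h.exists_cone_point hc.l_pos hc.T_nonneg hc.subset hc.metric_le
  obtain ⟨t, ht⟩ := h.exists_translation hAd hF₀
  have hl := hc.l_pos
  have hfd : ∀ F, IsPrimitive (cover R) dev (liftOp b) F → ∀ w ∈ strip s₀ T,
      DifferentiableAt ℝ F w ∧ ‖fderiv ℝ F w‖ ≤ (C * C₁) * Real.exp (l * (α + 1) * w.re) := by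
    intro F hF w hw
    refine ⟨(hF w (hc.subset hw)).differentiableAt, ?_⟩
    rw [(hF w (hc.subset hw)).fderiv]
    refine (ContinuousLinearMap.opNorm_comp_le _ _).trans ?_
    refine (mul_le_mul (hdev w hw).2.1 (hc.op_le w hw) (norm_nonneg _)
      (by positivity)).trans_eq ?_
    rw [mul_mul_mul_comm, ← Real.exp_add]
    ring_nf
  by_cases hα1 : -1 < α
  · have hκ : 0 < l * (α + 1) := mul_pos hl (by linarith)
    obtain ⟨q, D, hD⟩ := exists_limit_of_fderiv_le hκ hc.T_nonneg (hfd F₀ hF₀)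
    have hD0 : 0 ≤ D := nonneg_of_mul_nonneg_left
      ((norm_nonneg _).trans (hD _ (hc.real_mem le_rfl))) (Real.exp_pos _)
    -- Passing to the limit in the equivariance relation makes q a fixed point of the affine
    -- holonomy. Translation by -q then removes t.
    have hq : q = A q + t := by
      have h0 := tendsto_of_strip_bound hκ hD (τ := 0) (by simpa using hc.T_nonneg)
      have h1 := tendsto_of_strip_bound hκ hD hc.abs_two_pi_le
      have hA : Filter.Tendsto (fun s : ℝ => A (F₀ (s + (0 : ℝ) * Complex.I)) + t) Filter.atBot
          (nhds (A q + t)) :=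
        (((LinearMap.continuous_of_finiteDimensional (A : Mink →ₗ[ℝ] Mink)).tendsto q).comp
          h0).add_const t
      refine tendsto_nhds_unique h1 (hA.congr' ?_)
      filter_upwards [Filter.eventually_le_atBot s₀] with s hs
      rw [← ht _ (hc.subset (hc.real_mem hs)), deck_one_real]
    refine ⟨fun w => F₀ w + -q, hF₀.add_const _, fun w hw => ?_, fun γ hγ1 hγα hγ => ?_⟩
    · have hq' : t = q - A q := by rw [eq_sub_iff_add_eq']; exact hq.symm
      dsimp only
      rw [ht w hw, map_add, map_neg, hq']
      abel
    · refine ⟨D * Real.exp ((l * (α + 1) - l * (γ - 1)) * s₀), fun w hw => ?_⟩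
      dsimp only
      rw [← sub_eq_add_neg, mul_assoc]
      refine (hD w hw).trans (mul_le_mul_of_nonneg_left (exp_le_exp_mul ?_ hw.1) hD0)
      exact mul_le_mul_of_nonneg_left (by linarith) hl.le
  · have hne := hcase.resolve_left hα1
    have hAp := map_cone_point hAd hc (fun w hw => (hdev w hw).2.2)
    -- Here α ≤ -1 and F may diverge, but its component along p still converges.
    have htp : mink t p = 0 := by
      have hK : ∀ w ∈ strip s₀ T, DifferentiableAt ℝ (fun w => mink (F₀ w) p) w ∧
          ‖fderiv ℝ (fun w => mink (F₀ w) p) w‖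
            ≤ (3 * (C * C₁) * C) * Real.exp (l * (α + 2) * w.re) := by
        intro w hw
        have hwH := hc.subset hw
        have hd : HasFDerivAt (fun w => mink (F₀ w) p)
            ((minkL p).comp ((fderiv ℝ dev w).comp (liftOp b w))) w := by
          have := (minkL p).hasFDerivAt.comp w (hF₀ w hwH)
          exact this.congr_of_eventuallyEq (Filter.Eventually.of_forall fun z => mink_comm _ _)
        refine ⟨hd.differentiableAt, ?_⟩
        rw [hd.fderiv]
        have hCC : 0 ≤ C * C₁ := strip_const_nonneg hc.T_nonneg (hfd F₀ hF₀)
        refine ContinuousLinearMap.opNorm_le_bound _ (by positivity) fun v => ?_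
        set x := fderiv ℝ dev w (liftOp b w v) with hx
        have hx1 : ‖x‖ ≤ (C * C₁) * Real.exp (l * (α + 1) * w.re) * ‖v‖ := by
          have := (fderiv ℝ F₀ w).le_of_opNorm_le (hfd F₀ hF₀ w hw).2 v
          rwa [(hF₀ w hwH).fderiv] at this
        -- The vector x is tangent at dev w, so p may be replaced by p - dev w, which is O(e^{l Re
        -- w}). This raises the exponent from α + 1 to α + 2 > 0.
        have hx2 : mink p x = -mink (dev w - p) x := by
          rw [mink_sub_left, mink_comm (dev w), h.mink_fderiv hwH]; ring
        have hx3 := abs_mink_le (dev w - p) x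
        have e : Real.exp (l * (α + 2) * w.re)
            = Real.exp (l * w.re) * Real.exp (l * (α + 1) * w.re) := by
          rw [← Real.exp_add]; ring_nf
        show |mink p x| ≤ _
        rw [hx2, abs_neg, e]
        calc |mink (dev w - p) x| ≤ 3 * ‖dev w - p‖ * ‖x‖ := hx3
          _ ≤ 3 * (C * Real.exp (l * w.re))
              * ((C * C₁) * Real.exp (l * (α + 1) * w.re) * ‖v‖) := by
            gcongr
            exact (hdev w hw).2.2
          _ = _ := by ring
      have hκ : 0 < l * (α + 2) := mul_pos hl (by linarith)
      obtain ⟨q, D, hD⟩ := exists_limit_of_fderiv_le hκ hc.T_nonneg hK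
      have h0 := tendsto_of_strip_bound hκ hD (τ := 0) (by simpa using hc.T_nonneg)
      have h1 := tendsto_of_strip_bound hκ hD hc.abs_two_pi_le
      have h2 := h1.sub h0
      rw [sub_self] at h2
      refine tendsto_nhds_unique (tendsto_const_nhds.congr' ?_) h2
      filter_upwards [Filter.eventually_le_atBot s₀] with s hs
      -- Because A fixes p, the difference of ⟨F, p⟩ across the period is exactly ⟨t, p⟩.
      rw [← deck_one_real, ht _ (hc.subset (hc.real_mem hs)), mink_add_left]
      nth_rewrite 2 [← hAp]
      rw [hA.isometry]; ring
    obtain ⟨s, hs⟩ := hA.exists_sub_eq hpp hAp hne htp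
    refine ⟨fun w => F₀ w + s, hF₀.add_const s, fun w hw => ?_, fun γ hγ1 hγα hγ => ?_⟩
    · dsimp only
      rw [ht w hw, map_add, ← hs]; abel
    · have hγ' := hγ.resolve_right hα1
      have hκ : l * (γ - 1) < 0 := mul_neg_of_pos_of_neg hl (by linarith)
      -- Strictness γ < 1 makes the exponent negative, so translation constants and the logarithmic
      -- growth possible at α = -1 are absorbed.
      refine exists_bound_of_fderiv_le (C := C * C₁ * Real.exp ((l * (α + 1) - l * (γ - 1)) * s₀))
        hκ hc.T_nonneg fun w hw => ?_
      obtain ⟨hd, hn⟩ := hfd _ (hF₀.add_const s) w hw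
      refine ⟨hd, hn.trans ?_⟩
      rw [mul_assoc (C * C₁)]
      exact mul_le_mul_of_nonneg_left
        (exp_le_exp_mul (mul_le_mul_of_nonneg_left (by linarith) hl.le) hw.1)
        (strip_const_nonneg hc.T_nonneg (hfd F₀ hF₀))

/-- The scalar function of an equivariant affine deformation. -/
theorem exists_scalar_bounds (h : IsLocalIso (liftMetric φ) (cover R) dev)
    {b : ℂ → ℂ →L[ℝ] ℂ} {l α s₀ T C₀ C₁ : ℝ} (hc : ConeStrip φ R b l α s₀ T C₀ C₁)
    {F : ℂ → Mink} (hF : IsPrimitive (cover R) dev (liftOp b) F) {γ D : ℝ} (hγ : 0 < γ)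
    (hD : ∀ w ∈ strip s₀ T, ‖F w‖ ≤ D * Real.exp (l * (γ - 1) * w.re)) :
    ∃ q K : ℝ, ∀ w ∈ strip s₀ T,
      |mink (F w) (dev w) - q| ≤ K * Real.exp (l * γ * w.re) ∧
      ‖fderiv ℝ (fun w => mink (F w) (dev w)) w‖ ≤ K * Real.exp (l * γ * w.re) := by
  obtain ⟨p, C, hC, hpp, hdev⟩ := h.exists_cone_point hc.l_pos hc.T_nonneg hc.subset hc.metric_le
  have hD0 : 0 ≤ D := nonneg_of_mul_nonneg_left
    ((norm_nonneg _).trans (hD _ (hc.real_mem le_rfl))) (Real.exp_pos _)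
  have hb : ∀ w ∈ strip s₀ T, DifferentiableAt ℝ (fun w => mink (F w) (dev w)) w ∧
      ‖fderiv ℝ (fun w => mink (F w) (dev w)) w‖ ≤ (3 * D * C) * Real.exp (l * γ * w.re) := by
    intro w hw
    have hwH := hc.subset hw
    refine ⟨?_, ContinuousLinearMap.opNorm_le_bound _ (by positivity) fun v => ?_⟩
    · exact ((minkL.isBoundedBilinearMap.hasFDerivAt (F w, dev w)).comp w
        ((hF w hwH).prodMk (h.differentiableAt hwH).hasFDerivAt)).differentiableAt
    · rw [hF.fderiv_mink_dev h hwH, Real.norm_eq_abs]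
      -- As dF is tangent at `dev`, du = ⟨F, d dev⟩: the growth of F is compensated by one factor
      -- e^{l Re w} from d dev.
      have e : Real.exp (l * γ * w.re)
          = Real.exp (l * (γ - 1) * w.re) * Real.exp (l * w.re) := by
        rw [← Real.exp_add]; ring_nf
      rw [e]
      calc |mink (F w) (fderiv ℝ dev w v)| ≤ 3 * ‖F w‖ * ‖fderiv ℝ dev w v‖ := abs_mink_le _ _
        _ ≤ 3 * (D * Real.exp (l * (γ - 1) * w.re)) * (C * Real.exp (l * w.re) * ‖v‖) := by
          gcongr
          · exact hD w hw
          · exact (fderiv ℝ dev w).le_of_opNorm_le (hdev w hw).2.1 v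
        _ = _ := by ring
  obtain ⟨q, K, hK⟩ := exists_limit_of_fderiv_le (mul_pos hc.l_pos hγ) hc.T_nonneg hb
  refine ⟨q, max K (3 * D * C), fun w hw => ⟨(hK w hw).trans ?_, (hb w hw).2.trans ?_⟩⟩ <;> gcongr
  exacts [le_max_left _ _, le_max_right _ _]

end IsLocalIso

/-! ### The conformal factor at the cone point -/

theorem IsHyperbolicCone.exists_bounds {θ₀ R : ℝ} {φ : ℂ → ℝ} (hφ : IsHyperbolicCone θ₀ R φ)
    {ρ : ℝ} (hρ : ρ < R) : ∃ c : ℝ, 0 < c ∧ ∀ z : ℂ, z ≠ 0 → ‖z‖ ≤ ρ →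
      c⁻¹ * ‖z‖ ^ (θ₀ / (2 * Real.pi) - 1) ≤ Real.exp (φ z) ∧
      Real.exp (φ z) ≤ c * ‖z‖ ^ (θ₀ / (2 * Real.pi) - 1) := by
  obtain ⟨ξ, hξ, hcone⟩ := hφ.cone
  have hsub : Metric.closedBall (0 : ℂ) ρ ⊆ disc R := Metric.closedBall_subset_ball hρ
  obtain ⟨M, hM⟩ := (isCompact_closedBall (0 : ℂ) ρ).exists_bound_of_continuousOn (hξ.mono hsub)
  refine ⟨Real.exp M, Real.exp_pos _, fun z hz hzρ => ?_⟩
  have hzb : z ∈ Metric.closedBall (0 : ℂ) ρ := by simpa using hzρ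
  have h1 := abs_le.1 (hM z hzb)
  have h2 : 0 < ‖z‖ := norm_pos_iff.2 hz
  rw [hcone z ⟨hsub hzb, hz⟩, Real.exp_add, mul_comm _ (Real.log ‖z‖), Real.exp_mul,
    Real.exp_log h2, ← Real.exp_neg, mul_comm]
  constructor
  · gcongr; linarith [h1.1]
  · rw [mul_comm]; gcongr; exact h1.2

theorem exp_mul_re_eq (a : ℝ) (w : ℂ) : Real.exp (a * w.re) = ‖Complex.exp w‖ ^ a := by
  rw [Complex.norm_exp, ← Real.exp_mul, mul_comm]

theorem exp_mul_log_re_eq (a : ℝ) {z : ℂ} (hz : z ≠ 0) :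
    Real.exp (a * (Complex.log z).re) = ‖z‖ ^ a := by
  rw [exp_mul_re_eq, Complex.exp_log hz]

theorem log_mem_strip {s₀ : ℝ} {z : ℂ} (hz : z ≠ 0) (hzs : ‖z‖ ≤ Real.exp s₀) {T : ℝ}
    (hT : 2 * Real.pi ≤ T) : Complex.log z ∈ strip s₀ T := by
  refine ⟨?_, ?_⟩
  · rw [Complex.log_re]
    exact (Real.log_le_iff_le_exp (norm_pos_iff.2 hz)).2 hzs
  · rw [Complex.log_im]
    exact (Complex.abs_arg_le_pi z).trans (by linarith [Real.pi_pos])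

theorem norm_liftOp_le (b : ℂ → ℂ →L[ℝ] ℂ) (w : ℂ) : ‖liftOp b w‖ ≤ ‖b (Complex.exp w)‖ := by
  refine ContinuousLinearMap.opNorm_le_bound _ (norm_nonneg _) fun v => ?_
  rw [liftOp_apply, norm_mul]
  calc ‖Complex.exp (-w)‖ * ‖b (Complex.exp w) (Complex.exp w * v)‖
      ≤ ‖Complex.exp (-w)‖ * (‖b (Complex.exp w)‖ * (‖Complex.exp w‖ * ‖v‖)) := by
        gcongr
        rw [← norm_mul]
        exact ContinuousLinearMap.le_opNorm _ _
    _ = ‖Complex.exp (-w) * Complex.exp w‖ * (‖b (Complex.exp w)‖ * ‖v‖) := by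
        rw [norm_mul]; ring
    _ = _ := by rw [exp_neg_mul_exp, norm_one, one_mul]

/-- The differential of `exp` multiplies the factor |z|^{l-1} by |z|, producing e^{l Re w}.
Conjugation by a complex multiplication does not increase the norm of b. -/
theorem exists_coneStrip {θ₀ R : ℝ} {φ : ℂ → ℝ} (hφ : IsHyperbolicCone θ₀ R φ) (hθ : 0 < θ₀)
    {b : ℂ → ℂ →L[ℝ] ℂ} {α ρ C₁ : ℝ} (hρ : 0 < ρ) (hρR : ρ < R)
    (hb : ∀ z : ℂ, z ≠ 0 → ‖z‖ ≤ ρ → ‖b z‖ ≤ C₁ * ‖z‖ ^ (θ₀ / (2 * Real.pi) * α)) :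
    ∃ C₀, IsLocalIso.ConeStrip φ R b (θ₀ / (2 * Real.pi)) α (Real.log ρ) (2 * Real.pi) C₀ C₁ := by
  obtain ⟨c, hc, hcb⟩ := hφ.exists_bounds hρR
  have hle : ∀ w ∈ strip (Real.log ρ) (2 * Real.pi), ‖Complex.exp w‖ ≤ ρ := fun w hw => by
    rw [Complex.norm_exp]
    exact (Real.le_log_iff_exp_le hρ).1 hw.1
  refine ⟨c, by positivity, le_rfl, fun w hw => hw.1.trans_lt (Real.log_lt_log hρ hρR),
    fun w hw => ?_, fun w hw => ?_⟩
  · have h1 := (hcb _ (Complex.exp_ne_zero w) (hle w hw)).2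
    have e : Real.exp (θ₀ / (2 * Real.pi) * w.re)
        = ‖Complex.exp w‖ ^ (θ₀ / (2 * Real.pi) - 1) * Real.exp w.re := by
      rw [← exp_mul_re_eq, ← Real.exp_add]; ring_nf
    rw [liftMetric, Real.exp_add, e, ← mul_assoc]
    gcongr
  · rw [exp_mul_re_eq]
    exact (norm_liftOp_le b w).trans (hb _ (Complex.exp_ne_zero w) (hle w hw))

/-! ### Descending to the punctured disc -/

section Descend

variable {X : Type*} {f : ℂ → X} {R : ℝ}

theorem apply_deck_of_periodic (hf : ∀ w ∈ cover R, f (deck 1 w) = f w) (n : ℤ) :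
    ∀ w ∈ cover R, f (deck n w) = f w := by
  induction n using Int.induction_on with
  | zero => intro w _; rw [deck_zero]
  | succ n ih =>
    intro w hw
    rw [add_comm, ← deck_deck, hf _ ((deck_mem_cover _).2 hw), ih w hw]
  | pred n ih =>
    intro w hw
    rw [← hf _ ((deck_mem_cover _).2 hw), deck_deck, add_sub_cancel, ih w hw]

theorem apply_log_exp (hf : ∀ w ∈ cover R, f (deck 1 w) = f w) {w : ℂ} (hw : w ∈ cover R) :
    f (Complex.log (Complex.exp w)) = f w := by
  obtain ⟨n, hn⟩ := Complex.exp_eq_exp_iff_exists_int.1 (Complex.exp_log (Complex.exp_ne_zero w))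
  rw [hn]
  exact apply_deck_of_periodic hf n w hw

/-- The principal logarithm jumps across the negative axis. For periodic f it may be replaced near
any z₀ by a branch smooth there. -/
theorem log_branch_eq (hR : 0 < R) (hf : ∀ w ∈ cover R, f (deck 1 w) = f w) {z₀ : ℂ}
    (hz₀ : z₀ ∈ pdisc R) : (fun z => f (Complex.log z))
      =ᶠ[nhds z₀] fun z => f (Complex.log (z / z₀) + Complex.log z₀) := by
  filter_upwards [(isOpen_pdisc R).mem_nhds hz₀] with z hz
  have h0 := (mem_pdisc.1 hz₀).2
  have h1 := (mem_pdisc.1 hz).2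
  have e : Complex.exp (Complex.log (z / z₀) + Complex.log z₀) = z := by
    rw [Complex.exp_add, Complex.exp_log h0, Complex.exp_log (div_ne_zero h1 h0),
      div_mul_cancel₀ _ h0]
  have hw : Complex.log (z / z₀) + Complex.log z₀ ∈ cover R := by
    rwa [← exp_mem_pdisc hR, e]
  rw [← apply_log_exp hf hw, e]

theorem contDiffAt_log_branch {n : WithTop ℕ∞} {z₀ : ℂ} (hz₀ : z₀ ≠ 0) :
    ContDiffAt ℂ n (fun z => Complex.log (z / z₀) + Complex.log z₀) z₀ := by
  have h1 : ContDiffAt ℂ n Complex.log (z₀ / z₀) :=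
    Complex.contDiffAt_log (by rw [div_self hz₀]; exact Complex.one_mem_slitPlane)
  exact (ContDiffAt.comp (f := fun z => z / z₀) z₀ h1
    (contDiffAt_id.div_const z₀)).add contDiffAt_const

theorem log_branch_self {z₀ : ℂ} (hz₀ : z₀ ≠ 0) :
    Complex.log (z₀ / z₀) + Complex.log z₀ = Complex.log z₀ := by
  rw [div_self hz₀, Complex.log_one, zero_add]

theorem log_mem_cover (hR : 0 < R) {z : ℂ} (hz : z ∈ pdisc R) : Complex.log z ∈ cover R := by
  rwa [← exp_mem_pdisc hR, Complex.exp_log (mem_pdisc.1 hz).2]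

end Descend

theorem contDiffOn_log_of_periodic {E : Type*} [NormedAddCommGroup E] [NormedSpace ℝ E]
    {f : ℂ → E} {R : ℝ} (hR : 0 < R) (hf : ∀ w ∈ cover R, f (deck 1 w) = f w)
    (hs : ContDiffOn ℝ ∞ f (cover R)) : ContDiffOn ℝ ∞ (fun z => f (Complex.log z)) (pdisc R) := by
  intro z hz
  have h0 := (mem_pdisc.1 hz).2
  refine (ContDiffAt.congr_of_eventuallyEq ?_ (log_branch_eq hR hf hz)).contDiffWithinAt
  refine ContDiffAt.comp z ?_ ((contDiffAt_log_branch h0).restrict_scalars ℝ)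
  rw [log_branch_self h0]
  exact hs.contDiffAt ((isOpen_cover R).mem_nhds (log_mem_cover hR hz))

theorem differentiableOn_log_of_periodic {f : ℂ → ℂ} {R : ℝ} (hR : 0 < R)
    (hf : ∀ w ∈ cover R, f (deck 1 w) = f w) (hs : DifferentiableOn ℂ f (cover R)) :
    DifferentiableOn ℂ (fun z => f (Complex.log z)) (pdisc R) := by
  intro z hz
  have h0 := (mem_pdisc.1 hz).2
  refine (DifferentiableAt.congr_of_eventuallyEq ?_
    (log_branch_eq hR hf hz)).differentiableWithinAt
  refine DifferentiableAt.comp z ?_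
    ((contDiffAt_log_branch (n := 1) h0).differentiableAt (by simp))
  rw [log_branch_self h0]
  exact hs.differentiableAt ((isOpen_cover R).mem_nhds (log_mem_cover hR hz))

/-! ### Trivial holonomy -/

/-- If `c₁ |z|^β ≤ |G'(z)| ≤ c₂ |z|^β` near `0` for a bounded holomorphic function `G`, then `β` is
a natural number. -/
theorem exists_nat_of_norm_deriv {G : ℂ → ℂ} {ρ c₁ c₂ β : ℝ} (hρ : 0 < ρ) (hc₁ : 0 < c₁)
    (hG : DifferentiableOn ℂ G (pdisc ρ)) (hG1 : ∀ z ∈ pdisc ρ, ‖G z‖ ≤ 1)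
    (hlow : ∀ z ∈ pdisc ρ, c₁ * ‖z‖ ^ β ≤ ‖deriv G z‖)
    (hup : ∀ z ∈ pdisc ρ, ‖deriv G z‖ ≤ c₂ * ‖z‖ ^ β) : ∃ n : ℕ, β = n := by
  have hnhds : disc ρ ∈ nhds (0 : ℂ) := (isOpen_disc ρ).mem_nhds (by simpa [disc] using hρ)
  have hext := Complex.differentiableOn_update_limUnder_of_bddAbove hnhds hG
    ⟨1, by rintro _ ⟨z, hz, rfl⟩; exact hG1 z hz⟩
  set G' := Function.update G 0 ((nhdsWithin (0 : ℂ) {0}ᶜ).limUnder G) with hG'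
  have heq : ∀ z ∈ pdisc ρ, deriv G' z = deriv G z := by
    intro z hz
    refine Filter.EventuallyEq.deriv_eq ?_
    filter_upwards [(isOpen_pdisc ρ).mem_nhds hz] with y hy
    rw [hG', Function.update_of_ne (mem_pdisc.1 hy).2]
  have han : AnalyticAt ℂ (deriv G') 0 := (hext.analyticAt hnhds).deriv
  have hpd : pdisc ρ ∈ nhdsWithin (0 : ℂ) {0}ᶜ := by
    rw [pdisc, Set.sdiff_eq]
    exact Filter.inter_mem (mem_nhdsWithin_of_mem_nhds hnhds) self_mem_nhdsWithin
  have hnz : ¬ ∀ᶠ z in nhds (0 : ℂ), deriv G' z = 0 := by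
    intro h
    have h1 : ∀ᶠ z in nhdsWithin (0 : ℂ) {0}ᶜ, False := by
      filter_upwards [hpd, mem_nhdsWithin_of_mem_nhds h] with z hz hz0
      have h2 := hlow z hz
      rw [← heq z hz, hz0, norm_zero] at h2
      have : 0 < ‖z‖ ^ β := Real.rpow_pos_of_pos (norm_pos_iff.2 (mem_pdisc.1 hz).2) β
      nlinarith
    simpa using h1.exists
  -- After removing the singularity, G' has a zero of finite order n with nonvanishing cofactor k.
  -- As |k| is comparable with |z|^{β-n} and has a nonzero finite limit, β = n.
  obtain ⟨n, k, hk, hk0, hkeq⟩ := han.exists_eventuallyEq_pow_smul_nonzero_iff.2 hnz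
  refine ⟨n, ?_⟩
  have hkc : Filter.Tendsto (fun z => ‖k z‖) (nhdsWithin (0 : ℂ) {0}ᶜ) (nhds ‖k 0‖) :=
    (hk.continuousAt.norm.tendsto).mono_left nhdsWithin_le_nhds
  have hkpos : 0 < ‖k 0‖ := norm_pos_iff.2 hk0
  have hev : ∀ᶠ z in nhdsWithin (0 : ℂ) {0}ᶜ,
      c₁ * ‖z‖ ^ (β - n) ≤ ‖k z‖ ∧ ‖k z‖ ≤ c₂ * ‖z‖ ^ (β - n) := by
    filter_upwards [hpd, mem_nhdsWithin_of_mem_nhds hkeq] with z hz hz0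
    have hzp : 0 < ‖z‖ := norm_pos_iff.2 (mem_pdisc.1 hz).2
    have h1 := hlow z hz
    have h2 := hup z hz
    rw [← heq z hz, hz0, sub_zero, norm_smul, norm_pow] at h1 h2
    have hp : 0 < ‖z‖ ^ n := by positivity
    rw [Real.rpow_sub hzp, Real.rpow_natCast, ← mul_div_assoc, ← mul_div_assoc, div_le_iff₀ hp,
      le_div_iff₀ hp]
    constructor <;> linarith
  have hnorm : Filter.Tendsto (fun z : ℂ => ‖z‖) (nhdsWithin (0 : ℂ) {0}ᶜ)
      (nhdsWithin 0 (Set.Ioi 0)) := tendsto_norm_nhdsNE_zero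
  rcases lt_trichotomy (β - n) 0 with h | h | h
  · exfalso
    have h1 : Filter.Tendsto (fun z : ℂ => c₁ * ‖z‖ ^ (β - n)) (nhdsWithin (0 : ℂ) {0}ᶜ)
        Filter.atTop := by
      refine Filter.Tendsto.const_mul_atTop hc₁ ?_
      exact (tendsto_rpow_neg_nhdsGT_zero h).comp hnorm
    have h2 : Filter.Tendsto (fun z => ‖k z‖) (nhdsWithin (0 : ℂ) {0}ᶜ) Filter.atTop :=
      Filter.tendsto_atTop_mono' _ (hev.mono fun z hz => hz.1) h1
    exact not_tendsto_nhds_of_tendsto_atTop h2 _ hkc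
  · linarith
  · exfalso
    have h1 : Filter.Tendsto (fun z : ℂ => c₂ * ‖z‖ ^ (β - n)) (nhdsWithin (0 : ℂ) {0}ᶜ)
        (nhds 0) := by
      have h3 : Filter.Tendsto (fun x : ℝ => x ^ (β - n)) (nhdsWithin 0 (Set.Ioi 0)) (nhds 0) := by
        have := (Real.continuousAt_rpow_const 0 (β - n) (Or.inr h.le)).tendsto
        rw [Real.zero_rpow h.ne'] at this
        exact this.mono_left nhdsWithin_le_nhds
      simpa using (h3.comp hnorm).const_mul c₂
    have h2 := le_of_tendsto_of_tendsto hkc h1 (hev.mono fun z hz => hz.2)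
    linarith

/-- If the Liouville function of a hyperbolic cone is single-valued, then the cone angle is an
integer multiple of `2π`. -/
theorem exists_nat_of_periodic {θ₀ R : ℝ} {φ : ℂ → ℝ} (hR : 0 < R)
    (hφ : IsHyperbolicCone θ₀ R φ) (hθ : 0 < θ₀) {g : ℂ → ℂ}
    (hg : DifferentiableOn ℂ g (cover R)) (hg1 : ∀ w ∈ cover R, ‖g w‖ < 1 ∧
      2 * ‖deriv g w‖ = Real.exp (liftMetric φ w) * (1 - ‖g w‖ ^ 2))
    (hper : ∀ w ∈ cover R, g (deck 1 w) = g w) : ∃ n : ℕ, θ₀ = 2 * Real.pi * n := by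
  have hρ : 0 < R / 2 := by linarith
  have hρR : R / 2 < R := by linarith
  have hliso := isLocalIso_of_liouville (isOpen_cover R) (contDiffOn_liftMetric hR hφ.smooth) hg hg1
  -- Only the estimate of the metric is needed here, so the operator is taken to be zero.
  obtain ⟨C₀, hc⟩ := exists_coneStrip (b := 0) (α := 0) (C₁ := 0) hφ hθ hρ hρR (by simp)
  obtain ⟨p, C, hC, -, hdev⟩ :=
    hliso.exists_cone_point hc.l_pos hc.T_nonneg hc.subset hc.metric_le
  obtain ⟨c, hcpos, hcb⟩ := hφ.exists_bounds hρR
  set G := fun z => g (Complex.log z) with hG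
  have hsub : pdisc (R / 2) ⊆ pdisc R := fun z hz => by
    rw [mem_pdisc] at hz ⊢; exact ⟨hz.1.trans hρR, hz.2⟩
  have hGd := differentiableOn_log_of_periodic hR hper hg
  have hder : ∀ z ∈ pdisc R, 2 * ‖deriv G z‖ = Real.exp (φ z) * (1 - ‖G z‖ ^ 2) := by
    intro z hz
    have hz0 := (mem_pdisc.1 hz).2
    have hw := log_mem_cover hR hz
    have h1 : HasDerivAt G (deriv G z) (Complex.exp (Complex.log z)) := by
      rw [Complex.exp_log hz0]
      exact (hGd.differentiableAt ((isOpen_pdisc R).mem_nhds hz)).hasDerivAt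
    have h2 := h1.comp (Complex.log z) (Complex.hasDerivAt_exp _)
    have h3 : G ∘ Complex.exp =ᶠ[nhds (Complex.log z)] g := by
      filter_upwards [(isOpen_cover R).mem_nhds hw] with w hw using apply_log_exp hper hw
    have h4 := (hg1 _ hw).2
    rw [← h3.deriv_eq, h2.deriv, norm_mul, liftMetric, Complex.exp_log hz0, Real.exp_add,
      Complex.log_re, Real.exp_log (norm_pos_iff.2 hz0)] at h4
    refine mul_right_cancel₀ (norm_pos_iff.2 hz0).ne' ?_
    rw [hG]
    linear_combination h4
  -- The height (1 + |g|²)/(1 - |g|²) of the developing map is at most C, which keeps g away from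
  -- the unit circle.
  have hlow : ∀ z ∈ pdisc (R / 2), 2 / (1 + C) ≤ 1 - ‖G z‖ ^ 2 := by
    intro z hz
    have hz' := mem_pdisc.1 hz
    have hw := log_mem_cover hR (hsub hz)
    have hst : Complex.log z ∈ strip (Real.log (R / 2)) (2 * Real.pi) :=
      log_mem_strip hz'.2 (by rw [Real.exp_log hρ]; exact hz'.1.le) le_rfl
    have h1 := (hdev _ hst).1
    have hn : 0 < 1 - Complex.normSq (g (Complex.log z)) := by
      linarith [normSq_lt_one (hg1 _ hw).1]
    simp only [discToHyperboloid, Matrix.cons_val] at h1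
    rw [div_le_iff₀ hn] at h1
    rw [← Complex.normSq_eq_norm_sq, div_le_iff₀ (by positivity)]
    simp only [hG]
    linarith
  obtain ⟨n, hn⟩ := exists_nat_of_norm_deriv (G := G) (ρ := R / 2) (c₁ := c⁻¹ / (1 + C))
    (c₂ := c / 2) (β := θ₀ / (2 * Real.pi) - 1) hρ (by positivity) (hGd.mono hsub)
    (fun z hz => (hg1 _ (log_mem_cover hR (hsub hz))).1.le)
    (fun z hz => by
      have hz' := mem_pdisc.1 hz
      have h1 := hder z (hsub hz)
      have h2 := (hcb z hz'.2 hz'.1.le).1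
      have h3 := hlow z hz
      have h4 : c⁻¹ * ‖z‖ ^ (θ₀ / (2 * Real.pi) - 1) * (2 / (1 + C)) ≤ 2 * ‖deriv G z‖ := by
        rw [h1]; gcongr
      have h5 : c⁻¹ * ‖z‖ ^ (θ₀ / (2 * Real.pi) - 1) * (2 / (1 + C))
          = 2 * (c⁻¹ / (1 + C) * ‖z‖ ^ (θ₀ / (2 * Real.pi) - 1)) := by ring
      linarith)
    (fun z hz => by
      have hz' := mem_pdisc.1 hz
      have h1 := hder z (hsub hz)
      have h2 := (hcb z hz'.2 hz'.1.le).2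
      have h3 := Real.exp_pos (φ z)
      nlinarith [sq_nonneg ‖G z‖])
  -- The order of vanishing is n = l - 1, so l = n + 1.
  refine ⟨n + 1, ?_⟩
  rw [sub_eq_iff_eq_add, div_eq_iff (by positivity)] at hn
  rw [hn]; push_cast; ring

theorem discToHyperboloid_injOn {x y : ℂ} (hx : ‖x‖ < 1) (hy : ‖y‖ < 1)
    (h : discToHyperboloid x = discToHyperboloid y) : x = y := by
  have hnx : 0 < 1 - Complex.normSq x := by linarith [normSq_lt_one hx]
  have hny : 0 < 1 - Complex.normSq y := by linarith [normSq_lt_one hy]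
  have h0 := congrFun h 0
  have h1 := congrFun h 1
  have h2 := congrFun h 2
  simp only [discToHyperboloid, Matrix.cons_val] at h0 h1 h2
  have e : Complex.normSq x = Complex.normSq y := by
    rw [div_eq_div_iff hnx.ne' hny.ne'] at h2
    linarith
  rw [e] at h0 h1
  rw [div_left_inj' hny.ne'] at h0 h1
  exact Complex.ext (by linarith) (by linarith)

/-! ### Single-valued solutions -/

theorem IsHessSub.congr {φ u v : ℂ → ℝ} {Ω : Set ℂ} {b : ℂ → ℂ →L[ℝ] ℂ} (hΩ : IsOpen Ω)
    (h : IsHessSub φ Ω b u) (huv : ∀ z ∈ Ω, v z = u z) : IsHessSub φ Ω b v := by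
  intro z hz x
  have e : v =ᶠ[nhds z] u := by filter_upwards [hΩ.mem_nhds hz] with y hy using huv y hy
  have e2 : hgrad φ v =ᶠ[nhds z] hgrad φ u := by
    filter_upwards [e.fderiv (𝕜 := ℝ)] with y hy
    simp only [hgrad, gradient, hy]
  rw [h z hz x, huv z hz, hess, hess, nabla, nabla, e2.fderiv_eq, e2.eq_of_nhds]

/-- The core of both statements: the equivariant primitive gives a periodic function on the cover,
and its exponential bounds become powers of |z|. -/
theorem exists_solution_of_codazzi {θ₀ R : ℝ} {φ : ℂ → ℝ} (hR : 0 < R)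
    (hφ : IsHyperbolicCone θ₀ R φ) (hθ : 0 < θ₀) {b : ℂ → ℂ →L[ℝ] ℂ} {α ρ C₁ : ℝ}
    (hρ : 0 < ρ) (hρR : ρ < R) (hbC : IsCodazzi φ (pdisc R) b) (hα : -2 < α)
    (hb : ∀ z : ℂ, z ≠ 0 → ‖z‖ ≤ ρ → ‖b z‖ ≤ C₁ * ‖z‖ ^ (θ₀ / (2 * Real.pi) * α))
    (hcase : (∀ n : ℕ, θ₀ ≠ 2 * Real.pi * n) ∨ -1 < α) :
    DeltaTrivial φ R b ∧ ∃ u : ℂ → ℝ, ContDiffOn ℝ ∞ u (pdisc R) ∧ IsHessSub φ (pdisc R) b u ∧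
      ∀ γ, 0 < γ → γ ≤ 1 → γ ≤ α + 2 → (γ < 1 ∨ -1 < α) → ∃ K : ℝ, ∀ z : ℂ, z ≠ 0 → ‖z‖ ≤ ρ →
        |u z - u 0| ≤ K * ‖z‖ ^ (θ₀ / (2 * Real.pi) * γ) ∧
        ‖fderiv ℝ u z‖ ≤ K * ‖z‖ ^ (θ₀ / (2 * Real.pi) * γ - 1) := by
  obtain ⟨C₀, hc⟩ := exists_coneStrip hφ hθ hρ hρR hb
  obtain ⟨w₀, hw₀⟩ := cover_nonempty R
  obtain ⟨g, hg, hg1⟩ := (hφ.isHyperbolicOn hR).exists_liouville (convex_cover R) hw₀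
  set dev := fun w => discToHyperboloid (g w) with hdev
  have hl : IsLocalIso (liftMetric φ) (cover R) dev :=
    isLocalIso_of_liouville (isOpen_cover R) (contDiffOn_liftMetric hR hφ.smooth) hg hg1
  obtain ⟨A, hA, hAd⟩ := hl.exists_holonomy
  have hne : -1 < α ∨ ∃ v, A v ≠ v := by
    refine hcase.symm.imp_right fun h => ?_
    by_contra! hfix
    obtain ⟨n, hn⟩ := exists_nat_of_periodic hR hφ hθ hg hg1 fun w hw =>
      discToHyperboloid_injOn (hg1 _ ((deck_mem_cover 1).2 hw)).1 (hg1 w hw).1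
        ((hAd w hw).trans (hfix _))
    exact h n hn
  have hlC := isCodazzi_lift hR hφ.smooth hbC
  obtain ⟨F₀, hF₀⟩ := hl.exists_isPrimitive (convex_cover R) hlC
  obtain ⟨F, hF, hFA, hFb⟩ := hl.exists_equivariant_primitive hA hAd hc hα hne hF₀
  set v : ℂ → ℝ := fun w => mink (F w) (dev w) with hv
  have hvper : ∀ w ∈ cover R, v (deck 1 w) = v w := fun w hw => by
    simp only [hv]
    rw [hFA w hw, hAd w hw, hA.isometry]
  have hvs : ContDiffOn ℝ ∞ v (cover R) := contDiffOn_mink (hF.contDiffOn hl hlC.smooth) hl.smooth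
  have hbounds : ∀ γ, 0 < γ → γ ≤ 1 → γ ≤ α + 2 → (γ < 1 ∨ -1 < α) → ∃ q K : ℝ,
      ∀ w ∈ strip (Real.log ρ) (2 * Real.pi),
        |v w - q| ≤ K * Real.exp (θ₀ / (2 * Real.pi) * γ * w.re) ∧
        ‖fderiv ℝ v w‖ ≤ K * Real.exp (θ₀ / (2 * Real.pi) * γ * w.re) := by
    intro γ h0 h1 h2 h3
    obtain ⟨D, hD⟩ := hFb γ h1 h2 h3
    exact hl.exists_scalar_bounds hc hF h0 hD
  have hlim : ∀ {γ q K : ℝ}, 0 < γ → (∀ w ∈ strip (Real.log ρ) (2 * Real.pi),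
        |v w - q| ≤ K * Real.exp (θ₀ / (2 * Real.pi) * γ * w.re) ∧
        ‖fderiv ℝ v w‖ ≤ K * Real.exp (θ₀ / (2 * Real.pi) * γ * w.re)) →
      Filter.Tendsto (fun s : ℝ => v (s + (0 : ℝ) * Complex.I)) Filter.atBot (nhds q) :=
    fun h0 h => tendsto_of_strip_bound (mul_pos hc.l_pos h0) (fun w hw => (h w hw).1)
      (by simpa using hc.T_nonneg)
  -- An exponent that is admissible for every α > -2. It fixes the value of u at 0; uniqueness of
  -- limits shows that every other γ gives the same value.
  have hγ₀ : 0 < min (1 / 2) (α + 2) := lt_min (by norm_num) (by linarith)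
  have hγ₁ : min (1 / 2) (α + 2) < 1 := (min_le_left _ _).trans_lt (by norm_num)
  obtain ⟨q, K₀, hq⟩ := hbounds (min (1 / 2) (α + 2)) hγ₀ hγ₁.le (min_le_right _ _) (Or.inl hγ₁)
  set u : ℂ → ℝ := Function.update (fun z => v (Complex.log z)) 0 q with hu
  have hu0 : u 0 = q := Function.update_self _ _ _
  have hun : ∀ z, z ≠ 0 → u z = v (Complex.log z) := fun z hz => Function.update_of_ne hz _ _
  have hus : ContDiffOn ℝ ∞ u (pdisc R) :=
    (contDiffOn_log_of_periodic hR hvper hvs).congr fun z hz => hun z (mem_pdisc.1 hz).2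
  have hue : ∀ w ∈ cover R, u (Complex.exp w) = v w := fun w hw => by
    rw [hun _ (Complex.exp_ne_zero w), apply_log_exp hvper hw]
  have hH : IsHessSub φ (pdisc R) b u := (isHessSub_lift_iff hR hφ.smooth hus).1
    ((hF.isHessSub hl hlC.smooth).congr (isOpen_cover R) hue)
  refine ⟨deltaTrivial_of_isHessSub hR hφ hl hus hH, u, hus, hH, fun γ h0 h1 h2 h3 => ?_⟩
  obtain ⟨q', K, hK⟩ := hbounds γ h0 h1 h2 h3
  obtain rfl : q' = q := tendsto_nhds_unique (hlim h0 hK) (hlim hγ₀ hq)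
  refine ⟨K, fun z hz hzρ => ?_⟩
  have hzR : z ∈ pdisc R := mem_pdisc.2 ⟨hzρ.trans_lt hρR, hz⟩
  have hw := log_mem_cover hR hzR
  have hst : Complex.log z ∈ strip (Real.log ρ) (2 * Real.pi) :=
    log_mem_strip hz (by rwa [Real.exp_log hρ]) le_rfl
  obtain ⟨k1, k2⟩ := hK _ hst
  rw [exp_mul_log_re_eq _ hz] at k1 k2
  refine ⟨by rw [hu0, hun z hz]; exact k1, ?_⟩
  have hK0 : 0 ≤ K * ‖z‖ ^ (θ₀ / (2 * Real.pi) * γ) := (norm_nonneg _).trans k2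
  have hzp := norm_pos_iff.2 hz
  -- Differentiating the logarithm divides the bound by |z|, whence the exponent lγ - 1.
  rw [Real.rpow_sub_one hzp.ne', ← mul_div_assoc]
  refine ContinuousLinearMap.opNorm_le_bound _ (by positivity) fun x => ?_
  have e : u ∘ Complex.exp =ᶠ[nhds (Complex.log z)] v := by
    filter_upwards [(isOpen_cover R).mem_nhds hw] with w hw using hue w hw
  have hez := Complex.exp_log hz
  have h4 := fderiv_comp_exp (f := u) (w := Complex.log z)
    (by rw [hez]; exact differentiableAt_of_infty hus (isOpen_pdisc R) hzR) (z⁻¹ * x)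
  rw [hez, mul_inv_cancel_left₀ hz] at h4
  have e' : fderiv ℝ (fun ζ => u (Complex.exp ζ)) (Complex.log z) = fderiv ℝ v (Complex.log z) :=
    e.fderiv_eq
  rw [← h4, e']
  refine ((fderiv ℝ v (Complex.log z)).le_of_opNorm_le k2 _).trans_eq ?_
  rw [norm_mul, norm_inv]
  ring

/-! ### Paths and the distance -/

/-- The `C¹` paths that compete in the definition of `hdist`. -/
structure IsPath (R : ℝ) (x y : ℂ) (γ : ℝ → ℂ) : Prop where
  contDiffOn : ContDiffOn ℝ 1 γ (Icc 0 1)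
  mem : ∀ t ∈ Icc (0 : ℝ) 1, γ t ∈ disc R
  source : γ 0 = x
  target : γ 1 = y

/-- The length of a path. -/
def length (φ : ℂ → ℝ) (γ : ℝ → ℂ) : ℝ≥0∞ :=
  ∫⁻ t in Icc (0 : ℝ) 1, ENNReal.ofReal (Real.exp (φ (γ t)) * ‖derivWithin γ (Icc 0 1) t‖)

theorem le_hdist_iff {φ : ℂ → ℝ} {R : ℝ} {x y : ℂ} {a : ℝ≥0∞} :
    a ≤ hdist φ R x y ↔ ∀ γ, IsPath R x y γ → a ≤ length φ γ := by
  simp only [hdist, le_iInf_iff]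
  exact ⟨fun h γ hγ => h γ hγ.1 hγ.2 hγ.3 hγ.4, fun h γ h1 h2 h3 h4 => h γ ⟨h1, h2, h3, h4⟩⟩

theorem hdist_le_length {φ : ℂ → ℝ} {R : ℝ} {x y : ℂ} {γ : ℝ → ℂ} (hγ : IsPath R x y γ) :
    hdist φ R x y ≤ length φ γ :=
  le_hdist_iff.1 le_rfl γ hγ

theorem one_sub_mem_unit {t : ℝ} : 1 - t ∈ Icc (0 : ℝ) 1 ↔ t ∈ Icc (0 : ℝ) 1 := by
  simp only [mem_Icc]
  constructor <;> rintro ⟨h1, h2⟩ <;> constructor <;> linarith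

theorem IsPath.reverse {R : ℝ} {x y : ℂ} {γ : ℝ → ℂ} (hγ : IsPath R x y γ) :
    IsPath R y x (fun t => γ (1 - t)) where
  contDiffOn := hγ.contDiffOn.comp (contDiff_const.sub contDiff_id).contDiffOn
    fun _ ht => one_sub_mem_unit.2 ht
  mem t ht := hγ.mem _ (one_sub_mem_unit.2 ht)
  source := by rw [sub_zero]; exact hγ.target
  target := by rw [sub_self]; exact hγ.source

theorem length_reverse (φ : ℂ → ℝ) {γ : ℝ → ℂ} (hγ : ContDiffOn ℝ 1 γ (Icc 0 1)) :
    length φ (fun t => γ (1 - t)) = length φ γ := by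
  have hd : ∀ t ∈ Icc (0 : ℝ) 1, derivWithin (fun t => γ (1 - t)) (Icc 0 1) t
      = -derivWithin γ (Icc 0 1) (1 - t) := fun t ht => by
    have h1 := ((hγ.differentiableOn (by simp)) (1 - t)
      (one_sub_mem_unit.2 ht)).hasDerivWithinAt
    have h2 : HasDerivWithinAt (fun s : ℝ => 1 - s) (-1) (Icc 0 1) t :=
      ((hasDerivAt_id t).const_sub 1).hasDerivWithinAt
    have h3 := HasDerivWithinAt.scomp t h1 h2 (fun s hs => one_sub_mem_unit.2 hs)
    rw [neg_one_smul] at h3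
    exact h3.derivWithin (uniqueDiffOn_Icc zero_lt_one t ht)
  set F : ℝ → ℝ≥0∞ := fun t =>
    ENNReal.ofReal (Real.exp (φ (γ t)) * ‖derivWithin γ (Icc 0 1) t‖) with hF
  have h1 : length φ (fun t => γ (1 - t)) = ∫⁻ t in Icc (0 : ℝ) 1, F (1 - t) := by
    refine setLIntegral_congr_fun measurableSet_Icc fun t ht => ?_
    simp only [hF]
    rw [hd t ht, norm_neg]
  rw [h1, length, ← lintegral_indicator measurableSet_Icc, ← lintegral_indicator measurableSet_Icc,
    ← lintegral_sub_left_eq_self _ (1 : ℝ)]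
  refine lintegral_congr fun t => ?_
  by_cases ht : t ∈ Icc (0 : ℝ) 1
  · rw [indicator_of_mem ht, indicator_of_mem (one_sub_mem_unit.2 ht), sub_sub_cancel]
  · rw [indicator_of_notMem ht, indicator_of_notMem (mt one_sub_mem_unit.1 ht)]

theorem hdist_comm (φ : ℂ → ℝ) (R : ℝ) (x y : ℂ) : hdist φ R x y = hdist φ R y x := by
  have h : ∀ x y, hdist φ R x y ≤ hdist φ R y x := fun x y => le_hdist_iff.2 fun γ hγ => by
    rw [← length_reverse φ hγ.contDiffOn]
    exact hdist_le_length hγ.reverse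
  exact le_antisymm (h x y) (h y x)

/-- Along a path in a region where `‖dg‖_h ≤ M`, the function `g` varies by at most `M` times the
length. -/
theorem IsPath.abs_sub_le {φ : ℂ → ℝ} {R : ℝ} {x y : ℂ} {γ : ℝ → ℂ} (hγ : IsPath R x y γ)
    {g : ℂ → ℝ} (hg : ContDiffOn ℝ ∞ g (pdisc R)) {M ℓ : ℝ} (hℓ : 0 ≤ ℓ) (hM : 0 ≤ M)
    (hlen : length φ γ ≤ ENNReal.ofReal ℓ) {a b : ℝ} (ha : 0 ≤ a) (hab : a ≤ b) (hb : b ≤ 1)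
    (h : ∀ t ∈ Icc a b, γ t ≠ 0 ∧ ‖fderiv ℝ g (γ t)‖ ≤ M * Real.exp (φ (γ t))) :
    |g (γ b) - g (γ a)| ≤ M * ℓ := by
  have hsub : Icc a b ⊆ Icc (0 : ℝ) 1 := Icc_subset_Icc ha hb
  have hmem : ∀ t ∈ Icc a b, γ t ∈ pdisc R := fun t ht => ⟨hγ.mem t (hsub ht), (h t ht).1⟩
  have hcγ : ContinuousOn γ (Icc a b) := hγ.contDiffOn.continuousOn.mono hsub
  have hcd : ContinuousOn (derivWithin γ (Icc 0 1)) (Icc a b) :=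
    (hγ.contDiffOn.continuousOn_derivWithin (uniqueDiffOn_Icc zero_lt_one) le_rfl).mono hsub
  have hcg : ContinuousOn (fun t => fderiv ℝ g (γ t) (derivWithin γ (Icc 0 1) t)) (Icc a b) :=
    (((contDiffOn_fderiv_infty hg (isOpen_pdisc R)).continuousOn.comp hcγ hmem).clm_apply hcd)
  have hFTC : ∫ t in a..b, fderiv ℝ g (γ t) (derivWithin γ (Icc 0 1) t)
      = g (γ b) - g (γ a) := by
    refine intervalIntegral.integral_eq_sub_of_hasDerivAt_of_le hab
      (hg.continuousOn.comp hcγ hmem) (fun t ht => ?_) ?_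
    · have ht' := Ioo_subset_Icc_self ht
      have hn : Icc (0 : ℝ) 1 ∈ nhds t := Icc_mem_nhds (ha.trans_lt ht.1) (ht.2.trans_le hb)
      have h1 := ((hγ.contDiffOn.differentiableOn (by simp)) t
        (hsub ht')).hasDerivWithinAt.hasDerivAt hn
      exact (differentiableAt_of_infty hg (isOpen_pdisc R) (hmem t ht')).hasFDerivAt.comp_hasDerivAt
        t h1
    · exact (hcg.mono (by rw [uIcc_of_le hab])).intervalIntegrable
  rw [← hFTC, ← Real.norm_eq_abs, intervalIntegral.integral_of_le hab]
  have h2 : ‖∫ t in Ioc a b, fderiv ℝ g (γ t) (derivWithin γ (Icc 0 1) t)‖ₑ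
      ≤ ENNReal.ofReal (M * ℓ) := by
    calc _ ≤ ∫⁻ t in Ioc a b, ‖fderiv ℝ g (γ t) (derivWithin γ (Icc 0 1) t)‖ₑ :=
          enorm_integral_le_lintegral_enorm _
      _ ≤ ∫⁻ t in Ioc a b, ENNReal.ofReal M *
            ENNReal.ofReal (Real.exp (φ (γ t)) * ‖derivWithin γ (Icc 0 1) t‖) := by
          refine setLIntegral_mono' measurableSet_Ioc fun t ht => ?_
          rw [← ENNReal.ofReal_mul hM, ← ofReal_norm]
          refine ENNReal.ofReal_le_ofReal ((ContinuousLinearMap.le_opNorm _ _).trans ?_)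
          rw [← mul_assoc]
          gcongr
          exact (h t (Ioc_subset_Icc_self ht)).2
      _ = ENNReal.ofReal M * ∫⁻ t in Ioc a b,
            ENNReal.ofReal (Real.exp (φ (γ t)) * ‖derivWithin γ (Icc 0 1) t‖) :=
          lintegral_const_mul' _ _ ENNReal.ofReal_ne_top
      _ ≤ ENNReal.ofReal M * ENNReal.ofReal ℓ := by
          gcongr
          exact (lintegral_mono_set (Ioc_subset_Icc_self.trans hsub)).trans hlen
      _ = ENNReal.ofReal (M * ℓ) := (ENNReal.ofReal_mul hM).symm
  rw [← ofReal_norm] at h2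
  exact (ENNReal.ofReal_le_ofReal_iff (by positivity)).1 h2

theorem contDiffOn_norm_rpow (l R : ℝ) : ContDiffOn ℝ ∞ (fun z : ℂ => ‖z‖ ^ l) (pdisc R) :=
  fun _ hz => ((contDiffAt_norm ℝ (mem_pdisc.1 hz).2).rpow_const_of_ne
    (norm_ne_zero_iff.2 (mem_pdisc.1 hz).2)).contDiffWithinAt

theorem norm_fderiv_norm_rpow_le {l : ℝ} (hl : 0 ≤ l) {z : ℂ} (hz : z ≠ 0) :
    ‖fderiv ℝ (fun z : ℂ => ‖z‖ ^ l) z‖ ≤ l * ‖z‖ ^ (l - 1) := by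
  have h1 : HasFDerivAt (fun z : ℂ => ‖z‖) (fderiv ℝ (fun z : ℂ => ‖z‖) z) z :=
    ((contDiffAt_norm ℝ hz).differentiableAt (n := 1) (by simp)).hasFDerivAt
  have h2 := h1.rpow_const (p := l) (Or.inl (norm_ne_zero_iff.2 hz))
  rw [h2.fderiv, norm_smul, Real.norm_of_nonneg (by positivity)]
  have h3 : ‖fderiv ℝ (fun z : ℂ => ‖z‖) z‖ ≤ 1 := by
    simpa using norm_fderiv_le_of_lipschitz ℝ (x₀ := z) (lipschitzWith_one_norm (E := ℂ))
  exact mul_le_of_le_one_right (by positivity) h3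

/-- A short path stays at a distance from the cone point. -/
theorem IsPath.stays {φ : ℂ → ℝ} {R : ℝ} {x y : ℂ} {γ : ℝ → ℂ} (hγ : IsPath R x y γ)
    {l c ρ : ℝ} (hl : 0 < l) (hc : 0 < c)
    (hφ : ∀ z : ℂ, z ≠ 0 → ‖z‖ ≤ ρ → c⁻¹ * ‖z‖ ^ (l - 1) ≤ Real.exp (φ z))
    {ℓ : ℝ} (hℓ : 0 ≤ ℓ) (hlen : length φ γ ≤ ENNReal.ofReal ℓ)
    (hx : l * c * ℓ < ‖x‖ ^ l) (hxρ : ‖x‖ < ρ) (hρ : l * c * ℓ < ρ ^ l - ‖x‖ ^ l) :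
    ∀ t ∈ Icc (0 : ℝ) 1, γ t ≠ 0 ∧ ‖γ t‖ < ρ ∧ ‖x‖ ^ l - l * c * ℓ ≤ ‖γ t‖ ^ l := by
  have hpos : 0 ≤ l * c * ℓ := by positivity
  have hcγ : ContinuousOn γ (Icc 0 1) := hγ.contDiffOn.continuousOn
  have hcs : ContinuousOn (fun t => ‖γ t‖ ^ l) (Icc 0 1) :=
    (hcγ.norm).rpow_const fun _ _ => Or.inr hl.le
  have hx0 : x ≠ 0 := by
    rintro rfl
    rw [norm_zero, Real.zero_rpow hl.ne'] at hx
    linarith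
  -- The function |z|^l has h-gradient bounded by l·c in |z| ≤ ρ, so it changes by at most l·c·ℓ as
  -- long as the path remains in that punctured disc.
  have key : ∀ b ∈ Icc (0 : ℝ) 1, (∀ t ∈ Icc 0 b, γ t ≠ 0 ∧ ‖γ t‖ < ρ) →
      |‖γ b‖ ^ l - ‖x‖ ^ l| ≤ l * c * ℓ := fun b hb h => by
    have := hγ.abs_sub_le (contDiffOn_norm_rpow l R) hℓ (by positivity : 0 ≤ l * c) hlen le_rfl
      hb.1 hb.2 fun t ht => ⟨(h t ht).1, ?_⟩
    · rwa [hγ.source] at this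
    · refine (norm_fderiv_norm_rpow_le hl.le (h t ht).1).trans ?_
      have h1 := hφ _ (h t ht).1 (h t ht).2.le
      rw [inv_mul_le_iff₀ hc] at h1
      rw [mul_assoc]
      gcongr
  have hV : IsOpen {z : ℂ | z ≠ 0 ∧ ‖z‖ < ρ} :=
    isOpen_ne.inter (isOpen_lt continuous_norm continuous_const)
  have hall : ∀ t ∈ Icc (0 : ℝ) 1, γ t ≠ 0 ∧ ‖γ t‖ < ρ := by
    by_contra hcon
    push Not at hcon
    set B : Set ℝ := Icc 0 1 ∩ γ ⁻¹' {z : ℂ | z ≠ 0 ∧ ‖z‖ < ρ}ᶜ with hB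
    have hBc : IsClosed B := hcγ.preimage_isClosed_of_isClosed isClosed_Icc hV.isClosed_compl
    have hBne : B.Nonempty := by
      obtain ⟨t, ht, h⟩ := hcon
      exact ⟨t, ht, fun h' => absurd h'.2 (not_lt.2 (h h'.1))⟩
    have hBb : BddBelow B := ⟨0, fun t ht => ht.1.1⟩
    -- First exit time. By continuity the estimate of |z|^l still holds there, which excludes both
    -- reaching 0 and reaching the circle of radius ρ.
    have hτ : sInf B ∈ B := hBc.csInf_mem hBne hBb
    set τ := sInf B with hτd
    have hbefore : ∀ t ∈ Ico 0 τ, γ t ≠ 0 ∧ ‖γ t‖ < ρ := fun t ht => by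
      by_contra h'
      exact absurd (csInf_le hBb (⟨⟨ht.1, ht.2.le.trans hτ.1.2⟩, h'⟩ : t ∈ B)) (not_le.2 ht.2)
    have hτ0 : 0 < τ := lt_of_le_of_ne hτ.1.1 fun h' => hτ.2 (by
      rw [← h', hγ.source]; exact ⟨hx0, hxρ⟩)
    have hlim : |‖γ τ‖ ^ l - ‖x‖ ^ l| ≤ l * c * ℓ := by
      have hct : Filter.Tendsto (fun t => |‖γ t‖ ^ l - ‖x‖ ^ l|) (nhdsWithin τ (Ico 0 τ))
          (nhds |‖γ τ‖ ^ l - ‖x‖ ^ l|) :=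
        (((hcs τ hτ.1).mono fun t ht => ⟨ht.1, ht.2.le.trans hτ.1.2⟩).sub
          continuousWithinAt_const).abs
      have : (nhdsWithin τ (Ico 0 τ)).NeBot := by
        rw [nhdsWithin_Ico_eq_nhdsLT hτ0]; infer_instance
      refine le_of_tendsto hct ?_
      filter_upwards [self_mem_nhdsWithin] with t ht
      exact key t ⟨ht.1, ht.2.le.trans hτ.1.2⟩ fun s hs => hbefore s ⟨hs.1, hs.2.trans_lt ht.2⟩
    have hnot : ¬(γ τ ≠ 0 ∧ ‖γ τ‖ < ρ) := hτ.2
    by_cases h0 : γ τ = 0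
    · rw [h0, norm_zero, Real.zero_rpow hl.ne'] at hlim
      linarith [(abs_le.1 hlim).1]
    · have h1 : ρ ≤ ‖γ τ‖ := not_lt.1 fun h => hnot ⟨h0, h⟩
      have h2 : ρ ^ l ≤ ‖γ τ‖ ^ l :=
        Real.rpow_le_rpow ((norm_nonneg x).trans hxρ.le) h1 hl.le
      linarith [(abs_le.1 hlim).2]
  exact fun t ht => ⟨(hall t ht).1, (hall t ht).2, by
    linarith [(abs_le.1 (key t ht fun s hs => hall s ⟨hs.1, hs.2.trans ht.2⟩)).1]⟩
/-! ### Hölder continuity -/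

/-- Growth at the cone point: `|u - u(0)| = O(|z|^{lγ})` and `|du| = O(|z|^{lγ - 1})` on every
smaller disc. -/
def HasConeGrowth (R l γ : ℝ) (u : ℂ → ℝ) : Prop :=
  ∀ ρ < R, ∃ K : ℝ, 0 ≤ K ∧ ∀ z : ℂ, z ≠ 0 → ‖z‖ ≤ ρ →
    |u z - u 0| ≤ K * ‖z‖ ^ (l * γ) ∧ ‖fderiv ℝ u z‖ ≤ K * ‖z‖ ^ (l * γ - 1)

/-- It is enough to check the growth near the cone point. -/
theorem hasConeGrowth_of_near {R l γ : ℝ} {u : ℂ → ℝ} (hu : ContDiffOn ℝ ∞ u (pdisc R)) {ρ K : ℝ}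
    (hρ : 0 < ρ) (h : ∀ z : ℂ, z ≠ 0 → ‖z‖ ≤ ρ →
      |u z - u 0| ≤ K * ‖z‖ ^ (l * γ) ∧ ‖fderiv ℝ u z‖ ≤ K * ‖z‖ ^ (l * γ - 1)) :
    HasConeGrowth R l γ u := by
  intro ρ' hρ'
  set A : Set ℂ := Metric.closedBall 0 ρ' \ Metric.ball 0 ρ with hA
  have hAc : IsCompact A := (isCompact_closedBall 0 ρ').diff Metric.isOpen_ball
  have hA0 : ∀ z ∈ A, z ≠ 0 := fun z hz h0 => hz.2 (by rw [h0]; exact Metric.mem_ball_self hρ)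
  have hAsub : A ⊆ pdisc R := fun z hz => ⟨Metric.closedBall_subset_ball hρ' hz.1, hA0 z hz⟩
  have hcp : ∀ p : ℝ, ContinuousOn (fun z : ℂ => ‖z‖ ^ p) A := fun p =>
    continuous_norm.continuousOn.rpow_const fun z hz => Or.inl (norm_ne_zero_iff.2 (hA0 z hz))
  have hf₁ : ContinuousOn (fun z => (u z - u 0) * ‖z‖ ^ (-(l * γ))) A :=
    ((hu.continuousOn.mono hAsub).sub continuousOn_const).mul (hcp _)
  have hf₂ : ContinuousOn (fun z => ‖fderiv ℝ u z‖ * ‖z‖ ^ (-(l * γ - 1))) A :=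
    ((contDiffOn_fderiv_infty hu (isOpen_pdisc R)).continuousOn.mono hAsub).norm.mul (hcp _)
  obtain ⟨B₁, hB₁⟩ := hAc.exists_bound_of_continuousOn hf₁
  obtain ⟨B₂, hB₂⟩ := hAc.exists_bound_of_continuousOn hf₂
  refine ⟨max |K| (max B₁ B₂), (abs_nonneg K).trans (le_max_left _ _), fun z hz hzρ => ?_⟩
  have hpos : 0 < ‖z‖ := norm_pos_iff.2 hz
  rcases le_or_gt ‖z‖ ρ with hle | hgt
  · obtain ⟨h1, h2⟩ := h z hz hle
    have hK : K ≤ max |K| (max B₁ B₂) := (le_abs_self K).trans (le_max_left _ _)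
    exact ⟨h1.trans (by gcongr), h2.trans (by gcongr)⟩
  · have hzA : z ∈ A := ⟨by simpa using hzρ, by simpa using hgt.le⟩
    have h1 := hB₁ z hzA
    have h2 := hB₂ z hzA
    rw [norm_mul, Real.norm_of_nonneg (by positivity : 0 ≤ ‖z‖ ^ (-(l * γ))),
      Real.rpow_neg hpos.le, ← div_eq_mul_inv, div_le_iff₀ (by positivity)] at h1
    rw [norm_mul, Real.norm_of_nonneg (by positivity : 0 ≤ ‖z‖ ^ (-(l * γ - 1))), norm_norm,
      Real.rpow_neg hpos.le, ← div_eq_mul_inv, div_le_iff₀ (by positivity)] at h2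
    have hK₁ : B₁ ≤ max |K| (max B₁ B₂) := (le_max_left _ _).trans (le_max_right _ _)
    have hK₂ : B₂ ≤ max |K| (max B₁ B₂) := (le_max_right _ _).trans (le_max_right _ _)
    exact ⟨h1.trans (by gcongr), h2.trans (by gcongr)⟩

/-- Let k = l·c. If |x|^l ≤ 2kℓ, then x and y are both close to 0 relative to ℓ, and u(0) serves as
intermediate value. If kℓ ≥ δ, the path may leave the larger disc, but ℓ is bounded below and the
oscillation of u above. Otherwise the path stays where |z|^l ≥ m ≥ kℓ, and there ‖du‖_h ≤ K c
m^{γ-1}, to be multiplied by ℓ. -/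
theorem exists_holder_along_paths {θ₀ R : ℝ} {φ : ℂ → ℝ} (hφ : IsHyperbolicCone θ₀ R φ)
    (hθ : 0 < θ₀) {γ : ℝ} (hγ : 0 < γ) (hγ1 : γ ≤ 1) {u : ℂ → ℝ}
    (hu : ContDiffOn ℝ ∞ u (pdisc R)) (hg : HasConeGrowth R (θ₀ / (2 * Real.pi)) γ u) {ρ : ℝ}
    (hρ : 0 < ρ) (hρR : ρ < R) :
    ∃ K : ℝ, 0 < K ∧ ∀ x ∈ disc ρ, ∀ y ∈ disc ρ, ‖y‖ ≤ ‖x‖ → ∀ p, IsPath R x y p → ∀ ℓ, 0 ≤ ℓ →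
      length φ p ≤ ENNReal.ofReal ℓ → |u x - u y| ≤ K * ℓ ^ γ := by
  set l := θ₀ / (2 * Real.pi) with hl'
  have hl : 0 < l := by positivity
  obtain ⟨ρ', hρρ', hρ'R⟩ := exists_between hρR
  have hρ' : 0 < ρ' := hρ.trans hρρ'
  obtain ⟨c, hc, hcb⟩ := hφ.exists_bounds hρ'R
  obtain ⟨K, hK, hKb⟩ := hg ρ' hρ'R
  set k := l * c with hk
  have hk0 : 0 < k := by positivity
  set δ := ρ' ^ l - ρ ^ l with hδ
  have hδ0 : 0 < δ := sub_pos.2 (Real.rpow_lt_rpow hρ.le hρρ' hl)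
  have hval : ∀ z ∈ disc ρ, |u z - u 0| ≤ K * (‖z‖ ^ l) ^ γ := fun z hz => by
    by_cases h0 : z = 0
    · rw [h0, sub_self, abs_zero]; positivity
    · rw [← Real.rpow_mul (norm_nonneg z)]
      exact (hKb z h0 ((mem_disc.1 hz).le.trans hρρ'.le)).1
  -- One summand for each of the three cases; the final 1 ensures strict positivity when K = 0.
  refine ⟨2 * K * (2 * k) ^ γ + 2 * K * (ρ ^ l) ^ γ * (δ / k) ^ (-γ) + K * c * k ^ (γ - 1) + 1,
    by positivity, fun x hx y hy hyx p hp ℓ hℓ hlen => ?_⟩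
  have hxρ := mem_disc.1 hx
  have hxl : ‖x‖ ^ l ≤ ρ ^ l := Real.rpow_le_rpow (norm_nonneg x) hxρ.le hl.le
  have hlγ : 0 ≤ ℓ ^ γ := Real.rpow_nonneg hℓ _
  have hpieces : 0 ≤ 2 * K * (2 * k) ^ γ ∧ 0 ≤ 2 * K * (ρ ^ l) ^ γ * (δ / k) ^ (-γ) ∧
      0 ≤ K * c * k ^ (γ - 1) := ⟨by positivity, by positivity, by positivity⟩
  obtain ⟨q1, q2, q3⟩ := hpieces
  suffices h : |u x - u y| ≤ 2 * K * (2 * k) ^ γ * ℓ ^ γ ∨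
      |u x - u y| ≤ 2 * K * (ρ ^ l) ^ γ * (δ / k) ^ (-γ) * ℓ ^ γ ∨
      |u x - u y| ≤ K * c * k ^ (γ - 1) * ℓ ^ γ by
    rcases h with h | h | h <;> refine h.trans (mul_le_mul_of_nonneg_right ?_ hlγ) <;> linarith
  have hboth : |u x - u y| ≤ 2 * K * (‖x‖ ^ l) ^ γ := by
    have h1 := hval x hx
    have h2 := hval y hy
    have h3 : K * (‖y‖ ^ l) ^ γ ≤ K * (‖x‖ ^ l) ^ γ := by gcongr
    have h4 : |u x - u y| ≤ |u x - u 0| + |u y - u 0| := by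
      have := abs_sub (u x - u 0) (u y - u 0)
      rwa [sub_sub_sub_cancel_right] at this
    linarith
  rcases le_or_gt (‖x‖ ^ l) (2 * k * ℓ) with hsmall | hbig
  · refine Or.inl (hboth.trans ?_)
    rw [mul_assoc (2 * K), ← Real.mul_rpow (by positivity) hℓ]
    gcongr
  rcases le_or_gt δ (k * ℓ) with hlong | hshort
  · refine Or.inr (Or.inl (hboth.trans ?_))
    have h1 : δ / k ≤ ℓ := by rwa [div_le_iff₀ hk0, mul_comm]
    have h2 : 1 ≤ (δ / k) ^ (-γ) * ℓ ^ γ := by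
      rw [Real.rpow_neg (by positivity), inv_mul_eq_div, one_le_div (by positivity)]
      exact Real.rpow_le_rpow (by positivity) h1 hγ.le
    calc 2 * K * (‖x‖ ^ l) ^ γ ≤ 2 * K * (ρ ^ l) ^ γ := by gcongr
      _ ≤ 2 * K * (ρ ^ l) ^ γ * ((δ / k) ^ (-γ) * ℓ ^ γ) :=
          le_mul_of_one_le_right (by positivity) h2
      _ = _ := by ring
  · refine Or.inr (Or.inr ?_)
    have hkl : 0 ≤ k * ℓ := by positivity
    have hstay := hp.stays hl hc (fun z hz hzρ => (hcb z hz hzρ).1) hℓ hlen (by linarith)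
      (hxρ.trans hρρ') (by linarith)
    set m := ‖x‖ ^ l - k * ℓ with hm
    have hm0 : 0 < m := by linarith
    have hkm : k * ℓ ≤ m := by linarith
    have h1 := hp.abs_sub_le hu hℓ (by positivity : 0 ≤ K * c * m ^ (γ - 1)) hlen le_rfl zero_le_one
      le_rfl fun t ht => ⟨(hstay t ht).1, ?_⟩
    · rw [hp.source, hp.target, abs_sub_comm] at h1
      refine h1.trans ?_
      -- A zero length is treated apart: the exponent γ - 1 may be negative.
      rcases hℓ.eq_or_lt with h0 | h0
      · rw [← h0, mul_zero, Real.zero_rpow hγ.ne', mul_zero]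
      · have h2 : m ^ (γ - 1) ≤ (k * ℓ) ^ (γ - 1) :=
          Real.rpow_le_rpow_of_nonpos (by positivity) hkm (by linarith)
        rw [Real.mul_rpow hk0.le hℓ] at h2
        calc K * c * m ^ (γ - 1) * ℓ ≤ K * c * (k ^ (γ - 1) * ℓ ^ (γ - 1)) * ℓ := by gcongr
          _ = K * c * k ^ (γ - 1) * (ℓ ^ (γ - 1) * ℓ) := by ring
          _ = _ := by rw [← Real.rpow_add_one h0.ne', sub_add_cancel]
    · obtain ⟨h0, hρt, hmt⟩ := hstay t ht
      have hz : 0 < ‖p t‖ := norm_pos_iff.2 h0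
      have h2 := (hcb _ h0 hρt.le).1
      rw [inv_mul_le_iff₀ hc] at h2
      have h3 : (‖p t‖ ^ l) ^ (γ - 1) ≤ m ^ (γ - 1) :=
        Real.rpow_le_rpow_of_nonpos hm0 hmt (by linarith)
      calc ‖fderiv ℝ u (p t)‖ ≤ K * ‖p t‖ ^ (l * γ - 1) := (hKb _ h0 hρt.le).2
        _ = K * ((‖p t‖ ^ l) ^ (γ - 1) * ‖p t‖ ^ (l - 1)) := by
          rw [← Real.rpow_mul hz.le, ← Real.rpow_add hz]; ring_nf
        _ ≤ K * (m ^ (γ - 1) * (c * Real.exp (φ (p t)))) := by gcongr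
        _ = _ := by ring

theorem isLocallyHolder_of_hasConeGrowth {θ₀ R : ℝ} {φ : ℂ → ℝ} (hφ : IsHyperbolicCone θ₀ R φ)
    (hθ : 0 < θ₀) {γ : ℝ} (hγ : 0 < γ) (hγ1 : γ ≤ 1) {u : ℂ → ℝ}
    (hu : ContDiffOn ℝ ∞ u (pdisc R)) (hg : HasConeGrowth R (θ₀ / (2 * Real.pi)) γ u) :
    IsLocallyHolder φ R γ u := by
  intro ρ hρR
  rcases le_or_gt ρ 0 with hρ | hρ
  · refine ⟨0, fun x hx => absurd (mem_disc.1 hx) ?_⟩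
    linarith [norm_nonneg x]
  obtain ⟨K, hK, hKb⟩ := exists_holder_along_paths hφ hθ hγ hγ1 hu hg hρ hρR
  have key : ∀ x ∈ disc ρ, ∀ y ∈ disc ρ, ‖y‖ ≤ ‖x‖ →
      edist (u x) (u y) ≤ (K.toNNReal : ℝ≥0∞) * hdist φ R x y ^ γ := fun x hx y hy hyx => by
    have hK0 : (K.toNNReal : ℝ≥0∞) ≠ 0 := by simpa using hK
    rw [← ENNReal.div_le_iff' hK0 ENNReal.coe_ne_top]
    -- Inverting the power turns the claim into a lower bound for the infimum, which may be checked
    -- path by path.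
    refine (ENNReal.rpow_inv_le_iff hγ).1 (le_hdist_iff.2 fun p hp => ?_)
    rcases eq_or_ne (length φ p) ⊤ with h | h
    · rw [h]; exact le_top
    rw [ENNReal.rpow_inv_le_iff hγ, ENNReal.div_le_iff' hK0 ENNReal.coe_ne_top]
    have h1 := hKb x hx y hy hyx p hp (length φ p).toReal ENNReal.toReal_nonneg
      (ENNReal.ofReal_toReal h).ge
    calc edist (u x) (u y) = ENNReal.ofReal |u x - u y| := by rw [edist_dist, Real.dist_eq]
      _ ≤ ENNReal.ofReal (K * (length φ p).toReal ^ γ) := ENNReal.ofReal_le_ofReal h1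
      _ = _ := by
        rw [ENNReal.ofReal_mul hK.le, ← ENNReal.ofReal_rpow_of_nonneg ENNReal.toReal_nonneg hγ.le,
          ENNReal.ofReal_toReal h]
        rfl
  refine ⟨K.toNNReal, fun x hx y hy => ?_⟩
  rcases le_total ‖y‖ ‖x‖ with h | h
  · exact key x hx y hy h
  · rw [edist_comm, hdist_comm]
    exact key y hy x hx h

/-! ### The distance from the cone point -/

theorem isPath_radial {R : ℝ} {z : ℂ} (hz : z ∈ disc R) : IsPath R 0 z (fun t => (t : ℂ) * z) where
  contDiffOn := (Complex.ofRealCLM.contDiff.mul contDiff_const).contDiffOn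
  mem t ht := by
    rw [mem_disc, norm_mul, Complex.norm_real, Real.norm_of_nonneg ht.1]
    exact (mul_le_of_le_one_left (norm_nonneg z) ht.2).trans_lt (mem_disc.1 hz)
  source := by simp
  target := by simp

/-- Integrating c(t|z|)^{l-1}|z| over the segment gives c|z|^l/l; the singularity at t = 0 is
integrable because l > 0. -/
theorem length_radial_le {φ : ℂ → ℝ} {l c ρ : ℝ} (hl : 0 < l) (hc : 0 < c)
    (hφ : ∀ z : ℂ, z ≠ 0 → ‖z‖ ≤ ρ → Real.exp (φ z) ≤ c * ‖z‖ ^ (l - 1)) {z : ℂ} (hz : z ≠ 0)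
    (hzρ : ‖z‖ ≤ ρ) : length φ (fun t => (t : ℂ) * z) ≤ ENNReal.ofReal (c / l * ‖z‖ ^ l) := by
  have hz0 : 0 < ‖z‖ := norm_pos_iff.2 hz
  have hd : ∀ t ∈ Icc (0 : ℝ) 1, derivWithin (fun t : ℝ => (t : ℂ) * z) (Icc 0 1) t = z :=
    fun t ht => by
      have h1 : HasDerivAt (fun t : ℝ => (t : ℂ) * z) (1 * z) t :=
        (Complex.ofRealCLM.hasDerivAt (x := t)).mul_const z
      rw [one_mul] at h1
      exact h1.hasDerivWithinAt.derivWithin (uniqueDiffOn_Icc zero_lt_one t ht)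
  have hint : IntegrableOn (fun t : ℝ => c * ‖z‖ ^ l * t ^ (l - 1)) (Ioc 0 1) := by
    rw [← intervalIntegrable_iff_integrableOn_Ioc_of_le zero_le_one]
    exact (intervalIntegral.intervalIntegrable_rpow' (by linarith)).const_mul _
  rw [length, setLIntegral_congr Ioc_ae_eq_Icc.symm]
  calc _ ≤ ∫⁻ t in Ioc (0 : ℝ) 1, ENNReal.ofReal (c * ‖z‖ ^ l * t ^ (l - 1)) := by
        refine setLIntegral_mono' measurableSet_Ioc fun t ht => ENNReal.ofReal_le_ofReal ?_
        rw [hd t (Ioc_subset_Icc_self ht)]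
        have hn : ‖(t : ℂ) * z‖ = t * ‖z‖ := by
          rw [norm_mul, Complex.norm_real, Real.norm_of_nonneg ht.1.le]
        have h1 := hφ ((t : ℂ) * z) (mul_ne_zero (by exact_mod_cast ht.1.ne') hz) (by
          rw [hn]; exact (mul_le_of_le_one_left hz0.le ht.2).trans hzρ)
        rw [hn, Real.mul_rpow ht.1.le hz0.le] at h1
        calc _ ≤ c * (t ^ (l - 1) * ‖z‖ ^ (l - 1)) * ‖z‖ := by gcongr
          _ = c * (‖z‖ ^ (l - 1) * ‖z‖) * t ^ (l - 1) := by ring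
          _ = _ := by rw [← Real.rpow_add_one hz0.ne', sub_add_cancel]
    _ = ENNReal.ofReal (∫ t in Ioc (0 : ℝ) 1, c * ‖z‖ ^ l * t ^ (l - 1)) :=
        (ofReal_integral_eq_lintegral_ofReal hint
          ((ae_restrict_mem measurableSet_Ioc).mono fun t ht =>
            mul_nonneg (by positivity) (Real.rpow_nonneg ht.1.le _))).symm
    _ ≤ _ := by
        refine ENNReal.ofReal_le_ofReal (le_of_eq ?_)
        rw [← intervalIntegral.integral_of_le zero_le_one, intervalIntegral.integral_const_mul,
          integral_rpow (Or.inl (by linarith)), sub_add_cancel, Real.one_rpow,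
          Real.zero_rpow hl.ne']
        ring

/-- `r(z)` is comparable with `|z|^{θ₀/2π}` near the cone point. -/
theorem IsHyperbolicCone.exists_coneDist_bounds {θ₀ R : ℝ} {φ : ℂ → ℝ}
    (hφ : IsHyperbolicCone θ₀ R φ) (hθ : 0 < θ₀) {ρ : ℝ} (hρ : 0 < ρ) (hρR : ρ < R) :
    ∃ c₁ c₂ : ℝ, 0 < c₁ ∧ 0 < c₂ ∧ ∀ z : ℂ, z ≠ 0 → ‖z‖ ≤ ρ →
      c₁ * ‖z‖ ^ (θ₀ / (2 * Real.pi)) ≤ coneDist φ R z ∧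
      coneDist φ R z ≤ c₂ * ‖z‖ ^ (θ₀ / (2 * Real.pi)) := by
  set l := θ₀ / (2 * Real.pi) with hl'
  have hl : 0 < l := by positivity
  obtain ⟨ρ', hρρ', hρ'R⟩ := exists_between hρR
  obtain ⟨c, hc, hcb⟩ := hφ.exists_bounds hρ'R
  set δ := ρ' ^ l - ρ ^ l with hδ
  have hδ0 : 0 < δ := sub_pos.2 (Real.rpow_lt_rpow hρ.le hρρ' hl)
  -- Chosen so that l·c·e·|z|^l is at most half of both |z|^l and δ. A path from z shorter than
  -- e|z|^l then stays away from 0 by `IsPath.stays`.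
  set e := min 1 (δ / ρ ^ l) / (2 * (l * c)) with he
  have hρl : 0 < ρ ^ l := by positivity
  have he0 : 0 < e := by positivity
  refine ⟨e, c / l, he0, by positivity, fun z hz hzρ => ?_⟩
  have hz0 : 0 < ‖z‖ ^ l := Real.rpow_pos_of_pos (norm_pos_iff.2 hz) _
  have hzl : ‖z‖ ^ l ≤ ρ ^ l := Real.rpow_le_rpow (norm_nonneg z) hzρ hl.le
  have hup : hdist φ R 0 z ≤ ENNReal.ofReal (c / l * ‖z‖ ^ l) :=
    (hdist_le_length (isPath_radial (mem_disc.2 (hzρ.trans_lt hρR)))).trans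
      (length_radial_le hl hc (fun z hz hzρ => (hcb z hz hzρ).2) hz (hzρ.trans hρρ'.le))
  have hlow : ENNReal.ofReal (e * ‖z‖ ^ l) ≤ hdist φ R 0 z := by
    rw [hdist_comm]
    refine le_hdist_iff.2 fun p hp => ?_
    by_contra hcon
    have hkey : l * c * (e * ‖z‖ ^ l) = min 1 (δ / ρ ^ l) * ‖z‖ ^ l / 2 := by
      rw [he]; field_simp
    have h1 : min 1 (δ / ρ ^ l) * ‖z‖ ^ l ≤ ‖z‖ ^ l :=
      mul_le_of_le_one_left hz0.le (min_le_left _ _)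
    have h2 : min 1 (δ / ρ ^ l) * ‖z‖ ^ l ≤ δ := by
      calc _ ≤ δ / ρ ^ l * ρ ^ l := by
            gcongr
            exact min_le_right _ _
        _ = δ := div_mul_cancel₀ _ hρl.ne'
    have h3 := hp.stays hl hc (fun z hz hzρ => (hcb z hz hzρ).1) (by positivity)
      (not_le.1 hcon).le (by rw [hkey]; linarith) (hzρ.trans_lt hρρ') (by rw [hkey]; linarith)
    exact (h3 1 ⟨zero_le_one, le_rfl⟩).1 hp.target
  have hfin : hdist φ R 0 z ≠ ⊤ := ne_top_of_le_ne_top ENNReal.ofReal_ne_top hup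
  exact ⟨(ENNReal.ofReal_le_iff_le_toReal hfin).1 hlow,
    ENNReal.toReal_le_of_le_ofReal (by positivity) hup⟩

/-! ### The norm of a self-adjoint operator -/

/-- For self-adjoint b, tr b² is the squared Hilbert–Schmidt norm, which dominates the operator norm
by Cauchy–Schwarz. -/
theorem norm_le_opNorm {b : ℂ →L[ℝ] ℂ} (hb : ∀ v w : ℂ, inner ℝ (b v) w = inner ℝ v (b w)) :
    ‖b‖ ≤ opNorm b := by
  have hsym : (b 1).im = (b Complex.I).re := by
    have := hb 1 Complex.I
    simpa [Complex.inner] using this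
  have htr : LinearMap.trace ℝ ℂ ((b.comp b : ℂ →L[ℝ] ℂ) : ℂ →ₗ[ℝ] ℂ)
      = ‖b 1‖ ^ 2 + ‖b Complex.I‖ ^ 2 := by
    have hlin : ∀ v : ℂ, b v = v.re • b 1 + v.im • b Complex.I := fun v => by
      rw [← map_smul, ← map_smul, ← map_add]
      congr 1
      apply Complex.ext <;> simp
    rw [LinearMap.trace_eq_matrix_trace ℝ Complex.basisOneI, Matrix.trace_fin_two]
    simp only [LinearMap.toMatrix_apply, Complex.coe_basisOneI_repr, Complex.coe_basisOneI]
    simp only [Matrix.cons_val_zero, Matrix.cons_val_one, ContinuousLinearMap.coe_coe,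
      ContinuousLinearMap.comp_apply]
    rw [hlin (b 1), hlin (b Complex.I), Complex.sq_norm, Complex.sq_norm, Complex.normSq_apply,
      Complex.normSq_apply]
    simp
    rw [hsym]
  refine ContinuousLinearMap.opNorm_le_bound _ (Real.sqrt_nonneg _) fun v => ?_
  rw [opNorm, htr]
  refine abs_le_of_sq_le_sq' ?_ (by positivity) |>.2
  rw [mul_pow, Real.sq_sqrt (by positivity), Complex.sq_norm, Complex.sq_norm, Complex.sq_norm,
    Complex.sq_norm]
  have hlin : b v = v.re • b 1 + v.im • b Complex.I := by
    rw [← map_smul, ← map_smul, ← map_add]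
    congr 1
    apply Complex.ext <;> simp
  rw [hlin]
  simp only [Complex.normSq_apply, Complex.add_re, Complex.add_im, Complex.real_smul,
    Complex.re_ofReal_mul, Complex.im_ofReal_mul]
  nlinarith [sq_nonneg (v.re * (b Complex.I).re - v.im * (b 1).re),
    sq_nonneg (v.re * (b Complex.I).im - v.im * (b 1).im)]

theorem exists_norm_le_of_opNorm {θ₀ R : ℝ} {φ : ℂ → ℝ} (hφ : IsHyperbolicCone θ₀ R φ)
    (hθ : 0 < θ₀) {b : ℂ → ℂ →L[ℝ] ℂ} {C α : ℝ}
    (hsa : ∀ z ∈ pdisc R, ∀ v w : ℂ, metric φ z (b z v) w = metric φ z v (b z w))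
    (hb : ∀ z ∈ pdisc R, opNorm (b z) < C * coneDist φ R z ^ α) {ρ : ℝ} (hρ : 0 < ρ)
    (hρR : ρ < R) :
    ∃ C₁ : ℝ, ∀ z : ℂ, z ≠ 0 → ‖z‖ ≤ ρ → ‖b z‖ ≤ C₁ * ‖z‖ ^ (θ₀ / (2 * Real.pi) * α) := by
  obtain ⟨c₁, c₂, hc₁, hc₂, hc⟩ := hφ.exists_coneDist_bounds hθ hρ hρR
  -- The sign of α decides which of the two bounds of r controls r^α; the sum covers both.
  refine ⟨|C| * (c₁ ^ α + c₂ ^ α), fun z hz hzρ => ?_⟩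
  have hzR : z ∈ pdisc R := mem_pdisc.2 ⟨hzρ.trans_lt hρR, hz⟩
  have hz0 : 0 < ‖z‖ := norm_pos_iff.2 hz
  have h1 : ‖b z‖ ≤ opNorm (b z) := norm_le_opNorm fun v w => by
    have := hsa z hzR v w
    simp only [metric] at this
    exact mul_left_cancel₀ (Real.exp_pos _).ne' this
  obtain ⟨h2, h3⟩ := hc z hz hzρ
  set r := coneDist φ R z
  have hzl : 0 < ‖z‖ ^ (θ₀ / (2 * Real.pi)) := Real.rpow_pos_of_pos hz0 _
  have hr : 0 < r := lt_of_lt_of_le (by positivity) h2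
  have h4 : r ^ α ≤ (c₁ ^ α + c₂ ^ α) * ‖z‖ ^ (θ₀ / (2 * Real.pi) * α) := by
    rw [Real.rpow_mul hz0.le, add_mul, ← Real.mul_rpow hc₁.le hzl.le,
      ← Real.mul_rpow hc₂.le hzl.le]
    rcases le_total 0 α with hα | hα
    · have := Real.rpow_le_rpow hr.le h3 hα
      have : 0 ≤ (c₁ * ‖z‖ ^ (θ₀ / (2 * Real.pi))) ^ α := by positivity
      linarith
    · have := Real.rpow_le_rpow_of_nonpos (by positivity) h2 hα
      have : 0 ≤ (c₂ * ‖z‖ ^ (θ₀ / (2 * Real.pi))) ^ α := by positivity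
      linarith
  calc ‖b z‖ ≤ C * r ^ α := h1.trans (hb z hzR).le
    _ ≤ |C| * r ^ α := by gcongr; exact le_abs_self C
    _ ≤ |C| * ((c₁ ^ α + c₂ ^ α) * ‖z‖ ^ (θ₀ / (2 * Real.pi) * α)) := by gcongr
    _ = _ := by ring
/-! ### Weak derivatives -/

theorem integrableOn_disc_norm_rpow {p : ℝ} (hp : -2 < p) (ρ : ℝ) :
    IntegrableOn (fun z : ℂ => ‖z‖ ^ p) (disc ρ) := by
  rcases le_or_gt ρ 0 with hρ | hρ
  · rw [disc, Metric.ball_eq_empty.2 hρ]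
    exact integrableOn_empty
  refine (integrableOn_fun_norm_addHaar (μ := volume) (E := ℂ) (f := fun r : ℝ => r ^ p)).2 ?_
  rw [Complex.finrank_real_complex]
  have h1 : IntegrableOn (fun y : ℝ => y ^ (p + 1)) (Ioo 0 ρ) := by
    have := (intervalIntegral.intervalIntegrable_rpow' (a := 0) (b := ρ)
      (by linarith : -1 < p + 1))
    rw [intervalIntegrable_iff_integrableOn_Ioc_of_le hρ.le] at this
    exact this.mono_set Ioo_subset_Ioc_self
  refine h1.congr_fun (fun y hy => ?_) measurableSet_Ioo
  simp only [smul_eq_mul]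
  rw [Real.rpow_add_one hy.1.ne']
  norm_num
  ring

theorem disc_ae_eq_pdisc (ρ : ℝ) : pdisc ρ =ᵐ[volume] disc ρ :=
  sdiff_null_ae_eq_self (by simp)

theorem integrableOn_disc_of_norm_le {E : Type*} [NormedAddCommGroup E]
    [SecondCountableTopology E] {f : ℂ → E} {ρ C p : ℝ}
    (hf : ContinuousOn f (pdisc ρ)) (hp : -2 < p)
    (hb : ∀ z ∈ pdisc ρ, ‖f z‖ ≤ C * ‖z‖ ^ p) : IntegrableOn f (disc ρ) := by
  refine IntegrableOn.congr_set_ae ?_ (disc_ae_eq_pdisc ρ).symm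
  refine Integrable.mono' (((integrableOn_disc_norm_rpow hp ρ).mono_set sdiff_subset).const_mul C)
    (hf.aestronglyMeasurable (isOpen_pdisc ρ).measurableSet) ?_
  exact (ae_restrict_mem (isOpen_pdisc ρ).measurableSet).mono hb

/-- The divergence theorem on a square allows one exceptional point at which w is merely continuous.
Thus the cone point adds no singular term to the weak derivative. -/
theorem integral_fderiv_eq_zero {w : ℂ → ℝ} (hc : Continuous w)
    (hd : ∀ z ≠ 0, DifferentiableAt ℝ w z) {r : ℝ} (hr : 0 ≤ r) (hs : ∀ z, r ≤ ‖z‖ → w z = 0)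
    (v : ℂ) (hi : Integrable fun z => fderiv ℝ w z v) : ∫ z, fderiv ℝ w z v = 0 := by
  set e : (ℝ × ℝ) ≃L[ℝ] ℂ := Complex.equivRealProdCLM.symm with he
  have hmp : MeasurePreserving (fun p : ℝ × ℝ => e p) volume volume :=
    Complex.volume_preserving_equiv_real_prod.symm
  have hme : MeasurableEmbedding (fun p : ℝ × ℝ => e p) :=
    Complex.measurableEquivRealProd.symm.measurableEmbedding
  rw [← hmp.integral_comp hme]
  have hcoord : ∀ p : ℝ × ℝ, e p = ⟨p.1, p.2⟩ := fun p => rfl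
  have hn1 : ∀ p : ℝ × ℝ, |p.1| ≤ ‖e p‖ := fun p => Complex.abs_re_le_norm (e p)
  have hn2 : ∀ p : ℝ × ℝ, |p.2| ≤ ‖e p‖ := fun p => Complex.abs_im_le_norm (e p)
  have hout : ∀ z, r < ‖z‖ → fderiv ℝ w z v = 0 := fun z hz => by
    have h0 : w =ᶠ[nhds z] fun _ => 0 := by
      filter_upwards [(isOpen_lt continuous_const continuous_norm).mem_nhds hz] with y hy
      exact hs y (le_of_lt hy)
    rw [h0.fderiv_eq]
    simp
  rw [← setIntegral_eq_integral_of_forall_compl_eq_zero (s := Icc ((-r, -r) : ℝ × ℝ) (r, r))]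
  · set D : ℝ × ℝ → (ℝ × ℝ) →L[ℝ] ℝ := fun p =>
      (fderiv ℝ w (e p)).comp (e : (ℝ × ℝ) →L[ℝ] ℂ) with hD
    have hDer : ∀ c : ℝ, ∀ p ∈ Ioo (-r) r ×ˢ Ioo (-r) r \ {((0, 0) : ℝ × ℝ)},
        HasFDerivAt (fun p => c * w (e p)) (c • D p) p := fun c p hp => by
      have h0 : e p ≠ 0 := fun h => hp.2 (by
        have : p = e.symm 0 := by rw [← h, e.symm_apply_apply]
        rw [map_zero] at this
        exact this)
      exact ((hd _ h0).hasFDerivAt.comp p e.hasFDerivAt).const_mul c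
    have hsum : ∀ p, fderiv ℝ w (e p) v = (v.re • D p) (1, 0) + (v.im • D p) (0, 1) := fun p => by
      simp only [hD, FunLike.coe_smul, Pi.smul_apply, ContinuousLinearMap.comp_apply,
        ContinuousLinearEquiv.coe_coe, hcoord]
      rw [← map_smul, ← map_smul, ← map_add]
      congr 1
      apply Complex.ext <;> simp
    have hcont : ∀ c : ℝ, ContinuousOn (fun p => c * w (e p)) (Icc ((-r, -r) : ℝ × ℝ) (r, r)) :=
      fun c => (continuous_const.mul (hc.comp e.continuous)).continuousOn
    have hint : Integrable (fun p => fderiv ℝ w (e p) v) := (hmp.integrable_comp_emb hme).2 hi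
    have hdiv := integral_divergence_prod_Icc_of_hasFDerivAt_off_countable_of_le
      (fun p => v.re * w (e p)) (fun p => v.im * w (e p)) (fun p => v.re • D p)
      (fun p => v.im • D p) (-r, -r) (r, r) ⟨by simpa using hr, by simpa using hr⟩
      {(0, 0)} (countable_singleton _) (hcont _) (hcont _) (hDer _) (hDer _)
      (by simp_rw [← hsum]; exact hint.integrableOn)
    simp_rw [← hsum] at hdiv
    rw [hdiv]
    have hr' : |r| = r := abs_of_nonneg hr
    have e1 : ∀ x, w (e (x, r)) = 0 := fun x => hs _ (hr'.symm.le.trans (hn2 (x, r)))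
    have e2 : ∀ x, w (e (x, -r)) = 0 := fun x =>
      hs _ ((by simp [hr'] : r ≤ |-r|).trans (hn2 (x, -r)))
    have e3 : ∀ x, w (e (r, x)) = 0 := fun x => hs _ (hr'.symm.le.trans (hn1 (r, x)))
    have e4 : ∀ x, w (e (-r, x)) = 0 := fun x =>
      hs _ ((by simp [hr'] : r ≤ |-r|).trans (hn1 (-r, x)))
    simp [e1, e2, e3, e4]
  · intro p hp
    refine hout _ ?_
    by_contra hcon
    have h1 := abs_le.1 ((hn1 p).trans (not_lt.1 hcon))
    have h2 := abs_le.1 ((hn2 p).trans (not_lt.1 hcon))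
    exact hp ⟨⟨h1.1, h2.1⟩, ⟨h1.2, h2.2⟩⟩

theorem HasConeGrowth.continuousOn {R l γ : ℝ} {u : ℂ → ℝ} (hR : 0 < R)
    (hu : ContDiffOn ℝ ∞ u (pdisc R)) (hlγ : 0 < l * γ) (hg : HasConeGrowth R l γ u) :
    ContinuousOn u (disc R) := by
  intro z hz
  by_cases h0 : z = 0
  · obtain ⟨K, hK, hKb⟩ := hg (R / 2) (by linarith)
    rw [h0]
    refine ContinuousAt.continuousWithinAt ?_
    rw [ContinuousAt, tendsto_iff_norm_sub_tendsto_zero]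
    have hlim : Filter.Tendsto (fun z : ℂ => K * ‖z‖ ^ (l * γ)) (nhds 0) (nhds 0) := by
      have h : Continuous fun z : ℂ => K * ‖z‖ ^ (l * γ) :=
        continuous_const.mul (continuous_norm.rpow_const fun _ => Or.inr hlγ.le)
      simpa [Real.zero_rpow hlγ.ne'] using h.tendsto 0
    refine squeeze_zero' (Filter.Eventually.of_forall fun _ => norm_nonneg _) ?_ hlim
    filter_upwards [(isOpen_disc (R / 2)).mem_nhds (mem_disc.2 (by simpa using hR))] with y hy
    by_cases hy0 : y = 0
    · rw [hy0, sub_self, norm_zero]; positivity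
    · exact (hKb y hy0 (mem_disc.1 hy).le).1
  · exact (hu.continuousOn.continuousAt
      ((isOpen_pdisc R).mem_nhds ⟨hz, h0⟩)).continuousWithinAt

/-- The area density is O(|z|^{2(l-1)}), integrable since l > 0. The Dirichlet energy is conformally
invariant, and its density O(|z|^{2(lγ-1)}) is integrable since lγ > 0. The classical gradient is
also the weak one, because u is continuous at 0. -/
theorem memW12_of_hasConeGrowth {θ₀ R : ℝ} {φ : ℂ → ℝ} (hR : 0 < R)
    (hφ : IsHyperbolicCone θ₀ R φ) (hθ : 0 < θ₀) {γ : ℝ} (hγ : 0 < γ) {u : ℂ → ℝ}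
    (hu : ContDiffOn ℝ ∞ u (pdisc R)) (hg : HasConeGrowth R (θ₀ / (2 * Real.pi)) γ u) {ρ : ℝ}
    (hρR : ρ < R) : MemW12 φ (disc ρ) u := by
  set l := θ₀ / (2 * Real.pi) with hl'
  have hl : 0 < l := by positivity
  have hlγ : 0 < l * γ := by positivity
  have hcu : ContinuousOn u (disc R) := hg.continuousOn hR hu hlγ
  have hsub : disc ρ ⊆ disc R := Metric.ball_subset_ball hρR.le
  have hpsub : pdisc ρ ⊆ pdisc R := sdiff_subset_sdiff_left hsub
  obtain ⟨c, hc, hcb⟩ := hφ.exists_bounds hρR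
  obtain ⟨K, hK, hKb⟩ := hg ρ hρR
  obtain ⟨B, hB⟩ := (isCompact_closedBall (0 : ℂ) ρ).exists_bound_of_continuousOn
    (hcu.mono (Metric.closedBall_subset_ball hρR))
  have hcφ : ContinuousOn φ (pdisc ρ) := hφ.smooth.continuousOn.mono hpsub
  have hexp : ∀ z, Real.exp (2 * φ z) = Real.exp (φ z) ^ 2 := fun z => by
    rw [← Real.exp_nat_mul]; norm_num
  have hgrad : ∀ z, ‖gradient u z‖ = ‖fderiv ℝ u z‖ := fun z => by
    rw [gradient, LinearIsometryEquiv.norm_map]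
  have hcG : ContinuousOn (fun z => gradient u z) (pdisc ρ) :=
    (InnerProductSpace.toDual ℝ ℂ).symm.continuous.comp_continuousOn
      ((contDiffOn_fderiv_infty hu (isOpen_pdisc R)).continuousOn.mono hpsub)
  have hGint : IntegrableOn (fun z => gradient u z) (disc ρ) :=
    integrableOn_disc_of_norm_le (C := K) (p := l * γ - 1) hcG (by linarith) fun z hz => by
      rw [hgrad]; exact (hKb z hz.2 (mem_disc.1 hz.1).le).2
  refine ⟨(hcu.mono hsub).locallyIntegrableOn (isOpen_disc ρ).measurableSet, ?_,
    fun z => gradient u z, hGint.locallyIntegrableOn, ?_, ?_⟩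
  · refine integrableOn_disc_of_norm_le (C := B ^ 2 * c ^ 2) (p := 2 * (l - 1))
      (((hcu.mono (sdiff_subset.trans hsub)).pow 2).mul
        (Real.continuous_exp.comp_continuousOn (continuousOn_const.mul hcφ))) (by linarith)
      fun z hz => ?_
    have hz0 : 0 < ‖z‖ := norm_pos_iff.2 hz.2
    have h1 := hB z (by simpa using (mem_disc.1 hz.1).le)
    have h2 := (hcb z hz.2 (mem_disc.1 hz.1).le).2
    rw [Real.norm_of_nonneg (by positivity), hexp, mul_comm 2 (l - 1), Real.rpow_mul hz0.le,
      Real.rpow_two, mul_assoc, ← sq_abs (u z), ← mul_pow c]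
    exact mul_le_mul (pow_le_pow_left₀ (abs_nonneg _) h1 2)
      (pow_le_pow_left₀ (Real.exp_pos _).le h2 2) (by positivity) (by positivity)
  · intro η hη hηc hηs v
    have hηout : ∀ z, z ∉ disc ρ → z ∉ tsupport η := fun z hz h => hz (hηs h)
    have hη0 : ∀ z, z ∉ disc ρ → η z = 0 := fun z hz => image_eq_zero_of_notMem_tsupport
      (hηout z hz)
    have hdη0 : ∀ z, z ∉ disc ρ → fderiv ℝ η z = 0 := fun z hz =>
      image_eq_zero_of_notMem_tsupport fun h => hηout z hz (tsupport_fderiv_subset ℝ h)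
    have hηd : Differentiable ℝ η := hη.differentiable (by simp)
    have hw0 : ∀ z, z ∉ disc ρ → (fun y => u y * η y) =ᶠ[nhds z] fun _ => 0 := fun z hz => by
      filter_upwards [(isClosed_tsupport η).isOpen_compl.mem_nhds (hηout z hz)] with y hy
      rw [image_eq_zero_of_notMem_tsupport hy, mul_zero]
    have hwc : Continuous fun z => u z * η z := continuous_iff_continuousAt.2 fun z => by
      by_cases hz : z ∈ disc ρ
      · exact (hcu.continuousAt ((isOpen_disc R).mem_nhds (hsub hz))).mul
          hη.continuous.continuousAt
      · exact (continuousAt_const (y := (0 : ℝ))).congr (hw0 z hz).symm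
    have hud : ∀ z ∈ pdisc ρ, DifferentiableAt ℝ u z := fun z hz =>
      differentiableAt_of_infty hu (isOpen_pdisc R) (hpsub hz)
    have hwd : ∀ z ≠ 0, DifferentiableAt ℝ (fun z => u z * η z) z := fun z hz => by
      by_cases hz' : z ∈ disc ρ
      · exact (hud z ⟨hz', hz⟩).mul (hηd z)
      · exact (differentiableAt_const (0 : ℝ)).congr_of_eventuallyEq (hw0 z hz')
    have hfd : ∀ z ≠ 0, fderiv ℝ (fun z => u z * η z) z v
        = u z * fderiv ℝ η z v + inner ℝ (gradient u z) v * η z := fun z hz => by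
      by_cases hz' : z ∈ disc ρ
      · have e : fderiv ℝ (fun z => u z * η z) z = _ :=
          ((hud z ⟨hz', hz⟩).hasFDerivAt.mul (hηd z).hasFDerivAt).fderiv
        rw [e, inner_gradient_left]
        simp only [FunLike.coe_add, FunLike.coe_smul, Pi.add_apply, Pi.smul_apply, smul_eq_mul]
        ring
      · rw [(hw0 z hz').fderiv_eq, hη0 z hz', hdη0 z hz']
        simp
    have hi1 : IntegrableOn (fun z => u z * fderiv ℝ η z v) (disc ρ) := by
      have hcd : Continuous fun z => fderiv ℝ η z v :=
        (hη.continuous_fderiv (by simp)).clm_apply continuous_const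
      exact (((hcu.mono (Metric.closedBall_subset_ball hρR)).mul
        hcd.continuousOn).integrableOn_compact (isCompact_closedBall 0 ρ)).mono_set
        Metric.ball_subset_closedBall
    have hi2 : IntegrableOn (fun z => (inner ℝ (gradient u z) v : ℝ) * η z) (disc ρ) := by
      obtain ⟨M, hM⟩ := hηc.exists_bound_of_continuous hη.continuous
      refine Integrable.mul_bdd (c := M) (hGint.inner_const v) hη.continuous.aestronglyMeasurable
        (Filter.Eventually.of_forall hM)
    have hae : ∀ᵐ z : ℂ, z ≠ 0 := by
      simp [ae_iff]
    have hsum : IntegrableOn (fun z => u z * fderiv ℝ η z v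
        + (inner ℝ (gradient u z) v : ℝ) * η z) (disc ρ) := hi1.add hi2
    have hz0 : ∀ z, z ∉ disc ρ → u z * fderiv ℝ η z v
        + (inner ℝ (gradient u z) v : ℝ) * η z = 0 := fun z hz => by
      rw [hη0 z hz, hdη0 z hz]
      simp
    have hfull : Integrable (fun z => u z * fderiv ℝ η z v
        + (inner ℝ (gradient u z) v : ℝ) * η z) := by
      refine (integrableOn_iff_integrable_of_support_subset fun z hz => ?_).1 hsum
      by_contra h
      exact hz (hz0 z h)
    have hfae : (fun z => u z * fderiv ℝ η z v + (inner ℝ (gradient u z) v : ℝ) * η z)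
        =ᵐ[volume] fun z => fderiv ℝ (fun z => u z * η z) z v :=
      hae.mono fun z hz => (hfd z hz).symm
    have hzero := integral_fderiv_eq_zero hwc hwd (r := max ρ 0) (le_max_right _ _)
      (fun z hz => by
        rw [hη0 z fun h => absurd (mem_disc.1 h) (not_lt.2 ((le_max_left _ _).trans hz)),
          mul_zero]) v (hfull.congr hfae)
    rw [← integral_congr_ae hfae, ← setIntegral_eq_integral_of_forall_compl_eq_zero hz0,
      integral_add hi1 hi2] at hzero
    linarith
  · refine integrableOn_disc_of_norm_le (C := K ^ 2) (p := 2 * (l * γ - 1))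
      ((((Real.continuous_exp.comp_continuousOn hcφ.neg).mul hcG.norm).pow 2).mul
        (Real.continuous_exp.comp_continuousOn (continuousOn_const.mul hcφ))) (by linarith)
      fun z hz => ?_
    have hz0 : 0 < ‖z‖ := norm_pos_iff.2 hz.2
    have h2 := (hKb z hz.2 (mem_disc.1 hz.1).le).2
    rw [Real.norm_of_nonneg (by positivity), hexp, ← mul_pow, mul_right_comm, ← Real.exp_add,
      neg_add_cancel, Real.exp_zero, one_mul, mul_comm 2 (l * γ - 1), Real.rpow_mul hz0.le,
      Real.rpow_two, ← mul_pow, hgrad]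
    exact pow_le_pow_left₀ (norm_nonneg _) h2 2
/-! ### Quadratic differentials -/

theorem contDiffOn_bq {φ : ℂ → ℝ} {f : ℂ → ℂ} {R : ℝ} (hφ : ContDiffOn ℝ ∞ φ (pdisc R))
    (hf : DifferentiableOn ℂ f (pdisc R)) : ContDiffOn ℝ ∞ (bq φ f) (pdisc R) := by
  have h1 : ContDiffOn ℝ ∞ f (pdisc R) := (hf.contDiffOn (isOpen_pdisc R)).restrict_scalars ℝ
  exact (Real.contDiff_exp.comp_contDiffOn (contDiffOn_const.mul hφ)).smul
    (contDiffOn_const.clm_comp (contDiffOn_mulLeft h1))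

theorem metric_bq_comm (φ : ℂ → ℝ) (f : ℂ → ℂ) (z v w : ℂ) :
    metric φ z (bq φ f z v) w = metric φ z v (bq φ f z w) := by
  rw [metric_comm φ z v, ← re_eq_metric_bq, ← re_eq_metric_bq, mul_right_comm]

theorem bq_apply (φ : ℂ → ℝ) (f : ℂ → ℂ) (z v : ℂ) :
    bq φ f z v = Real.exp (-2 * φ z) • (starRingEnd ℂ) (f z * v) := rfl

/-- By holomorphy the derivative of f contributes the conjugate of f'vw, symmetric in v and w. The
remaining terms in dφ, including those from the factor e^{-2φ}, cancel on antisymmetrisation by an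
identity special to dimension two. -/
theorem isCodazzi_bq {φ : ℂ → ℝ} {f : ℂ → ℂ} {R : ℝ} (hφ : ContDiffOn ℝ ∞ φ (pdisc R))
    (hf : DifferentiableOn ℂ f (pdisc R)) : IsCodazzi φ (pdisc R) (bq φ f) where
  smooth := contDiffOn_bq hφ hf
  selfAdjoint z _ v w := metric_bq_comm φ f z v w
  codazzi z hz v w := by
    have hφd : HasFDerivAt φ (fderiv ℝ φ z) z :=
      (differentiableAt_of_infty hφ (isOpen_pdisc R) hz).hasFDerivAt
    have hfd : HasDerivAt f (deriv f z) z :=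
      (hf.differentiableAt ((isOpen_pdisc R).mem_nhds hz)).hasDerivAt
    have hY : ∀ x y : ℂ, fderiv ℝ (fun ζ => bq φ f ζ x) z y
        = Real.exp (-2 * φ z) • ((starRingEnd ℂ) (deriv f z * y * x)
          - (2 * fderiv ℝ φ z y) • (starRingEnd ℂ) (f z * x)) := fun x y => by
      have h1 := (hφd.const_mul (-2)).exp
      have h2 : HasFDerivAt (fun ζ => (starRingEnd ℂ) (f ζ * x)) _ z :=
        (Complex.conjCLE : ℂ →L[ℝ] ℂ).hasFDerivAt.comp z
          ((hfd.mul_const x).hasFDerivAt.restrictScalars ℝ)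
      have e : fderiv ℝ (fun ζ => bq φ f ζ x) z = _ := (h1.smul h2).fderiv
      rw [e]
      simp
      ring
    have hsym : (inner ℝ v (bq φ f z w) : ℝ) = inner ℝ w (bq φ f z v) := by
      have := metric_bq_comm φ f z v w
      rw [metric_comm, metric, metric] at this
      exact (mul_left_cancel₀ (Real.exp_pos _).ne' this).symm
    rw [nabla, nabla, hY, hY, hsym, ← inner_gradient_left, ← inner_gradient_left,
      ← inner_gradient_left, ← inner_gradient_left, bq_apply, bq_apply]
    generalize Real.exp (-2 * φ z) = E
    generalize gradient φ z = g
    apply Complex.ext <;> simp [Complex.inner] <;> ring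

theorem norm_bq_le (φ : ℂ → ℝ) (f : ℂ → ℂ) (z : ℂ) :
    ‖bq φ f z‖ ≤ Real.exp (-φ z) ^ 2 * ‖f z‖ := by
  refine ContinuousLinearMap.opNorm_le_bound _ (by positivity) fun v => ?_
  rw [bq_apply, norm_smul, RCLike.norm_conj, norm_mul, Real.norm_of_nonneg (Real.exp_pos _).le,
    ← Real.exp_nat_mul, mul_assoc]
  apply le_of_eq
  congr 2
  push_cast
  ring

/-- A function with at most a simple pole at `0` is `O(|z|⁻¹)`. -/
theorem exists_norm_le_of_order {f : ℂ → ℂ} (hf : MeromorphicAt f 0)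
    (ho : -1 ≤ meromorphicOrderAt f 0) :
    ∃ K ρ : ℝ, 0 < K ∧ 0 < ρ ∧ ∀ z : ℂ, z ≠ 0 → ‖z‖ < ρ → ‖f z‖ ≤ K * ‖z‖⁻¹ := by
  have hid : MeromorphicAt (id : ℂ → ℂ) 0 := analyticAt_id.meromorphicAt
  have h0 : 0 ≤ meromorphicOrderAt ((id : ℂ → ℂ) * f) 0 := by
    rw [meromorphicOrderAt_mul hid hf, meromorphicOrderAt_id]
    calc (0 : WithTop ℤ) = 1 + -1 := rfl
      _ ≤ 1 + meromorphicOrderAt f 0 := by gcongr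
  obtain ⟨c, hc⟩ := (tendsto_nhds_iff_meromorphicOrderAt_nonneg (hid.mul hf)).2 h0
  have h1 : ∀ᶠ z in nhdsWithin (0 : ℂ) {0}ᶜ, ‖((id : ℂ → ℂ) * f) z‖ < ‖c‖ + 1 :=
    hc.norm.eventually_lt_const (lt_add_one _)
  rw [eventually_nhdsWithin_iff, Metric.eventually_nhds_iff] at h1
  obtain ⟨ρ, hρ, h⟩ := h1
  refine ⟨‖c‖ + 1, ρ, by positivity, hρ, fun z hz hzρ => ?_⟩
  have h2 := h (by simpa using hzρ) hz
  rw [Pi.mul_apply, norm_mul, id] at h2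
  rw [← div_eq_mul_inv, le_div_iff₀ (norm_pos_iff.2 hz), mul_comm]
  exact h2.le

/-- The factor e^{-2φ} is O(|z|^{2(1-l)}) and the pole costs |z|⁻¹. The total exponent 1 - 2l is
written as l·α with α = -2 + 1/l. -/
theorem exists_norm_bq_le {θ₀ R : ℝ} {φ : ℂ → ℝ} {f : ℂ → ℂ} (hR : 0 < R)
    (hφ : IsHyperbolicCone θ₀ R φ) (hθ : 0 < θ₀) (hf : MeromorphicAt f 0)
    (ho : -1 ≤ meromorphicOrderAt f 0) :
    ∃ C ρ : ℝ, 0 < ρ ∧ ρ < R ∧ ∀ z : ℂ, z ≠ 0 → ‖z‖ ≤ ρ → ‖bq φ f z‖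
      ≤ C * ‖z‖ ^ (θ₀ / (2 * Real.pi) * (-2 + (θ₀ / (2 * Real.pi))⁻¹)) := by
  obtain ⟨K, ρ, hK, hρ, h⟩ := exists_norm_le_of_order hf ho
  obtain ⟨c, hc, hcb⟩ := hφ.exists_bounds (half_lt_self hR)
  set l := θ₀ / (2 * Real.pi) with hl'
  have hl : 0 < l := by positivity
  have hmin : min (ρ / 2) (R / 2) < R := (min_le_right _ _).trans_lt (half_lt_self hR)
  refine ⟨c ^ 2 * K, min (ρ / 2) (R / 2), by positivity, hmin, fun z hz hzρ => ?_⟩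
  have hz0 : 0 < ‖z‖ := norm_pos_iff.2 hz
  have h1 := h z hz (hzρ.trans_lt ((min_le_left _ _).trans_lt (half_lt_self hρ)))
  have h2 := (hcb z hz (hzρ.trans (min_le_right _ _))).1
  have h3 : Real.exp (-φ z) ≤ c * ‖z‖ ^ (1 - l) := by
    rw [Real.exp_neg, inv_le_iff_one_le_mul₀ (Real.exp_pos _)]
    calc (1 : ℝ) = c * ‖z‖ ^ (1 - l) * (c⁻¹ * ‖z‖ ^ (l - 1)) := by
          rw [mul_mul_mul_comm, mul_inv_cancel₀ hc.ne', ← Real.rpow_add hz0]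
          simp
      _ ≤ _ := by gcongr
  calc ‖bq φ f z‖ ≤ Real.exp (-φ z) ^ 2 * ‖f z‖ := norm_bq_le φ f z
    _ ≤ (c * ‖z‖ ^ (1 - l)) ^ 2 * (K * ‖z‖⁻¹) := by gcongr
    _ = c ^ 2 * K * (‖z‖ ^ ((1 - l) * 2) * ‖z‖ ^ (-1 : ℝ)) := by
      rw [Real.rpow_mul hz0.le, Real.rpow_two, Real.rpow_neg_one]; ring
    _ = _ := by
      rw [← Real.rpow_add hz0, mul_add, mul_inv_cancel₀ hl.ne']
      ring_nf

/-! ### Regularity of the solution -/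

/-- The growth estimates for the solution `u` of `b = Hess u - u I`. -/
theorem exists_solution_hasConeGrowth {θ₀ R : ℝ} {φ : ℂ → ℝ} (hR : 0 < R)
    (hφ : IsHyperbolicCone θ₀ R φ) (hθ : 0 < θ₀) {b : ℂ → ℂ →L[ℝ] ℂ} {α ρ C₁ : ℝ} (hρ : 0 < ρ)
    (hρR : ρ < R) (hbC : IsCodazzi φ (pdisc R) b) (hα : -2 < α)
    (hb : ∀ z : ℂ, z ≠ 0 → ‖z‖ ≤ ρ → ‖b z‖ ≤ C₁ * ‖z‖ ^ (θ₀ / (2 * Real.pi) * α))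
    (hcase : (∀ n : ℕ, θ₀ ≠ 2 * Real.pi * n) ∨ -1 < α) :
    DeltaTrivial φ R b ∧ ∃ u : ℂ → ℝ, ContDiffOn ℝ ∞ u (pdisc R) ∧ IsHessSub φ (pdisc R) b u ∧
      (∀ ρ' < R, MemW12 φ (disc ρ') u) ∧
      ∀ γ : ℝ, 0 < γ → γ ≤ 1 → γ ≤ α + 2 → (γ < 1 ∨ -1 < α) → IsLocallyHolder φ R γ u := by
  obtain ⟨hδ, u, hu, hhess, hgr⟩ := exists_solution_of_codazzi hR hφ hθ hρ hρR hbC hα hb hcase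
  have hgrowth : ∀ γ : ℝ, 0 < γ → γ ≤ 1 → γ ≤ α + 2 → (γ < 1 ∨ -1 < α) →
      HasConeGrowth R (θ₀ / (2 * Real.pi)) γ u := fun γ h0 h1 h2 h3 => by
    obtain ⟨K, hK⟩ := hgr γ h0 h1 h2 h3
    exact hasConeGrowth_of_near hu hρ hK
  have hγ0 : 0 < min (1 / 2) (α + 2) := lt_min (by norm_num) (by linarith)
  have hγ1 : min (1 / 2) (α + 2) ≤ 1 / 2 := min_le_left _ _
  exact ⟨hδ, u, hu, hhess,
    fun ρ' hρ' => memW12_of_hasConeGrowth hR hφ hθ hγ0 hu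
      (hgrowth _ hγ0 (by linarith) (min_le_right _ _) (Or.inl (by linarith))) hρ',
    fun γ h0 h1 h2 h3 => isLocallyHolder_of_hasConeGrowth hφ hθ h0 h1 hu (hgrowth γ h0 h1 h2 h3)⟩
end

end ConeCodazzi

/-! ### The proposition and the lemma. -/

theorem mainTheorem10 :
    (∀ (θ₀ R : ℝ) (φ : ℂ → ℝ) (f : ℂ → ℂ),
      0 < θ₀ → θ₀ < 2 * Real.pi → 0 < R → ConeCodazzi.IsHyperbolicCone θ₀ R φ →
      DifferentiableOn ℂ f (ConeCodazzi.pdisc R) →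
      MeromorphicAt f 0 → -1 ≤ meromorphicOrderAt f 0 →
      ConeCodazzi.DeltaTrivial φ R (ConeCodazzi.bq φ f) ∧
      ∃ u : ℂ → ℝ, ContDiffOn ℝ ∞ u (ConeCodazzi.pdisc R) ∧
        ConeCodazzi.IsHessSub φ (ConeCodazzi.pdisc R) (ConeCodazzi.bq φ f) u ∧
        ConeCodazzi.IsLocallyHolder φ R 1 u) ∧
    (∀ (θ₀ R : ℝ) (φ : ℂ → ℝ) (b : ℂ → ℂ →L[ℝ] ℂ) (C α : ℝ),
      0 < θ₀ → 0 < R → ConeCodazzi.IsHyperbolicCone θ₀ R φ →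
      ConeCodazzi.IsCodazzi φ (ConeCodazzi.pdisc R) b →
      -2 < α →
      (∀ z ∈ ConeCodazzi.pdisc R,
        ConeCodazzi.opNorm (b z) < C * ConeCodazzi.coneDist φ R z ^ α) →
      ((∀ n : ℕ, θ₀ ≠ 2 * Real.pi * n) ∨ -1 < α) →
      ConeCodazzi.DeltaTrivial φ R b ∧
      ∃ u : ℂ → ℝ, ContDiffOn ℝ ∞ u (ConeCodazzi.pdisc R) ∧
        ConeCodazzi.IsHessSub φ (ConeCodazzi.pdisc R) b u ∧
        (∀ ρ < R, ConeCodazzi.MemW12 φ (ConeCodazzi.disc ρ) u) ∧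
        (∀ γ : ℝ, 0 < γ → γ < 1 → γ ≤ α + 2 → ConeCodazzi.IsLocallyHolder φ R γ u) ∧
        (-1 < α → ConeCodazzi.IsLocallyHolder φ R 1 u)) := by
  refine ⟨fun θ₀ R φ f hθ hθ2 hR hφ hf hm ho => ?_,
    fun θ₀ R φ b C α hθ hR hφ hbC hα hb hcase => ?_⟩
  · obtain ⟨C, ρ, hρ, hρR, hb⟩ := ConeCodazzi.exists_norm_bq_le hR hφ hθ hm ho
    have hl : 0 < θ₀ / (2 * Real.pi) := by positivity
    have hl1 : 1 < (θ₀ / (2 * Real.pi))⁻¹ :=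
      (one_lt_inv₀ hl).2 ((div_lt_one (by positivity)).2 hθ2)
    -- The angle condition means l < 1, which puts b_q in the range α > -1, where F converges, u is
    -- Lipschitz and no condition on the holonomy is required.
    have hα : -1 < -2 + (θ₀ / (2 * Real.pi))⁻¹ := by linarith
    obtain ⟨hδ, u, hu, hhess, -, hh⟩ := ConeCodazzi.exists_solution_hasConeGrowth hR hφ hθ hρ hρR
      (ConeCodazzi.isCodazzi_bq hφ.smooth hf) (by linarith) hb (Or.inr hα)
    exact ⟨hδ, u, hu, hhess, hh 1 one_pos le_rfl (by linarith) (Or.inr hα)⟩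
  · obtain ⟨C₁, hC₁⟩ := ConeCodazzi.exists_norm_le_of_opNorm hφ hθ hbC.selfAdjoint hb (half_pos hR)
      (half_lt_self hR)
    obtain ⟨hδ, u, hu, hhess, hw, hh⟩ := ConeCodazzi.exists_solution_hasConeGrowth hR hφ hθ
      (half_pos hR) (half_lt_self hR) hbC hα hC₁ hcase
    exact ⟨hδ, u, hu, hhess, hw, fun γ h0 h1 h2 => hh γ h0 h1.le h2 (Or.inl h1),
      fun h => hh 1 one_pos le_rfl (by linarith) (Or.inr h)⟩
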